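/- **Setting.** Let $\mathcal O$ be a discrete valuation ring with maximal ideal $\pi\mathcal O$, finite residue field of order $q$ and fraction field $K$ (for example the valuation ring of a finite extension $K/\mathbb Q_p$). Let $\Delta$ be the ($\widetilde A_2$) Bruhat–Tits building of $SL_3(K)$: its vertices are the full rank $\mathcal O$-lattices in $K^3$ up to homothety, two distinct vertices being joined by an edge if they have representatives with $\mathcal L_1\supseteq\mathcal L_2\supseteq\pi\mathcal L_1$; its chambers are the triples of pairwise adjacent vertices; its apartments are given by the bases of $K^3$. Let $\widetilde W=\langle s_0,s_1,s_2\mid s_i^2=(s_is_j)^3=1\ (i\ne j)\rangle$, let $\delta$ be the $\widetilde W$-valued distance between chambers ($\delta(D,E)=s_{i_1}\cdots s_{i_r}$ for any minimal gallery $D\sim_{i_1}\cdots\sim_{i_r}E$, where $\sim_i$ means sharing the edge opposite to the vertex of type $i$), and let $d(D,E)$ be the length of a minimal gallery. Fix a chamber $C$ with vertices $v_0,v_1,v_2$ (in any order) and an apartment $\mathcal A$ containing $C$. Let $\Delta_n$ be the set of vertices lying in a chamber $D$ with $d(D,C)\le n$, $\Delta_{-1}=\varnothing$, and $P(n)=\Delta_n\setminus\Delta_{n-1}$.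 A vertex $x\in P(n)$ is a *peak* of $\Delta_n$, with *summit* $D$, if $D$ is the unique chamber containing $x$ with $d(D,C)=n$ and, when $n>0$, the *base* $D\setminus\{x\}$ consists exactly of the neighbours of $x$ in $\Delta_{n-1}$. Let $X_{i,n}$ be the set of vertices at graph distance at most $\lceil n/2\rceil$ from $v_i$ if $n$ is even, and from both $v_k$, $k\neq i$, if $n$ is odd. For $n\ge1$ let $\mathrm{Crown}(X_{i,n})$ be the set of summits of $\Delta_n$ all of whose vertices lie in $X_{i,n}$, and let $\mathrm{Crown}(X_{i,0})=\{C\}$. Label the chambers of $\mathrm{Crown}(X_{i,n})$ lying in $\mathcal A$ as $D^{(n)}_{1,i},\dots,D^{(n)}_{\lfloor n/2\rfloor+1,i}$ so that consecutive ones have peaks joined by an edge and, for $n\geq 1$ and $\{a<b\}=\{0,1,2\}\setminus\{i\}$, the base of the first one is an edge of a chamber in $\mathrm{Crown}(X_{a,n-1})$ and the base of the last one is an edge of a chamber in $\mathrm{Crown}(X_{b,n-1})$. Put $S^{(n)}_{j,i}=\{D:\delta(D,C)=\delta(D^{(n)}_{j,i},C)\}$, $S^{(n)}_j=S^{(n)}_{j,0}$,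 and let $P^{(n)}_j$ be the set of peaks of the summits of $\Delta_n$ in $S^{(n)}_j$. **Theorem.** Such a labelling exists for all $i$ and $n$. For any such labelling and each $n\ge 1$, with $m=\lfloor n/2\rfloor$, $$\mathrm{Crown}(X_{0,n})=S_1^{(n)}\sqcup\dots\sqcup S_{m+1}^{(n)}.$$ Moreover, for each $j=1,\dots,m+1$: 1. For $v\in P_j^{(n)}$, every vertex of $P(n)$ adjacent to $v$ lies in $P_{j-1}^{(n)}$ (with $j>1$) or in $P_{j+1}^{(n)}$ (with $j<m+1$). 2. For $v\in P_j^{(n)}$, no two distinct neighbours of $v$ in $P(n)$ have summits with the same base. 3. If $1<j<m+1$, then the base of every $D\in S_j^{(n)}$ joins a vertex of $P_{j-1}^{(n-2)}$ to a vertex of $P_j^{(n-2)}$. 4. If $j=1$ (resp. $j=m+1$), then the base of every $D\in S_j^{(n)}$ is an edge of a summit of $\Delta_{n-1}$ in $S_{1,1}^{(n-1)}$ (resp. in $S_{1,2}^{(n-1)}$). 5. Each $v\in P_j^{(n)}$ is joined to exactly $q$ vertices of $P_{j+1}^{(n)}$ if $j<m+1$, and to exactly $q$ vertices of $P_{j-1}^{(n)}$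 if $j>1$. 6. $|S_j^{(n)}|=|P_j^{(n)}|=q^n$. -/

import Mathlib

open scoped Pointwise

noncomputable section

namespace A2Building

section Building

variable (O K : Type*) [CommRing O] [IsDomain O] [IsDiscreteValuationRing O]
  [Field K] [Algebra O K] [IsFractionRing O K]

/-- Full rank `O`-lattices in `K ^ 3`. -/
abbrev Lat : Type _ := {M : Submodule O (Fin 3 → K) // M.IsLattice K}

/-- Homothety of lattices: `M = a N` for some `a ∈ Kˣ`. -/
instance homothety : Setoid (Lat O K) where
  r M N := ∃ a : Kˣ, (M.1 : Submodule O (Fin 3 → K)) = a • N.1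
  iseqv :=
    { refl := fun M => ⟨1, (one_smul _ _).symm⟩
      symm := by
        rintro M N ⟨a, h⟩
        exact ⟨a⁻¹, by rw [h, inv_smul_smul]⟩
      trans := by
        rintro M N P ⟨a, h⟩ ⟨b, h'⟩
        exact ⟨a * b, by rw [h, h', mul_smul]⟩ }

/-- Vertices of the building of `SL₃(K)`: lattices in `K ^ 3` up to homothety. -/
abbrev Vertex : Type _ := Quotient (homothety O K)

variable {O K}

/-- The vertex `x` is the homothety class of `M`. -/
def Represents (M : Submodule O (Fin 3 → K)) (x : Vertex O K) : Prop :=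
  ∃ h : M.IsLattice K, (⟦⟨M, h⟩⟧ : Vertex O K) = x

theorem Represents.smul {M : Submodule O (Fin 3 → K)} {x : Vertex O K}
    (h : Represents M x) (a : Kˣ) : Represents (a • M) x := by
  obtain ⟨hM, rfl⟩ := h
  have := hM
  exact ⟨inferInstance, Quotient.sound ⟨a, rfl⟩⟩

variable (O K)

/-- The 1-skeleton of the building. Two distinct vertices are joined by an edge if they have
representatives `M`, `N` with `π M ⊆ N ⊆ M`. -/
def graph : SimpleGraph (Vertex O K) where
  Adj x y := x ≠ y ∧ ∃ M N : Submodule O (Fin 3 → K), Represents M x ∧ Represents N y ∧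
    N ≤ M ∧ IsLocalRing.maximalIdeal O • M ≤ N
  symm := ⟨by
    rintro x y ⟨hxy, M, N, hM, hN, hNM, hMN⟩
    obtain ⟨ϖ, hϖ⟩ := IsDiscreteValuationRing.exists_irreducible O
    have hne : algebraMap O K ϖ ≠ 0 := by
      simpa using hϖ.ne_zero
    have key : ∀ P : Submodule O (Fin 3 → K),
        Units.mk0 _ hne • P = IsLocalRing.maximalIdeal O • P := by
      intro P
      rw [hϖ.maximalIdeal_eq, Submodule.ideal_span_singleton_smul]
      ext z
      simp only [Submodule.mem_smul_pointwise_iff_exists]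
      constructor
      · rintro ⟨p, hp, rfl⟩
        exact ⟨p, hp, (algebraMap_smul K ϖ p).symm⟩
      · rintro ⟨p, hp, rfl⟩
        exact ⟨p, hp, algebraMap_smul K ϖ p⟩
    refine ⟨hxy.symm, N, Units.mk0 _ hne • M, hN, hM.smul _, ?_, ?_⟩
    · rw [key]; exact hMN
    · rw [key]; exact Submodule.smul_mono le_rfl hNM⟩
  loopless := ⟨fun _ h => h.1 rfl⟩

/-- Chambers: the 2-simplices, i.e. triples of pairwise adjacent vertices. -/
abbrev Chamber : Type _ := {s : Finset (Vertex O K) // (graph O K).IsNClique 3 s}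

variable {O K}

/-- The type of a vertex: `x` has type `i` if it is the class of a lattice having an `O`-basis
with determinant `π ^ i` for some uniformizer `π`. (The three types are the three orbits of
`SL₃(K)` on the vertices.) -/
def HasType (i : Fin 3) (x : Vertex O K) : Prop :=
  ∃ (ϖ : O) (b : Matrix (Fin 3) (Fin 3) K), Irreducible ϖ ∧
    b.det = algebraMap O K ϖ ^ (i : ℕ) ∧ Represents (Submodule.span O (Set.range b.row)) x

/-- The adjacency relation `D ∼ᵢ E` of the chamber system: the distinct chambers `D` and `E`
share the edge opposite to their vertices of type `i`. -/
def AdjType (i : Fin 3) (D E : Chamber O K) : Prop :=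
  D ≠ E ∧ ∀ x, ¬ HasType i x → (x ∈ D.1 ↔ x ∈ E.1)

/-- `IsGallery D E ω`: there is a gallery `D = D₀ ∼ D₁ ∼ ⋯ ∼ Dᵣ = E` of type
`ω = [i₁, …, iᵣ]`. -/
inductive IsGallery : Chamber O K → Chamber O K → List (Fin 3) → Prop
  | nil (D : Chamber O K) : IsGallery D D []
  | cons {D D' E : Chamber O K} {i : Fin 3} {ω : List (Fin 3)} :
      AdjType i D D' → IsGallery D' E ω → IsGallery D E (i :: ω)

/-- The distance between two chambers: the length of a minimal gallery. -/
def dist (D E : Chamber O K) : ℕ :=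
  sInf {r | ∃ ω, IsGallery D E ω ∧ ω.length = r}

/-- The Coxeter matrix of type `Ã₂`. -/
def coxeterMatrix : CoxeterMatrix (Fin 3) where
  M := Matrix.of fun i j => if i = j then 1 else 3
  isSymm := by ext i j; simp [eq_comm]
  diagonal := by simp
  off_diagonal := by intro i j h; simp [h]

/-- The affine Weyl group of type `Ã₂`. -/
abbrev AffineWeyl : Type := coxeterMatrix.Group

/-- The Weyl distance `δ(D, E) = s_{i₁} ⋯ s_{iᵣ}`, where `[i₁, …, iᵣ]` is the type of a minimal
gallery from `D` to `E` (`δ(D, E)` does not depend on which one is taken). -/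
def weylDist (D E : Chamber O K) : AffineWeyl :=
  coxeterMatrix.toCoxeterSystem.wordProd
    (Classical.epsilon fun ω => IsGallery D E ω ∧ ω.length = dist D E)

/-- The `w`-sphere around `C`. -/
def weylSphere (C : Chamber O K) (w : AffineWeyl) : Set (Chamber O K) :=
  {D | weylDist D C = w}

/-- The vertices of the apartment attached to a basis (frame) `b` of `K ^ 3`: the classes of the
lattices `O a₁ b₁ + O a₂ b₂ + O a₃ b₃` with `a₁, a₂, a₃ ∈ Kˣ`. -/
def apartment (b : Module.Basis (Fin 3) K (Fin 3 → K)) : Set (Vertex O K) :=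
  {x | ∃ a : Fin 3 → Kˣ, Represents (Submodule.span O (Set.range fun i => a i • b i)) x}

/-- The vertices that lie in a chamber at distance `< n` from `C`. -/
def regionLT (C : Chamber O K) (n : ℕ) : Set (Vertex O K) :=
  {x | ∃ D : Chamber O K, x ∈ D.1 ∧ dist D C < n}

/-- The region `Δₙ`: the vertices that lie in a chamber at distance `≤ n` from `C`. -/
def region (C : Chamber O K) (n : ℕ) : Set (Vertex O K) :=
  {x | ∃ D : Chamber O K, x ∈ D.1 ∧ dist D C ≤ n}

/-- `P(n) = Δₙ ∖ Δₙ₋₁`, where `Δ₋₁ = ∅`. -/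
def newVertices (C : Chamber O K) (n : ℕ) : Set (Vertex O K) :=
  region C n \ regionLT C n

/-- The edge of the chamber `D` opposite to its vertex `x`, as a set of vertices. -/
def base (D : Chamber O K) (x : Vertex O K) : Set (Vertex O K) := {y | y ∈ D.1 ∧ y ≠ x}

/-- `x` is a peak of `Δₙ` and `D` is the summit of `Δₙ` at `x`: `x ∈ P(n)`, `D` is the unique
chamber at distance `n` from `C` that contains `x`, and (for `n > 0`) the two other vertices of
`D` are exactly the neighbours of `x` in `Δₙ₋₁`. -/
structure IsSummitAt (C : Chamber O K) (n : ℕ) (D : Chamber O K) (x : Vertex O K) : Prop where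
  mem_new : x ∈ newVertices C n
  mem : x ∈ D.1
  dist_eq : dist D C = n
  unique : ∀ E : Chamber O K, x ∈ E.1 → dist E C = n → E = D
  base_eq : 0 < n → base D x = {y | y ∈ regionLT C n ∧ (graph O K).Adj x y}

/-- `S(n)`, the set of summits of `Δₙ`. -/
def summits (C : Chamber O K) (n : ℕ) : Set (Chamber O K) :=
  {D | ∃ x, IsSummitAt C n D x}

/-- `X_{i,n}`, for `v₀, v₁, v₂` the vertices of `C`. Here `(n + 1) / 2 = ⌈n / 2⌉`. -/
def X (v : Fin 3 → Vertex O K) (i : Fin 3) (n : ℕ) : Set (Vertex O K) :=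
  {x | if Even n then (graph O K).dist x (v i) ≤ (n + 1) / 2
    else ∀ k, k ≠ i → (graph O K).dist x (v k) ≤ (n + 1) / 2}

/-- `Crown(X_{i,n})`: the summits of `Δₙ` all of whose vertices lie in `X_{i,n}`; for `n = 0` it
is `{C}`. -/
def crown (C : Chamber O K) (v : Fin 3 → Vertex O K) (i : Fin 3) (n : ℕ) : Set (Chamber O K) :=
  if n = 0 then {C} else {D | D ∈ summits C n ∧ ∀ x ∈ D.1, x ∈ X v i n}

/-- The base of the summit `D` of `Δₙ` is an edge of the chamber `E`. -/
def IsBasedAt (C : Chamber O K) (n : ℕ) (D E : Chamber O K) : Prop :=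
  ∃ x, IsSummitAt C n D x ∧ base D x ⊆ {y | y ∈ E.1}

/-- The crown that the first chamber in the labelling of a crown of `X_{i,n}` faces. -/
def firstFace : Fin 3 → Fin 3 := ![1, 0, 0]

/-- The crown that the last chamber in the labelling of a crown of `X_{i,n}` faces. -/
def lastFace : Fin 3 → Fin 3 := ![2, 2, 1]

/-- `D i n 1, …, D i n (⌊n / 2⌋ + 1)` is the labelling of the chambers of `Crown(X_{i,n})` in the
apartment `A`, for all `i` and `n`: consecutive chambers have peaks joined by an edge, and,
writing `{a < b}` for the two indices other than `i`, the first chamber is based at a summit in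
`Crown(X_{a,n-1})` and the last one at a summit in `Crown(X_{b,n-1})`. -/
structure IsCrownLabelling (C : Chamber O K) (v : Fin 3 → Vertex O K) (A : Set (Vertex O K))
    (D : Fin 3 → ℕ → ℕ → Chamber O K) : Prop where
  bijOn : ∀ i n, Set.BijOn (D i n) (Set.Icc 1 (n / 2 + 1))
    {E | E ∈ crown C v i n ∧ ∀ x ∈ E.1, x ∈ A}
  joined : ∀ i n, ∀ j ∈ Set.Icc 1 (n / 2), ∃ x y, IsSummitAt C n (D i n j) x ∧
    IsSummitAt C n (D i n (j + 1)) y ∧ (graph O K).Adj x y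
  first : ∀ i n, 0 < n → ∃ E ∈ crown C v (firstFace i) (n - 1), IsBasedAt C n (D i n 1) E
  last : ∀ i n, 0 < n →
    ∃ E ∈ crown C v (lastFace i) (n - 1), IsBasedAt C n (D i n (n / 2 + 1)) E

/-- The set of peaks of the summits of `Δₙ` that lie in `S`. -/
def peaks (C : Chamber O K) (n : ℕ) (S : Set (Chamber O K)) : Set (Vertex O K) :=
  {x | ∃ D ∈ S, IsSummitAt C n D x}

end Building

end A2Building

end

noncomputable section

set_option linter.unusedSectionVars false

namespace A2Building

/-! ### Lattice chains and the jumps they induce on a lattice -/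

section Filtration

variable (O K : Type*) [CommRing O] [IsDomain O] [IsDiscreteValuationRing O]
  [Field K] [Algebra O K] [IsFractionRing O K]

/-! Choose a basis of the apartment adapted to `C` and a uniformizer `π`. The lattices representing
the vertices of `C` form a chain `L i` with `L (i + 3) = π L i` and one-dimensional quotients. A
lattice `M` is recorded by its jumps, the `i` with `M ∩ L i ≠ M ∩ L (i + 1)`: three progressions `a
+ 3ℕ`, `b + 3ℕ`, `c + 3ℕ` with distinct residues modulo 3 (`Filtration.Pos`). A chamber is a flag
`M₀ > M₁ > M₂ > πM₀`; each inclusion loses exactly one of these jumps, so the chamber puts them in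
an order and yields the window of an affine permutation. Crossing a panel either fixes the window or
applies a simple reflection. Hence the distance to `C` is the number of inversions `len`, and the
Weyl distance to `C` carries the same information as the window (`IsAdapted.dist_eq`,
`IsAdapted.weylDist_eq_iff`).

Among the chambers at a vertex with jumps `a, b, c`, the unique nearest one loses the jumps in
increasing order; its distance is `lev a b c`. So every vertex is a peak of the region in which it
first appears (`IsAdapted.isSummitAt_iff`). The increasing triples of level `n` are `a`, `a + 1 + e
+ 3k`, `a + 2 + 2e + 3⌊n/2⌋` with `e = n mod 2` and `0 ≤ k ≤ ⌊n/2⌋`. Up to homothety this gives, for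
each residue of `a` modulo 3, a row of `⌊n/2⌋ + 1` positions, the sites. Graph distances to the
vertices of `C` show that the three rows are the three crowns (`Filtration.Summit.mem_X_iff`).

A neighbour of a vertex arises by raising a proper nonempty subset of its jumps by 3. Raising `a`,
or `a` and `b`, lowers the level and gives the base. Raising `b`, or `a` and `c`, replaces `k` by `k
+ 1` or `k - 1` and can preserve the level. The other choices raise it. This yields the adjacencies
and the shape of the bases. All counts come from one fact: lines in a residue plane that avoid a
prescribed line are `q` in number (`Filtration.ncard_between`). Applied across panels it gives `q ^
len` chambers for each window.

For the labelling, adjacency of consecutive peaks forces `k` to run monotonically along the row, and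
the condition on the first chamber fixes the direction (`IsCrownLabelling.exists_site`). -/

/-- A periodic complete lattice chain in `K ^ 3`, indexed by `ℤ`, with one-dimensional
graded pieces. -/
structure Filtration where
  /-- a uniformizer -/
  ϖ : O
  irr : Irreducible ϖ
  /-- the lattices of the chain -/
  L : ℤ → Submodule O (Fin 3 → K)
  succ_le : ∀ i, L (i + 1) ≤ L i
  smul_mem_iff : ∀ i x, ϖ • x ∈ L (i + 3) ↔ x ∈ L i
  exists_jump : ∀ x, x ≠ 0 → ∃ i, x ∈ L i ∧ x ∉ L (i + 1)
  exists_sub_mem : ∀ i x y, x ∈ L i → y ∈ L i → y ∉ L (i + 1) → ∃ r : O, x - r • y ∈ L (i + 1)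
  exists_mem : ∀ i, ∃ x, x ∈ L i ∧ x ∉ L (i + 1)
  isLattice : ∀ i, (L i).IsLattice K

namespace Filtration

variable {O K} (F : Filtration O K)

/-- The uniformizer as a unit of `K`. -/
def u : Kˣ := Units.mk0 (algebraMap O K F.ϖ) (by simpa using F.irr.ne_zero)

theorem u_smul (x : Fin 3 → K) : F.u • x = F.ϖ • x := algebraMap_smul K F.ϖ x

theorem mem_units_smul' {a : Kˣ} {M : Submodule O (Fin 3 → K)} {x : Fin 3 → K} :
    x ∈ a • M ↔ ∃ y ∈ M, a • y = x :=
  Submodule.mem_smul_pointwise_iff_exists x a M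

theorem smul_mem_units_smul {a : Kˣ} {M : Submodule O (Fin 3 → K)} {x : Fin 3 → K} (hx : x ∈ M) :
    a • x ∈ a • M :=
  mem_units_smul'.2 ⟨x, hx, rfl⟩

theorem mem_u_smul {M : Submodule O (Fin 3 → K)} {x : Fin 3 → K} :
    x ∈ F.u • M ↔ ∃ y ∈ M, F.ϖ • y = x := by
  simp only [mem_units_smul', F.u_smul]

theorem u_smul_eq (M : Submodule O (Fin 3 → K)) :
    F.u • M = IsLocalRing.maximalIdeal O • M := by
  rw [F.irr.maximalIdeal_eq, Submodule.ideal_span_singleton_smul]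
  ext z
  rw [F.mem_u_smul, Submodule.mem_smul_pointwise_iff_exists]

theorem u_smul_le (M : Submodule O (Fin 3 → K)) : F.u • M ≤ M := by
  intro x hx
  obtain ⟨y, hy, rfl⟩ := F.mem_u_smul.1 hx
  exact M.smul_mem _ hy

theorem mem_units_smul {a : Kˣ} {M : Submodule O (Fin 3 → K)} {x : Fin 3 → K} :
    x ∈ a • M ↔ a⁻¹ • x ∈ M := by
  rw [mem_units_smul']
  exact ⟨fun ⟨y, hy, h⟩ => by rwa [← h, inv_smul_smul], fun h => ⟨_, h, smul_inv_smul _ _⟩⟩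

theorem units_smul_le {a : Kˣ} {M N : Submodule O (Fin 3 → K)} (h : M ≤ N) : a • M ≤ a • N :=
  fun _ hx => mem_units_smul.2 (h (mem_units_smul.1 hx))

theorem units_smul_le_iff {a : Kˣ} {M N : Submodule O (Fin 3 → K)} : a • M ≤ a • N ↔ M ≤ N :=
  ⟨fun h => by simpa using units_smul_le (a := a⁻¹) h, units_smul_le⟩

theorem units_smul_lt_iff {a : Kˣ} {M N : Submodule O (Fin 3 → K)} : a • M < a • N ↔ M < N := by
  simp only [lt_iff_le_not_ge, units_smul_le_iff]

theorem L_antitone : Antitone F.L := antitone_int_of_succ_le F.succ_le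

theorem u_smul_L (i : ℤ) : F.u • F.L i = F.L (i + 3) := by
  ext x
  rw [mem_units_smul, ← F.smul_mem_iff i, ← F.u_smul, smul_inv_smul]

theorem zpow_smul_L (k i : ℤ) : F.u ^ k • F.L i = F.L (i + 3 * k) := by
  induction k using Int.induction_on with
  | zero => simp
  | succ k ih =>
    rw [zpow_add_one, mul_comm, mul_smul, ih, u_smul_L]
    congr 1; ring
  | pred k ih =>
    rw [zpow_sub_one, mul_comm, mul_smul, ih, inv_smul_eq_iff, u_smul_L]
    congr 1; ring

theorem mem_L_of_lt {i j : ℤ} {x : Fin 3 → K} (hx : x ∈ F.L i) (hij : j ≤ i) : x ∈ F.L j :=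
  F.L_antitone hij hx

theorem lt_of_mem_of_notMem {i j : ℤ} {x : Fin 3 → K} (hx : x ∈ F.L i) (hy : x ∉ F.L j) :
    i < j := by
  by_contra! h
  exact hy (F.mem_L_of_lt hx h)

/-- A scalar is a power of the uniformizer times a unit of `O`, and the unit preserves every
`O`-submodule. Thus homothety classes are orbits of the powers of `F.u`. -/
theorem unit_smul_zpow (a : Kˣ) : ∃ k : ℤ, ∀ M : Submodule O (Fin 3 → K), a • M = F.u ^ k • M := by
  obtain ⟨k, v, h⟩ := IsDiscreteValuationRing.exists_units_eq_smul_zpow_of_irreducible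
    F.irr a.ne_zero
  refine ⟨k, fun M => ?_⟩
  have key : ∀ x : Fin 3 → K, a • x = (v : O) • (F.u ^ k • x) := by
    intro x
    rw [Units.smul_def, h, Units.smul_def v, smul_assoc]
    congr 1
    rw [Units.smul_def, Units.val_zpow_eq_zpow_val]; rfl
  ext x
  simp only [mem_units_smul']
  constructor
  · rintro ⟨y, hy, rfl⟩
    refine ⟨(v : O) • y, M.smul_mem _ hy, ?_⟩
    rw [key, smul_comm]
  · rintro ⟨y, hy, rfl⟩
    refine ⟨((v⁻¹ : Oˣ) : O) • y, M.smul_mem _ hy, ?_⟩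
    rw [key, smul_comm (F.u ^ k) _ y, smul_smul, Units.mul_inv, one_smul]

/-- The set of jumps of the intersections of a submodule with the filtration. -/
def jumps (M : Submodule O (Fin 3 → K)) : Set ℤ := {i | ∃ x ∈ M, x ∈ F.L i ∧ x ∉ F.L (i + 1)}

variable {F}

theorem jumps_mono {M N : Submodule O (Fin 3 → K)} (h : M ≤ N) : F.jumps M ⊆ F.jumps N :=
  fun _ ⟨x, hx, h'⟩ => ⟨x, h hx, h'⟩

theorem mem_jumps_zpow_smul {M : Submodule O (Fin 3 → K)} {k i : ℤ} :
    i ∈ F.jumps (F.u ^ k • M) ↔ i - 3 * k ∈ F.jumps M := by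
  have key : ∀ (x : Fin 3 → K) (j : ℤ), F.u ^ k • x ∈ F.L (j + 3 * k) ↔ x ∈ F.L j := by
    intro x j
    rw [← F.zpow_smul_L, mem_units_smul, inv_smul_smul]
  constructor
  · rintro ⟨x, hx, h1, h2⟩
    obtain ⟨y, hy, rfl⟩ := mem_units_smul'.1 hx
    refine ⟨y, hy, ?_, ?_⟩
    · rw [← key]; convert h1 using 2; ring
    · rw [← key]; convert h2 using 3; ring
  · rintro ⟨y, hy, h1, h2⟩
    refine ⟨F.u ^ k • y, smul_mem_units_smul hy, ?_, ?_⟩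
    · rw [← key] at h1; convert h1 using 2; ring
    · rw [← key] at h2; convert h2 using 3; ring

theorem mem_jumps_u_smul {M : Submodule O (Fin 3 → K)} {i : ℤ} :
    i ∈ F.jumps (F.u • M) ↔ i - 3 ∈ F.jumps M := by
  simpa using mem_jumps_zpow_smul (F := F) (M := M) (k := 1) (i := i)

theorem add_three_mem_jumps {M : Submodule O (Fin 3 → K)} {i : ℤ} (h : i ∈ F.jumps M) :
    i + 3 ∈ F.jumps M :=
  jumps_mono (F.u_smul_le M) (mem_jumps_u_smul.2 (by simpa using h))

theorem jumps_L (i : ℤ) : F.jumps (F.L i) = Set.Ici i := by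
  ext j
  constructor
  · rintro ⟨x, hx, -, h⟩
    have := F.lt_of_mem_of_notMem hx h
    simp only [Set.mem_Ici]; omega
  · intro h
    obtain ⟨x, h1, h2⟩ := F.exists_mem j
    exact ⟨x, F.mem_L_of_lt h1 h, h1, h2⟩

theorem exists_mem_L (F : Filtration O K) (x : Fin 3 → K) : ∃ i, x ∈ F.L i := by
  by_cases hx : x = 0
  · exact ⟨0, hx ▸ Submodule.zero_mem _⟩
  · exact (F.exists_jump x hx).imp fun _ => And.left

theorem exists_le_L {M : Submodule O (Fin 3 → K)} (hM : M.FG) : ∃ i, M ≤ F.L i := by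
  classical
  obtain ⟨s, rfl⟩ := hM
  induction s using Finset.induction_on with
  | empty => exact ⟨0, by simp⟩
  | insert a s _ ih =>
    obtain ⟨i, hi⟩ := ih
    obtain ⟨j, hj⟩ := F.exists_mem_L a
    refine ⟨min i j, Submodule.span_le.2 ?_⟩
    intro x hx
    rw [Finset.coe_insert, Set.mem_insert_iff] at hx
    rcases hx with rfl | hx
    · exact F.mem_L_of_lt hj (min_le_right _ _)
    · exact F.mem_L_of_lt (hi (Submodule.subset_span hx)) (min_le_left _ _)

theorem exists_pow_smul_mem {M : Submodule O (Fin 3 → K)}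
    (hM : Submodule.span K (M : Set (Fin 3 → K)) = ⊤) (x : Fin 3 → K) :
    ∃ n : ℕ, F.ϖ ^ n • x ∈ M := by
  have hx : x ∈ Submodule.span K (M : Set (Fin 3 → K)) := hM ▸ Submodule.mem_top
  induction hx using Submodule.span_induction with
  | mem x hx => exact ⟨0, by simpa using hx⟩
  | zero => exact ⟨0, by simp⟩
  | add x y _ _ hx hy =>
    obtain ⟨n, hn⟩ := hx
    obtain ⟨k, hk⟩ := hy
    refine ⟨n + k, ?_⟩
    rw [smul_add]
    refine add_mem ?_ ?_
    · rw [add_comm, pow_add, mul_smul]; exact M.smul_mem _ hn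
    · rw [pow_add, mul_smul]; exact M.smul_mem _ hk
  | smul a x _ hx =>
    obtain ⟨n, hn⟩ := hx
    obtain ⟨r, s, hs, rfl⟩ := IsFractionRing.div_surjective (A := O) a
    obtain ⟨k, v, hv⟩ := IsDiscreteValuationRing.eq_unit_mul_pow_irreducible
      (nonZeroDivisors.ne_zero hs) F.irr
    refine ⟨n + k, ?_⟩
    have h : F.ϖ ^ (n + k) • ((algebraMap O K r / algebraMap O K s) • x) =
        (r * ((v⁻¹ : Oˣ) : O)) • (F.ϖ ^ n • x) := by
      have hs0 : algebraMap O K s ≠ 0 := by simpa using nonZeroDivisors.ne_zero hs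
      rw [← algebraMap_smul K (F.ϖ ^ (n + k)), ← algebraMap_smul K (F.ϖ ^ n) x,
        ← algebraMap_smul K (r * _), smul_smul, smul_smul]
      congr 1
      have h1 : s * ((v⁻¹ : Oˣ) : O) = F.ϖ ^ k := by
        rw [hv, mul_comm, ← mul_assoc, Units.inv_mul, one_mul]
      rw [pow_add, ← h1]
      simp only [map_mul]
      field_simp
    rw [h]
    exact M.smul_mem _ hn

theorem exists_L_le {M : Submodule O (Fin 3 → K)} (hM : M.IsLattice K) : ∃ i, F.L i ≤ M := by
  have key : ∀ N : Submodule O (Fin 3 → K), N.FG → ∃ n : ℕ, F.u ^ (n : ℤ) • N ≤ M := by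
    classical
    rintro N ⟨s, rfl⟩
    induction s using Finset.induction_on with
    | empty => exact ⟨0, by simp⟩
    | insert a s _ ih =>
      obtain ⟨i, hi⟩ := ih
      obtain ⟨j, hj⟩ := exists_pow_smul_mem (F := F) hM.span_eq_top a
      have hpow : ∀ (l : ℕ) (x : Fin 3 → K), F.u ^ (l : ℤ) • x = F.ϖ ^ l • x := by
        intro l x
        rw [zpow_natCast, Units.smul_def, Units.val_pow_eq_pow_val]
        change (algebraMap O K F.ϖ ^ l) • x = _
        rw [← map_pow, algebraMap_smul]
      refine ⟨i + j, ?_⟩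
      intro y hy
      rw [mem_units_smul] at hy
      have hsp : Submodule.span O ((insert a s : Finset _) : Set (Fin 3 → K)) ≤
          F.u ^ (-((i + j : ℕ) : ℤ)) • M := by
        rw [Submodule.span_le]
        intro x hx
        rw [SetLike.mem_coe, mem_units_smul, ← zpow_neg, neg_neg]
        rw [hpow]
        rw [Finset.coe_insert, Set.mem_insert_iff] at hx
        rcases hx with rfl | hx
        · rw [pow_add, mul_smul]; exact M.smul_mem _ hj
        · rw [add_comm, pow_add, mul_smul]
          refine M.smul_mem _ (hi ?_)
          rw [← hpow]
          exact smul_mem_units_smul (Submodule.subset_span hx)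
      have := hsp hy
      rwa [mem_units_smul, ← zpow_neg, neg_neg, smul_inv_smul] at this
  obtain ⟨n, hn⟩ := key (F.L 0) (F.isLattice 0).fg
  exact ⟨0 + 3 * n, by rw [← F.zpow_smul_L]; exact hn⟩

/-- Successive approximation: the elements of `M` lie in `N` up to `F.L i`. -/
theorem le_sup_inf_of_jumps_subset {M N : Submodule O (Fin 3 → K)} (hNM : N ≤ M)
    {i j : ℤ} (hM : M ≤ F.L i) (h : ∀ t ∈ F.jumps M, t < j → t ∈ F.jumps N) :
    M ≤ N ⊔ (M ⊓ F.L j) := by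
  -- Induction on the distance of `x` from `L j`: at a common jump a multiple of some `y ∈ N` can be
  -- subtracted to move one step down the chain.
  have key : ∀ n : ℕ, ∀ x ∈ M, x ∈ F.L (j - n) → x ∈ N ⊔ (M ⊓ F.L j) := by
    intro n
    induction n with
    | zero => exact fun x hx hx' => Submodule.mem_sup_right ⟨hx, by simpa using hx'⟩
    | succ n ih =>
      intro x hx hx'
      by_cases hx1 : x ∈ F.L (j - n)
      · exact ih x hx hx1
      have e : j - ((n + 1 : ℕ) : ℤ) + 1 = j - n := by push_cast; ring
      obtain ⟨y, hy, hy1, hy2⟩ := h (j - (n + 1 : ℕ)) ⟨x, hx, hx', by rwa [e]⟩ (by omega)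
      obtain ⟨r, hr⟩ := F.exists_sub_mem _ x y hx' hy1 hy2
      rw [e] at hr
      have := ih _ (sub_mem hx (M.smul_mem r (hNM hy))) hr
      simpa using add_mem this (Submodule.mem_sup_left (N.smul_mem r hy))
  intro x hx
  refine key (j - i).toNat x hx (F.mem_L_of_lt (hM hx) ?_)
  omega

/-- Successive approximation brings every element of `M` into `N` modulo some `L j ≤ F.u • M`;
Nakayama's lemma finishes. This is the tool for proving that two lattices coincide. -/
theorem eq_of_jumps_subset {M N : Submodule O (Fin 3 → K)} (hM : M.IsLattice K) (hNM : N ≤ M)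
    (h : F.jumps M ⊆ F.jumps N) : N = M := by
  refine le_antisymm hNM ?_
  have := hM
  obtain ⟨i, hi⟩ := exists_le_L (F := F) hM.fg
  obtain ⟨j, hj⟩ := exists_L_le (F := F) (inferInstance : (F.u • M).IsLattice K)
  refine Submodule.le_of_le_smul_of_le_jacobson_bot hM.fg
    (IsLocalRing.maximalIdeal_le_jacobson _) ?_
  refine (le_sup_inf_of_jumps_subset (j := j) hNM hi fun t ht _ => h ht).trans ?_
  rw [← F.u_smul_eq]
  exact sup_le_sup_left (inf_le_right.trans hj) _

/-- Below `t` the summand `M ⊓ L t` does not change the leading term of an element of `A`; from `t`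
on, it contributes all jumps of `M`. -/
theorem jumps_sup_inf {A M : Submodule O (Fin 3 → K)} (hAM : A ≤ M) (t : ℤ) :
    F.jumps (A ⊔ (M ⊓ F.L t)) = F.jumps A ∪ (F.jumps M ∩ Set.Ici t) := by
  ext j
  constructor
  · rintro ⟨x, hx, h1, h2⟩
    obtain ⟨a, ha, m, ⟨hm, hmt⟩, rfl⟩ := Submodule.mem_sup.1 hx
    rcases lt_or_ge j t with hj | hj
    · left
      have hmj : m ∈ F.L (j + 1) := F.mem_L_of_lt hmt (by omega)
      refine ⟨a, ha, ?_, fun h => h2 (add_mem h hmj)⟩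
      simpa using sub_mem h1 (F.succ_le j hmj)
    · right
      exact ⟨⟨a + m, add_mem (hAM ha) hm, h1, h2⟩, hj⟩
  · rintro (h | ⟨⟨x, hx, h1, h2⟩, hj⟩)
    · exact jumps_mono le_sup_left h
    · exact ⟨x, Submodule.mem_sup_right ⟨hx, F.mem_L_of_lt h1 hj⟩, h1, h2⟩

theorem eq_sup_inf {A N : Submodule O (Fin 3 → K)} (hN : N.IsLattice K) (hAN : A ≤ N) {t : ℤ}
    (h : ∀ j ∈ F.jumps N, j < t → j ∈ F.jumps A) : N = A ⊔ (N ⊓ F.L t) := by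
  refine (eq_of_jumps_subset (F := F) hN (sup_le hAN inf_le_left) ?_).symm
  rw [jumps_sup_inf hAN]
  intro j hj
  rcases lt_or_ge j t with h' | h'
  · exact Or.inl (h j hj h')
  · exact Or.inr ⟨hj, h'⟩

theorem inf_L_le {M N : Submodule O (Fin 3 → K)} (hM : M.IsLattice K) (hNM : N ≤ M) {t : ℤ}
    (h : ∀ j ∈ F.jumps M, t ≤ j → j ∈ F.jumps N) : M ⊓ F.L t ≤ N := by
  have hN : N ⊔ (M ⊓ F.L t) = N ⊔ (N ⊓ F.L t) := by
    have hsup : (N ⊔ (M ⊓ F.L t)) ≤ M := sup_le hNM inf_le_left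
    rw [sup_eq_left.2 (inf_le_left : N ⊓ F.L t ≤ N)]
    have hfg : (N ⊔ (M ⊓ F.L t)).FG := by
      have : IsNoetherian O M := isNoetherian_of_fg_of_noetherian M hM.fg
      exact Submodule.FG.of_le hM.fg hsup
    -- The sum is finitely generated and contains the lattice `M ⊓ L t`, so the second case is void.
    by_cases hne : (N ⊔ (M ⊓ F.L t)).IsLattice K
    · refine (eq_of_jumps_subset (F := F) hne le_sup_left ?_).symm
      rw [jumps_sup_inf hNM]
      rintro j (hj | ⟨hj, hj'⟩)
      · exact hj
      · exact h j hj hj'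
    · have hL := F.isLattice t
      have : (M ⊓ F.L t).IsLattice K := inferInstance
      exact absurd (Submodule.IsLattice.of_le_of_isLattice_of_fg K le_sup_right hfg) hne
  rw [sup_eq_left.2 (inf_le_left : N ⊓ F.L t ≤ N)] at hN
  exact sup_eq_left.1 hN

end Filtration

end Filtration

end A2Building

namespace A2Building

/-! ### The position of a lattice relative to the chain -/

section Position

variable {O K : Type*} [CommRing O] [IsDomain O] [IsDiscreteValuationRing O]
  [Field K] [Algebra O K] [IsFractionRing O K]

namespace Filtration

variable {F : Filtration O K}

/-- `M` is a lattice whose jumps are `a, b, c`, which are distinct modulo `3`, and their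
translates by positive multiples of `3`. -/
structure Pos (F : Filtration O K) (M : Submodule O (Fin 3 → K)) (a b c : ℤ) : Prop where
  isLattice : M.IsLattice K
  ab : (b - a) % 3 ≠ 0
  bc : (c - b) % 3 ≠ 0
  ac : (c - a) % 3 ≠ 0
  mem_iff : ∀ j, j ∈ F.jumps M ↔
    (a ≤ j ∧ (j - a) % 3 = 0) ∨ (b ≤ j ∧ (j - b) % 3 = 0) ∨ (c ≤ j ∧ (j - c) % 3 = 0)

variable {M N : Submodule O (Fin 3 → K)} {a b c a' b' c' : ℤ}

theorem Pos.swap12 (h : F.Pos M a b c) : F.Pos M b a c where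
  isLattice := h.isLattice
  ab := by have := h.ab; omega
  bc := h.ac
  ac := h.bc
  mem_iff j := by rw [h.mem_iff]; tauto

theorem Pos.swap23 (h : F.Pos M a b c) : F.Pos M a c b where
  isLattice := h.isLattice
  ab := h.ac
  bc := by have := h.bc; omega
  ac := h.ab
  mem_iff j := by rw [h.mem_iff]; tauto

theorem Pos.mem1 (h : F.Pos M a b c) : a ∈ F.jumps M := by rw [h.mem_iff]; simp
theorem Pos.mem2 (h : F.Pos M a b c) : b ∈ F.jumps M := by rw [h.mem_iff]; simp
theorem Pos.mem3 (h : F.Pos M a b c) : c ∈ F.jumps M := by rw [h.mem_iff]; simp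

/-- Each of `a, b, c` is the least jump in its residue class, so the triple is unique up to
permutation. -/
theorem Pos.eq_or (h : F.Pos M a b c) (h' : F.Pos M a' b' c') : a = a' ∨ a = b' ∨ a = c' := by
  have h1 := (h'.mem_iff a).1 h.mem1
  have ha := (h.mem_iff a').1 h'.mem1
  have hb := (h.mem_iff b').1 h'.mem2
  have hc := (h.mem_iff c').1 h'.mem3
  have := h.ab
  have := h.ac
  rcases h1 with h1 | h1 | h1
  · left; omega
  · right; left; omega
  · right; right; omega

theorem Pos.sum_eq (h : F.Pos M a b c) (h' : F.Pos M a' b' c') :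
    a + b + c = a' + b' + c' := by
  have h1 := h.eq_or h'
  have h2 := h.swap12.eq_or h'
  have h3 := h.swap23.swap12.eq_or h'
  have := h.ab
  have := h.ac
  have := h.bc
  omega

theorem Pos.eq_of_lt (h : F.Pos M a b c) (h' : F.Pos M a' b' c') (h1 : a < b) (h2 : b < c)
    (h1' : a' < b') (h2' : b' < c') : a = a' ∧ b = b' ∧ c = c' := by
  have e1 := h.eq_or h'
  have e2 := h.swap12.eq_or h'
  have e3 := h.swap23.swap12.eq_or h'
  omega

theorem Pos.zpow_smul (h : F.Pos M a b c) (k : ℤ) :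
    F.Pos (F.u ^ k • M) (a + 3 * k) (b + 3 * k) (c + 3 * k) where
  isLattice := have := h.isLattice; inferInstance
  ab := by have := h.ab; omega
  bc := by have := h.bc; omega
  ac := by have := h.ac; omega
  mem_iff j := by
    rw [mem_jumps_zpow_smul, h.mem_iff]
    omega

theorem Pos.u_smul (h : F.Pos M a b c) : F.Pos (F.u • M) (a + 3) (b + 3) (c + 3) := by
  simpa using h.zpow_smul 1

theorem Pos.eq_of_le (h : F.Pos M a b c) (h' : F.Pos N a b c) (hNM : N ≤ M) : N = M :=
  eq_of_jumps_subset h.isLattice hNM fun j hj => by rwa [h'.mem_iff, ← h.mem_iff]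

theorem pos_L (F : Filtration O K) (i : ℤ) : F.Pos (F.L i) i (i + 1) (i + 2) where
  isLattice := F.isLattice i
  ab := by omega
  bc := by omega
  ac := by omega
  mem_iff j := by rw [jumps_L, Set.mem_Ici]; omega

theorem Pos.le_L (h : F.Pos M a b c) {t : ℤ} (ha : t ≤ a) (hb : t ≤ b) (hc : t ≤ c) :
    M ≤ F.L t := by
  intro x hx
  by_cases hx0 : x = 0
  · exact hx0 ▸ Submodule.zero_mem _
  obtain ⟨i, hi, hi'⟩ := F.exists_jump x hx0
  have := (h.mem_iff i).1 ⟨x, hx, hi, hi'⟩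
  exact F.mem_L_of_lt hi (by omega)

theorem Pos.L_le (h : F.Pos M a b c) {t : ℤ} (ha : a ≤ t + 2) (hb : b ≤ t + 2)
    (hc : c ≤ t + 2) : F.L t ≤ M := by
  have := h.isLattice
  have := F.isLattice t
  have hj : ∀ j ∈ F.jumps (M ⊔ F.L t), t ≤ j → j ∈ F.jumps M := by
    intro j _ hj
    have h1 := h.ab
    have h2 := h.bc
    have h3 := h.ac
    rw [h.mem_iff]
    omega
  exact (le_inf le_sup_right le_rfl).trans (inf_L_le inferInstance le_sup_left hj)

theorem Pos.eq_L (h : F.Pos M a (a + 1) (a + 2)) : M = F.L a :=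
  le_antisymm (h.le_L (by omega) (by omega) (by omega)) (h.L_le (by omega) (by omega) (by omega))

theorem exists_least_jump (hM : M.IsLattice K) (r : ℤ) :
    ∃ a ∈ F.jumps M, (a - r) % 3 = 0 ∧ ∀ j ∈ F.jumps M, (j - r) % 3 = 0 → a ≤ j := by
  obtain ⟨l, hl⟩ := exists_le_L (F := F) hM.fg
  obtain ⟨s, hs⟩ := exists_L_le (F := F) hM
  have hs' : Set.Ici s ⊆ F.jumps M := by rw [← jumps_L (F := F)]; exact jumps_mono hs
  have hl' : F.jumps M ⊆ Set.Ici l := by rw [← jumps_L (F := F)]; exact jumps_mono hl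
  obtain ⟨a, ⟨ha1, ha2⟩, h⟩ := Int.exists_least_of_bdd
    (P := fun j => j ∈ F.jumps M ∧ (j - r) % 3 = 0) ⟨l, fun z hz => hl' hz.1⟩
    ⟨s + (r - s) % 3, hs' (by simp only [Set.mem_Ici]; omega), by omega⟩
  exact ⟨a, ha1, ha2, fun j hj hj' => h j ⟨hj, hj'⟩⟩

theorem exists_pos_mod (hM : M.IsLattice K) :
    ∃ a b c, F.Pos M a b c ∧ a % 3 = 0 ∧ b % 3 = 1 ∧ c % 3 = 2 := by
  obtain ⟨a, ha, ha', hal⟩ := exists_least_jump (F := F) hM 0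
  obtain ⟨b, hb, hb', hbl⟩ := exists_least_jump (F := F) hM 1
  obtain ⟨c, hc, hc', hcl⟩ := exists_least_jump (F := F) hM 2
  have up : ∀ n : ℕ, ∀ j ∈ F.jumps M, j + 3 * n ∈ F.jumps M := by
    intro n
    induction n with
    | zero => simp
    | succ n ih =>
      intro j hj
      have := add_three_mem_jumps (ih j hj)
      convert this using 1; push_cast; ring
  have up' : ∀ i ∈ F.jumps M, ∀ j, i ≤ j → (j - i) % 3 = 0 → j ∈ F.jumps M := by
    intro i hi j hij hm
    have := up ((j - i) / 3).toNat i hi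
    convert this using 1; omega
  refine ⟨a, b, c, ⟨hM, by omega, by omega, by omega, fun j => ⟨fun hj => ?_, ?_⟩⟩,
    by omega, by omega, by omega⟩
  · have h1 := hal j hj
    have h2 := hbl j hj
    have h3 := hcl j hj
    omega
  · rintro (h | h | h)
    · exact up' a ha j h.1 h.2
    · exact up' b hb j h.1 h.2
    · exact up' c hc j h.1 h.2

theorem exists_pos (hM : M.IsLattice K) : ∃ a b c, F.Pos M a b c ∧ a < b ∧ b < c := by
  obtain ⟨a, b, c, h, ha, hb, hc⟩ := exists_pos_mod (F := F) hM
  rcases lt_or_ge a b with h1 | h1 <;> rcases lt_or_ge b c with h2 | h2 <;>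
    rcases lt_or_ge a c with h3 | h3
  · exact ⟨a, b, c, h, h1, h2⟩
  · omega
  · exact ⟨a, c, b, h.swap23, h3, by omega⟩
  · exact ⟨c, a, b, h.swap23.swap12, by omega, h1⟩
  · exact ⟨b, a, c, h.swap12, by omega, h3⟩
  · exact ⟨b, c, a, h.swap12.swap23, h2, by omega⟩
  · omega
  · exact ⟨c, b, a, h.swap12.swap23.swap12, by omega, by omega⟩

/-- The index of a lattice, normalised so that `L 0` has index `0`. -/
def charge (F : Filtration O K) (M : Submodule O (Fin 3 → K)) : ℤ :=
  Classical.epsilon fun i => ∃ a b c, F.Pos M a b c ∧ a + b + c = 3 * i + 3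

/-- Three distinct residues modulo 3 have a sum divisible by 3, so the index is an integer; the
constant 3 is the sum `0 + 1 + 2` belonging to `L 0`. -/
theorem Pos.charge_eq (h : F.Pos M a b c) : a + b + c = 3 * F.charge M + 3 := by
  have : ∃ i a b c, F.Pos M a b c ∧ a + b + c = 3 * i + 3 := by
    refine ⟨(a + b + c) / 3 - 1, a, b, c, h, ?_⟩
    have h1 := h.ab
    have h2 := h.bc
    have h3 := h.ac
    have : (b - a) % 3 = 1 ∨ (b - a) % 3 = 2 := by omega
    have : (c - b) % 3 = 1 ∨ (c - b) % 3 = 2 := by omega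
    omega
  obtain ⟨a', b', c', h', e⟩ := Classical.epsilon_spec this
  rw [h.sum_eq h']
  exact e

theorem charge_zpow_smul (hM : M.IsLattice K) (k : ℤ) :
    F.charge (F.u ^ k • M) = F.charge M + 3 * k := by
  obtain ⟨a, b, c, h, -⟩ := exists_pos (F := F) hM
  have h1 := h.charge_eq
  have h2 := (h.zpow_smul k).charge_eq
  omega

theorem charge_u_smul (hM : M.IsLattice K) : F.charge (F.u • M) = F.charge M + 3 := by
  simpa using charge_zpow_smul (F := F) hM 1

theorem charge_L (F : Filtration O K) (i : ℤ) : F.charge (F.L i) = i := by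
  have := (F.pos_L i).charge_eq
  omega

/-- Lattices between `u • M` and `M` are determined by a subset of the three first jumps. -/
theorem Pos.of_between (h : F.Pos M a b c) (hN : N.IsLattice K) (h1 : F.u • M ≤ N) (h2 : N ≤ M) :
    ∃ a' b' c', F.Pos N a' b' c' ∧ (a' = a ∨ a' = a + 3) ∧ (b' = b ∨ b' = b + 3) ∧
      (c' = c ∨ c' = c + 3) := by
  have hab := h.ab
  have hbc := h.bc
  have hac := h.ac
  have H : ∀ j, j ∈ F.jumps N → j ∈ F.jumps M := fun j hj => jumps_mono h2 hj
  have H' : ∀ j, j - 3 ∈ F.jumps M → j ∈ F.jumps N := fun j hj =>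
    jumps_mono h1 (mem_jumps_u_smul.2 hj)
  have key : ∀ x ∈ F.jumps M, (∀ y ∈ F.jumps M, (y - x) % 3 = 0 → x ≤ y) →
      ∃ x', (x' = x ∨ x' = x + 3) ∧ x' ∈ F.jumps N ∧
        ∀ j ∈ F.jumps N, (j - x) % 3 = 0 → x' ≤ j := by
    intro x hx hmin
    by_cases hx' : x ∈ F.jumps N
    · exact ⟨x, Or.inl rfl, hx', fun j hj hm => hmin j (H j hj) hm⟩
    · refine ⟨x + 3, Or.inr rfl, H' _ (by simpa using hx), fun j hj hm => ?_⟩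
      have := hmin j (H j hj) hm
      have hne : j ≠ x := fun e => hx' (e ▸ hj)
      omega
  obtain ⟨a', ha, ha1, ha2⟩ := key a h.mem1 (fun y hy hm => by rw [h.mem_iff] at hy; omega)
  obtain ⟨b', hb, hb1, hb2⟩ := key b h.mem2 (fun y hy hm => by rw [h.mem_iff] at hy; omega)
  obtain ⟨c', hc, hc1, hc2⟩ := key c h.mem3 (fun y hy hm => by rw [h.mem_iff] at hy; omega)
  refine ⟨a', b', c', ⟨hN, by omega, by omega, by omega, fun j => ⟨fun hj => ?_, ?_⟩⟩, ha, hb, hc⟩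
  · have h1 := ha2 j hj
    have h2 := hb2 j hj
    have h3 := hc2 j hj
    have := (h.mem_iff j).1 (H j hj)
    omega
  · rintro (hj | hj | hj)
    · by_cases e : j = a'
      · rwa [e]
      · exact H' j ((h.mem_iff _).2 (by omega))
    · by_cases e : j = b'
      · rwa [e]
      · exact H' j ((h.mem_iff _).2 (by omega))
    · by_cases e : j = c'
      · rwa [e]
      · exact H' j ((h.mem_iff _).2 (by omega))

/-- The sublattice of `M` that contains the elements of `M` in `L t` and `u • M`. -/
def cut (F : Filtration O K) (M : Submodule O (Fin 3 → K)) (t : ℤ) : Submodule O (Fin 3 → K) :=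
  F.u • M ⊔ (M ⊓ F.L t)

theorem cut_le (M : Submodule O (Fin 3 → K)) (t : ℤ) : F.cut M t ≤ M :=
  sup_le (F.u_smul_le M) inf_le_left

theorem u_smul_le_cut (M : Submodule O (Fin 3 → K)) (t : ℤ) : F.u • M ≤ F.cut M t := le_sup_left

theorem cut_antitone (M : Submodule O (Fin 3 → K)) {s t : ℤ} (h : s ≤ t) :
    F.cut M t ≤ F.cut M s :=
  sup_le_sup_left (inf_le_inf_left _ (F.L_antitone h)) _

theorem isLattice_of_between (hM : M.IsLattice K) (h1 : F.u • M ≤ N) (h2 : N ≤ M) :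
    N.IsLattice K := by
  have : (F.u • M).IsLattice K := inferInstance
  have : IsNoetherian O M := isNoetherian_of_fg_of_noetherian M hM.fg
  exact Submodule.IsLattice.of_le_of_isLattice_of_fg K h1 (Submodule.FG.of_le hM.fg h2)

theorem mem_jumps_cut {t j : ℤ} :
    j ∈ F.jumps (F.cut M t) ↔ j - 3 ∈ F.jumps M ∨ (j ∈ F.jumps M ∧ t ≤ j) := by
  rw [cut, jumps_sup_inf (F.u_smul_le M), Set.mem_union, mem_jumps_u_smul]
  rfl

/-- The chain induces a complete flag on the three-dimensional space `M / (F.u • M)`; for `a < b <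
c` its members are `cut M b` and `cut M c`. Together with `M` they form the chamber at `M` nearest
to the base chamber. -/
theorem Pos.cut2 (h : F.Pos M a b c) (h1 : a < b) (h2 : b < c) :
    F.Pos (F.cut M b) b c (a + 3) where
  isLattice := isLattice_of_between (F := F) h.isLattice (u_smul_le_cut _ _) (cut_le _ _)
  ab := h.bc
  bc := by have := h.ac; omega
  ac := by have := h.ab; omega
  mem_iff j := by
    rw [mem_jumps_cut, h.mem_iff, h.mem_iff]
    have := h.ab
    have := h.ac
    have := h.bc
    omega

theorem Pos.cut3 (h : F.Pos M a b c) (h1 : a < b) (h2 : b < c) :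
    F.Pos (F.cut M c) c (a + 3) (b + 3) where
  isLattice := isLattice_of_between (F := F) h.isLattice (u_smul_le_cut _ _) (cut_le _ _)
  ab := by have := h.ac; omega
  bc := by have := h.ab; omega
  ac := by have := h.bc; omega
  mem_iff j := by
    rw [mem_jumps_cut, h.mem_iff, h.mem_iff]
    have := h.ab
    have := h.ac
    have := h.bc
    omega

theorem cut_le_of_jumps (hM : M.IsLattice K) (h1 : F.u • M ≤ N) (h2 : N ≤ M) {t : ℤ}
    (h : ∀ j ∈ F.jumps M, t ≤ j → j ∈ F.jumps N) : F.cut M t ≤ N :=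
  sup_le h1 (inf_L_le hM h2 h)

theorem le_cut_of_jumps (hM : M.IsLattice K) (h1 : F.u • M ≤ N) (h2 : N ≤ M) {t : ℤ}
    (h : ∀ j ∈ F.jumps N, j < t → j - 3 ∈ F.jumps M) : N ≤ F.cut M t := by
  have hN := isLattice_of_between (F := F) hM h1 h2
  rw [eq_sup_inf (F := F) hN h1 (t := t) fun j hj hjt => mem_jumps_u_smul.2 (h j hj hjt)]
  exact sup_le_sup_left (inf_le_inf_right _ h2) _

/-- Since `a` is the smallest jump, a sublattice that only loses `a` must contain `M ⊓ L b`; the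
position therefore leaves no freedom. -/
theorem Pos.eq_cut2 (h : F.Pos M a b c) (hab : a < b) (hbc : b < c) (h1 : F.u • M ≤ N)
    (h2 : N ≤ M) (hN : F.Pos N b c (a + 3)) : N = F.cut M b := by
  refine (hN.eq_of_le (h.cut2 hab hbc) (cut_le_of_jumps h.isLattice h1 h2 ?_)).symm
  intro j hj hbj
  rw [h.mem_iff] at hj
  rw [hN.mem_iff]
  omega

theorem Pos.eq_cut3 (h : F.Pos M a b c) (hab : a < b) (hbc : b < c) (h1 : F.u • M ≤ N)
    (h2 : N ≤ M) (hN : F.Pos N c (a + 3) (b + 3)) : N = F.cut M c := by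
  refine (hN.eq_of_le (h.cut3 hab hbc) (cut_le_of_jumps h.isLattice h1 h2 ?_)).symm
  intro j hj hbj
  rw [h.mem_iff] at hj
  rw [hN.mem_iff]
  omega

/-! ### Lattices between `A` and `B` as lines in a residue plane -/

section Pencil

variable {A B : Submodule O (Fin 3 → K)} {p p' r : ℤ}

/-- The lattice spanned by `A` and `x + s y`. -/
def pencil (A : Submodule O (Fin 3 → K)) (x y : Fin 3 → K) (s : O) : Submodule O (Fin 3 → K) :=
  A ⊔ Submodule.span O {x + s • y}

/-- Take `m + t (x + s y)` with leading term at `p'`. If `t` is a unit, `m ∈ A` would have a jump at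
`p`; otherwise the whole element lies in `A`, which has no jump at `p'`. -/
theorem notMem_jumps_pencil (hA : F.Pos A (p + 3) (p' + 3) r) (hB : F.Pos B p p' r)
    (huB : F.u • B ≤ A) (hpp : p < p') {x y : Fin 3 → K} (hx : x ∈ B) (hxp : x ∈ F.L p)
    (hxp' : x ∉ F.L (p + 1)) (hy : y ∈ B) (hyp : y ∈ F.L p') (s : O) :
    p' ∉ F.jumps (pencil A x y s) := by
  have hab := hB.ab
  have hbc := hB.bc
  have hac := hB.ac
  have hpA : p ∉ F.jumps A := by rw [hA.mem_iff]; omega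
  have hp'A : p' ∉ F.jumps A := by rw [hA.mem_iff]; omega
  rintro ⟨z, hz, h1, h2⟩
  obtain ⟨m, hm, w, hw, rfl⟩ := Submodule.mem_sup.1 hz
  obtain ⟨t, rfl⟩ := Submodule.mem_span_singleton.1 hw
  have hyp1 : y ∈ F.L (p + 1) := F.mem_L_of_lt hyp (by omega)
  have hxyB : x + s • y ∈ B := add_mem hx (B.smul_mem _ hy)
  by_cases ht : IsUnit t
  · obtain ⟨t, rfl⟩ := ht
    refine hpA ⟨m, hm, ?_, fun h => hxp' ?_⟩
    · have : (t : O) • (x + s • y) ∈ F.L p :=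
        (F.L p).smul_mem _ (add_mem hxp ((F.L p).smul_mem _ (F.succ_le _ hyp1)))
      have h3 := sub_mem (F.mem_L_of_lt h1 hpp.le) this
      rwa [add_sub_cancel_right] at h3
    · have h3 := sub_mem (F.mem_L_of_lt h1 (show p + 1 ≤ p' by omega)) h
      rw [add_sub_cancel_left] at h3
      have h4 := (F.L (p + 1)).smul_mem ((t⁻¹ : Oˣ) : O) h3
      rw [smul_smul, Units.inv_mul, one_smul] at h4
      simpa using sub_mem h4 ((F.L (p + 1)).smul_mem s hyp1)
  · have htm : t ∈ IsLocalRing.maximalIdeal O := ht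
    refine hp'A ⟨_, add_mem hm (huB ?_), h1, h2⟩
    rw [F.u_smul_eq]
    exact Submodule.smul_mem_smul htm hxyB

theorem pos_pencil (hA : F.Pos A (p + 3) (p' + 3) r) (hB : F.Pos B p p' r)
    (hAB : A ≤ B) (huB : F.u • B ≤ A) (hpp : p < p') {x y : Fin 3 → K} (hx : x ∈ B)
    (hxp : x ∈ F.L p) (hxp' : x ∉ F.L (p + 1)) (hy : y ∈ B) (hyp : y ∈ F.L p') (s : O) :
    pencil A x y s ≤ B ∧ F.Pos (pencil A x y s) p (p' + 3) r := by
  have hle : pencil A x y s ≤ B :=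
    sup_le hAB (by simpa using add_mem hx (B.smul_mem s hy))
  have h := notMem_jumps_pencil hA hB huB hpp hx hxp hxp' hy hyp s
  obtain ⟨a', b', c', hN, ha, hb, hc⟩ := hB.of_between (N := pencil A x y s)
    (isLattice_of_between (F := F) hB.isLattice (huB.trans le_sup_left) hle)
    (huB.trans le_sup_left) hle
  refine ⟨hle, ?_⟩
  have hyp1 : y ∈ F.L (p + 1) := F.mem_L_of_lt hyp (by omega)
  have hp : p ∈ F.jumps (pencil A x y s) := by
    refine ⟨x + s • y, Submodule.mem_sup_right (Submodule.mem_span_singleton_self _), ?_, ?_⟩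
    · exact add_mem hxp ((F.L p).smul_mem _ (F.succ_le _ hyp1))
    · intro h'
      exact hxp' (by simpa using sub_mem h' ((F.L (p + 1)).smul_mem s hyp1))
  have hr : r ∈ F.jumps (pencil A x y s) := jumps_mono le_sup_left hA.mem3
  rw [hN.mem_iff] at hp hr h
  have hab := hB.ab
  have hbc := hB.bc
  have hac := hB.ac
  obtain rfl : a' = p := by omega
  obtain rfl : b' = p' + 3 := by omega
  obtain rfl : c' = r := by omega
  exact hN

/-- In the plane `B / A` the chain singles out one line, the image of `y`, which has the jump `p'`.
The other lines are spanned by `x + s y`, with `s` running through the residue field. -/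
theorem ncard_between (hA : F.Pos A (p + 3) (p' + 3) r) (hB : F.Pos B p p' r)
    (hAB : A ≤ B) (huB : F.u • B ≤ A) (hpp : p < p') :
    {N | A ≤ N ∧ N ≤ B ∧ F.Pos N p (p' + 3) r}.ncard =
      Nat.card (IsLocalRing.ResidueField O) := by
  obtain ⟨x, hx, hxp, hxp'⟩ := hB.mem1
  obtain ⟨y, hy, hyp, hyp'⟩ := hB.mem2
  have hpen := fun s => pos_pencil hA hB hAB huB hpp hx hxp hxp' hy hyp s
  have hnot := fun s => notMem_jumps_pencil hA hB huB hpp hx hxp hxp' hy hyp s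
  have hmem : ∀ s, x + s • y ∈ pencil A x y s := fun s =>
    Submodule.mem_sup_right (Submodule.mem_span_singleton_self _)
  have hres : ∀ s, IsLocalRing.residue O
      (Function.surjInv (IsLocalRing.residue_surjective (R := O)) s) = s :=
    Function.surjInv_eq _
  let f : IsLocalRing.ResidueField O → Submodule O (Fin 3 → K) :=
    fun s => pencil A x y (Function.surjInv IsLocalRing.residue_surjective s)
  have hf : Function.Injective f := by
    intro s s' h
    by_contra hne
    set t := Function.surjInv (IsLocalRing.residue_surjective (R := O)) s with ht
    set t' := Function.surjInv (IsLocalRing.residue_surjective (R := O)) s' with ht'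
    have hu : IsUnit (t - t') := by
      by_contra hu
      have : IsLocalRing.residue O (t - t') = 0 := Ideal.Quotient.eq_zero_iff_mem.2 hu
      rw [map_sub, ht, ht', hres, hres, sub_eq_zero] at this
      exact hne this
    obtain ⟨v, hv⟩ := hu
    have h' : pencil A x y t = pencil A x y t' := h
    have h1 : (t - t') • y ∈ pencil A x y t := by
      have := sub_mem (hmem t) (h' ▸ hmem t' : x + t' • y ∈ pencil A x y t)
      rwa [add_sub_add_left_eq_sub, ← sub_smul] at this
    have h2 := (pencil A x y t).smul_mem ((v⁻¹ : Oˣ) : O) h1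
    rw [← hv, smul_smul, Units.inv_mul, one_smul] at h2
    exact hnot t ⟨y, h2, hyp, hyp'⟩
  have hrange : Set.range f = {N | A ≤ N ∧ N ≤ B ∧ F.Pos N p (p' + 3) r} := by
    ext N
    constructor
    · rintro ⟨s, rfl⟩
      exact ⟨le_sup_left, hpen _⟩
    · rintro ⟨h1, h2, h3⟩
      obtain ⟨z, hz, hzp, hzp'⟩ := h3.mem1
      obtain ⟨t, ht⟩ := F.exists_sub_mem p x z hxp hzp hzp'
      -- Below its first jump `p`, the lattice `B` has only the direction `y` beyond `A`. Hence `x -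
      -- t z = m + s y` with `m ∈ A`, and `x - s y` lies in `N`: this is why the parameter is `-s`.
      have hB' : B ⊓ F.L (p + 1) ≤ A ⊔ Submodule.span O {y} := by
        refine inf_L_le hB.isLattice (sup_le hAB (by simpa using hy)) fun j hj hpj => ?_
        by_cases hjp : j = p'
        · exact ⟨y, Submodule.mem_sup_right (Submodule.mem_span_singleton_self _),
            hjp ▸ hyp, hjp ▸ hyp'⟩
        · refine jumps_mono le_sup_left ?_
          rw [hB.mem_iff] at hj
          rw [hA.mem_iff]
          omega
      obtain ⟨m, hm, w, hw, hmw⟩ := Submodule.mem_sup.1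
        (hB' ⟨sub_mem hx (B.smul_mem t (h2 hz)), ht⟩)
      obtain ⟨s, rfl⟩ := Submodule.mem_span_singleton.1 hw
      refine ⟨IsLocalRing.residue O (-s), ?_⟩
      have hle : f (IsLocalRing.residue O (-s)) ≤ N := by
        set s' := Function.surjInv (IsLocalRing.residue_surjective (R := O))
          (IsLocalRing.residue O (-s)) with hs'
        have hss : s' + s ∈ IsLocalRing.maximalIdeal O := by
          rw [← Ideal.Quotient.eq_zero_iff_mem]
          change IsLocalRing.residue O _ = 0
          rw [map_add, hs', hres, map_neg, neg_add_cancel]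
        change pencil A x y s' ≤ N
        refine sup_le h1 ?_
        rw [Submodule.span_le, Set.singleton_subset_iff, SetLike.mem_coe]
        have e : x + s' • y = m + t • z + (s' + s) • y := by
          have hx' : x = m + s • y + t • z := by rw [hmw]; abel
          rw [hx']
          module
        rw [e]
        refine add_mem (add_mem (h1 hm) (N.smul_mem _ hz)) (h1 (huB ?_))
        rw [F.u_smul_eq]
        exact Submodule.smul_mem_smul hss hy
      exact h3.eq_of_le (hpen _).2 hle
  rw [← hrange, ← Set.image_univ, Set.ncard_image_of_injective _ hf, Set.ncard_univ]

end Pencil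

end Filtration

end Position

end A2Building

namespace A2Building

/-! ### Chambers as periodic lattice flags, and their affine permutations -/

section Flags

variable {O K : Type*} [CommRing O] [IsDomain O] [IsDiscreteValuationRing O]
  [Field K] [Algebra O K] [IsFractionRing O K]

theorem Represents.isLattice {M : Submodule O (Fin 3 → K)} {x : Vertex O K}
    (h : Represents M x) : M.IsLattice K := h.1

theorem exists_represents (x : Vertex O K) : ∃ M, Represents M x := by
  obtain ⟨M, rfl⟩ := Quotient.exists_rep x
  exact ⟨M.1, M.2, rfl⟩

theorem Represents.eq {M : Submodule O (Fin 3 → K)} {x y : Vertex O K}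
    (h : Represents M x) (h' : Represents M y) : x = y := by
  obtain ⟨_, rfl⟩ := h
  obtain ⟨_, rfl⟩ := h'
  rfl

/-- The vertex of a lattice. -/
theorem exists_vertex {M : Submodule O (Fin 3 → K)} (h : M.IsLattice K) : ∃ x, Represents M x :=
  ⟨_, h, rfl⟩

namespace Filtration

variable {F : Filtration O K} {M N M₀ M₁ M₂ N₀ N₁ N₂ : Submodule O (Fin 3 → K)}
  {x y : Vertex O K} {a b c a' b' c' : ℤ} {C D E : Chamber O K}

theorem exists_eq_zpow_smul (F : Filtration O K) (h : Represents M x) (h' : Represents N x) :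
    ∃ k : ℤ, N = F.u ^ k • M := by
  obtain ⟨hM, rfl⟩ := h
  obtain ⟨hN, h⟩ := h'
  obtain ⟨a, ha⟩ := Quotient.exact h
  obtain ⟨k, hk⟩ := F.unit_smul_zpow a
  exact ⟨k, by rw [← hk]; exact ha⟩

theorem eq_of_charge_eq (h : Represents M x) (h' : Represents N x)
    (hc : F.charge M = F.charge N) : M = N := by
  obtain ⟨k, rfl⟩ := F.exists_eq_zpow_smul h h'
  rw [charge_zpow_smul h.isLattice] at hc
  obtain rfl : k = 0 := by omega
  simp

theorem zpow_smul_antitone (M : Submodule O (Fin 3 → K)) : Antitone fun k : ℤ => F.u ^ k • M := by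
  refine antitone_int_of_succ_le fun k => ?_
  rw [zpow_add_one, mul_comm, mul_smul]
  exact F.u_smul_le _

/-- The representative of `x` may be fixed in advance: both lattices of an edge can be rescaled
simultaneously, and strictness of the inclusions encodes `x ≠ y`. -/
theorem adj_iff (F : Filtration O K) (hM : Represents M x) :
    (graph O K).Adj x y ↔ ∃ N, Represents N y ∧ F.u • M < N ∧ N < M := by
  constructor
  · rintro ⟨hne, M', N', hM', hN', h1, h2⟩
    rw [← F.u_smul_eq] at h2
    obtain ⟨k, rfl⟩ := F.exists_eq_zpow_smul hM' hM
    have hN := hN'.smul (F.u ^ k)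
    have h3 : F.u ^ k • N' ≤ F.u ^ k • M' := units_smul_le h1
    have h4 : F.u • F.u ^ k • M' ≤ F.u ^ k • N' := by
      rw [smul_comm]; exact units_smul_le h2
    refine ⟨_, hN, lt_of_le_of_ne h4 fun e => hne ?_, lt_of_le_of_ne h3 fun e => hne ?_⟩
    · exact (hM.smul F.u).eq (e ▸ hN)
    · exact hM.eq (e ▸ hN)
  · rintro ⟨N, hN, h1, h2⟩
    refine ⟨?_, M, N, hM, hN, h2.le, by rw [← F.u_smul_eq]; exact h1.le⟩
    rintro rfl
    obtain ⟨k, rfl⟩ := F.exists_eq_zpow_smul hM hN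
    rcases lt_or_ge 0 k with hk | hk
    · refine h1.not_ge ?_
      simpa using zpow_smul_antitone (F := F) M (show (1 : ℤ) ≤ k by omega)
    · refine h2.not_ge ?_
      simpa using zpow_smul_antitone (F := F) M hk

/-- A chain of lattices representing the vertices of a chamber, with its jumps. -/
structure IsFlag (F : Filtration O K) (D : Chamber O K) (M₀ M₁ M₂ : Submodule O (Fin 3 → K))
    (a b c : ℤ) : Prop where
  mem_iff : ∀ x, x ∈ D.1 ↔ Represents M₀ x ∨ Represents M₁ x ∨ Represents M₂ x
  lt₁ : M₁ < M₀
  lt₂ : M₂ < M₁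
  lt₃ : F.u • M₀ < M₂
  pos₀ : F.Pos M₀ a b c
  pos₁ : F.Pos M₁ b c (a + 3)
  pos₂ : F.Pos M₂ c (a + 3) (b + 3)

theorem exists_jump_of_lt (hM : M.IsLattice K) (h : N < M) : ∃ j ∈ F.jumps M, j ∉ F.jumps N := by
  by_contra! h'
  exact h.ne (eq_of_jumps_subset hM h.le h')

/-- Passing from `M₀` to `u M₀` loses exactly three jumps, and each of the three strict inclusions
loses at least one, so each loses exactly one. The order of loss defines `a, b, c`. -/
theorem exists_pos_of_chain (hM : M₀.IsLattice K) (h1 : M₁ < M₀) (h2 : M₂ < M₁)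
    (h3 : F.u • M₀ < M₂) : ∃ a b c, F.Pos M₀ a b c ∧ F.Pos M₁ b c (a + 3) ∧
      F.Pos M₂ c (a + 3) (b + 3) := by
  obtain ⟨x, y, z, h, -⟩ := exists_pos (F := F) hM
  have hM1 := isLattice_of_between (F := F) hM (h3.trans h2).le h1.le
  have hM2 := isLattice_of_between (F := F) hM h3.le (h2.trans h1).le
  obtain ⟨a, ha0, ha1⟩ := exists_jump_of_lt (F := F) hM h1
  obtain ⟨b, hb1, hb2⟩ := exists_jump_of_lt (F := F) hM1 h2
  obtain ⟨c, hc2, hc3⟩ := exists_jump_of_lt (F := F) hM2 h3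
  have hb0 := jumps_mono h1.le hb1
  have hc1 := jumps_mono h2.le hc2
  have hc0 := jumps_mono h1.le hc1
  have ha2 : a ∉ F.jumps M₂ := fun h => ha1 (jumps_mono h2.le h)
  have ha3 : a ∉ F.jumps (F.u • M₀) := fun h => ha2 (jumps_mono h3.le h)
  have hb3 : b ∉ F.jumps (F.u • M₀) := fun h => hb2 (jumps_mono h3.le h)
  have hab : a ≠ b := fun e => ha1 (e ▸ hb1)
  have hac : a ≠ c := fun e => ha1 (e ▸ hc1)
  have hbc : b ≠ c := fun e => hb2 (e ▸ hc2)
  have key : ∀ j ∈ F.jumps M₀, j ∉ F.jumps (F.u • M₀) → j = x ∨ j = y ∨ j = z := by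
    intro j hj hj'
    rw [mem_jumps_u_smul, h.mem_iff] at hj'
    rw [h.mem_iff] at hj
    omega
  have h0 : F.Pos M₀ a b c := by
    rcases key a ha0 ha3 with rfl | rfl | rfl <;> rcases key b hb0 hb3 with rfl | rfl | rfl <;>
      rcases key c hc0 hc3 with rfl | rfl | rfl <;>
      first
        | exact absurd rfl hab
        | exact absurd rfl hac
        | exact absurd rfl hbc
        | exact h
        | exact h.swap12
        | exact h.swap23
        | exact h.swap12.swap23
        | exact h.swap23.swap12
        | exact h.swap12.swap23.swap12
  refine ⟨a, b, c, h0, ?_, ?_⟩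
  · obtain ⟨a', b', c', h', ha', hb', hc'⟩ := h0.of_between hM1 (h3.trans h2).le h1.le
    have := h0.ab
    have := h0.bc
    have := h0.ac
    rw [h'.mem_iff] at ha1 hb1 hc1
    obtain rfl : a' = a + 3 := by omega
    obtain rfl : b' = b := by omega
    obtain rfl : c' = c := by omega
    exact h'.swap12.swap23
  · obtain ⟨a', b', c', h', ha', hb', hc'⟩ := h0.of_between hM2 h3.le (h2.trans h1).le
    have := h0.ab
    have := h0.bc
    have := h0.ac
    rw [h'.mem_iff] at ha2 hb2 hc2
    obtain rfl : a' = a + 3 := by omega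
    obtain rfl : b' = b + 3 := by omega
    obtain rfl : c' = c := by omega
    exact h'.swap23.swap12

theorem exists_chamber (hM : M₀.IsLattice K) (h1 : M₁ < M₀) (h2 : M₂ < M₁)
    (h3 : F.u • M₀ < M₂) : ∃ D a b c, F.IsFlag D M₀ M₁ M₂ a b c := by
  classical
  obtain ⟨x, hx⟩ := exists_vertex hM
  obtain ⟨y, hy⟩ := exists_vertex (isLattice_of_between (F := F) hM (h3.trans h2).le h1.le)
  obtain ⟨z, hz⟩ := exists_vertex (isLattice_of_between (F := F) hM h3.le (h2.trans h1).le)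
  obtain ⟨a, b, c, p0, p1, p2⟩ := exists_pos_of_chain hM h1 h2 h3
  refine ⟨⟨{x, y, z}, SimpleGraph.is3Clique_triple_iff.2 ⟨?_, ?_, ?_⟩⟩, a, b, c,
    fun w => ?_, h1, h2, h3, p0, p1, p2⟩
  · exact (F.adj_iff hx).2 ⟨M₁, hy, h3.trans h2, h1⟩
  · exact (F.adj_iff hx).2 ⟨M₂, hz, h3, h2.trans h1⟩
  · exact (F.adj_iff hy).2 ⟨M₂, hz, (units_smul_lt_iff.2 h1).trans h3, h2⟩
  · simp only [Finset.mem_insert, Finset.mem_singleton]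
    refine or_congr ⟨?_, fun h => h.eq hx⟩ (or_congr ⟨?_, fun h => h.eq hy⟩ ⟨?_, fun h => h.eq hz⟩)
    · rintro rfl; exact hx
    · rintro rfl; exact hy
    · rintro rfl; exact hz

theorem isFlag_of_chain (hM : Represents M₀ x) (h1 : M₁ < M₀) (h2 : M₂ < M₁)
    (h3 : F.u • M₀ < M₂) (hD : ∀ y ∈ D.1, y ≠ x → Represents M₁ y ∨ Represents M₂ y) :
    ∃ a b c, F.IsFlag D M₀ M₁ M₂ a b c := by
  obtain ⟨E, a, b, c, h⟩ := exists_chamber hM.isLattice h1 h2 h3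
  have hDE : D.1 ⊆ E.1 := by
    intro y hy
    rw [h.mem_iff]
    by_cases hyx : y = x
    · exact Or.inl (hyx ▸ hM)
    · exact Or.inr (hD y hy hyx)
  have : D = E := Subtype.ext (Finset.eq_of_subset_of_card_le hDE (by
    rw [D.2.card_eq, E.2.card_eq]))
  exact ⟨a, b, c, this ▸ h⟩

theorem exists_flag_of_mem (F : Filtration O K) (hx : x ∈ D.1) (hM : Represents M x) :
    ∃ M₁ M₂ a b c, F.IsFlag D M M₁ M₂ a b c := by
  classical
  obtain ⟨y, z, hyz, hD⟩ := Finset.card_eq_two.1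
    (show (D.1.erase x).card = 2 by rw [Finset.card_erase_of_mem hx, D.2.card_eq])
  have hy : y ∈ D.1.erase x := by simp [hD]
  have hz : z ∈ D.1.erase x := by simp [hD]
  have hor : ∀ w ∈ D.1, w ≠ x → w = y ∨ w = z := fun w hw hwx => by
    have : w ∈ D.1.erase x := Finset.mem_erase.2 ⟨hwx, hw⟩
    simpa [hD] using this
  rw [Finset.mem_erase] at hy hz
  have cl := D.2.isClique
  obtain ⟨N, hN, hN1, hN2⟩ := (F.adj_iff hM).1 (cl hx hy.2 hy.1.symm)
  obtain ⟨P, hP, hP1, hP2⟩ := (F.adj_iff hM).1 (cl hx hz.2 hz.1.symm)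
  obtain ⟨Q, hQ, hQ1, hQ2⟩ := (F.adj_iff hN).1 (cl hy.2 hz.2 hyz)
  -- `N` and `P` both lie between `u M` and `M`. The exponent relating `P` to the neighbour `Q` of
  -- `N` can only be 0 or 1, meaning `P < N` or `N < P`.
  obtain ⟨k, rfl⟩ := F.exists_eq_zpow_smul hP hQ
  have hk0 : 0 ≤ k := by
    by_contra! hk
    have h1 : F.u ^ (-1 : ℤ) • P ≤ F.u ^ k • P := zpow_smul_antitone P (by omega)
    have h2 : M < F.u ^ (-1 : ℤ) • P := by
      rw [← units_smul_lt_iff (a := F.u), zpow_neg_one, smul_inv_smul]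
      exact hP1
    exact (h2.trans_le h1).not_gt (hQ2.trans hN2)
  have hk1 : k ≤ 1 := by
    by_contra! hk
    have h1 : F.u ^ k • P ≤ F.u ^ (1 + 1 : ℤ) • P := zpow_smul_antitone P (by omega)
    rw [zpow_add, zpow_one, mul_smul] at h1
    have h2 : F.u • N < F.u • F.u • P := hQ1.trans_le h1
    rw [units_smul_lt_iff] at h2
    exact (hN1.trans h2).not_gt (units_smul_lt_iff.2 hP2)
  rcases (show k = 0 ∨ k = 1 by omega) with rfl | rfl
  · rw [zpow_zero, one_smul] at hQ2
    obtain ⟨a, b, c, h⟩ := isFlag_of_chain hM hN2 hQ2 hP1 fun w hw hwx => by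
      rcases hor w hw hwx with rfl | rfl
      · exact Or.inl hN
      · exact Or.inr hP
    exact ⟨N, P, a, b, c, h⟩
  · rw [zpow_one, units_smul_lt_iff] at hQ1
    obtain ⟨a, b, c, h⟩ := isFlag_of_chain hM hP2 hQ1 hN1 fun w hw hwx => by
      rcases hor w hw hwx with rfl | rfl
      · exact Or.inr hN
      · exact Or.inl hP
    exact ⟨P, N, a, b, c, h⟩

theorem IsFlag.rotate (h : F.IsFlag D M₀ M₁ M₂ a b c) :
    F.IsFlag D M₁ M₂ (F.u • M₀) b c (a + 3) where
  mem_iff x := by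
    rw [h.mem_iff]
    have : Represents (F.u • M₀) x ↔ Represents M₀ x :=
      ⟨fun h' => by simpa using h'.smul F.u⁻¹, fun h' => h'.smul _⟩
    rw [this]; tauto
  lt₁ := h.lt₂
  lt₂ := h.lt₃
  lt₃ := units_smul_lt_iff.2 h.lt₁
  pos₀ := h.pos₁
  pos₁ := h.pos₂
  pos₂ := h.pos₀.u_smul

theorem represents_zpow_smul {k : ℤ} : Represents (F.u ^ k • M) x ↔ Represents M x :=
  ⟨fun h' => by simpa using h'.smul (F.u ^ k)⁻¹, fun h' => h'.smul _⟩

theorem IsFlag.zpow_smul (h : F.IsFlag D M₀ M₁ M₂ a b c) (k : ℤ) :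
    F.IsFlag D (F.u ^ k • M₀) (F.u ^ k • M₁) (F.u ^ k • M₂) (a + 3 * k) (b + 3 * k)
      (c + 3 * k) where
  mem_iff x := by simp only [h.mem_iff, represents_zpow_smul]
  lt₁ := units_smul_lt_iff.2 h.lt₁
  lt₂ := units_smul_lt_iff.2 h.lt₂
  lt₃ := by rw [smul_comm]; exact units_smul_lt_iff.2 h.lt₃
  pos₀ := h.pos₀.zpow_smul k
  pos₁ := by convert h.pos₁.zpow_smul k using 1; ring
  pos₂ := by convert h.pos₂.zpow_smul k using 1 <;> ring

theorem IsFlag.charge₁ (h : F.IsFlag D M₀ M₁ M₂ a b c) : F.charge M₁ = F.charge M₀ + 1 := by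
  have h0 := h.pos₀.charge_eq
  have h1 := h.pos₁.charge_eq
  omega

theorem IsFlag.charge₂ (h : F.IsFlag D M₀ M₁ M₂ a b c) : F.charge M₂ = F.charge M₀ + 2 := by
  have h0 := h.pos₀.charge_eq
  have h1 := h.pos₂.charge_eq
  omega

theorem IsFlag.eq_of_represents (h : F.IsFlag D M₀ M₁ M₂ a b c) (hx : x ∈ D.1)
    (hN : Represents N x) : (F.charge N = F.charge M₀ → N = M₀) ∧
      (F.charge N = F.charge M₁ → N = M₁) ∧ (F.charge N = F.charge M₂ → N = M₂) := by
  have h1 := h.charge₁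
  have h2 := h.charge₂
  have key : ∀ P, Represents P x → ∃ k, F.charge N = F.charge P + 3 * k ∧
      (F.charge N = F.charge P → N = P) := by
    intro P hP
    obtain ⟨k, rfl⟩ := F.exists_eq_zpow_smul hP hN
    rw [charge_zpow_smul hP.isLattice]
    refine ⟨k, rfl, fun e => ?_⟩
    obtain rfl : k = 0 := by omega
    simp
  rcases (h.mem_iff x).1 hx with hP | hP | hP <;> obtain ⟨k, hk, hk'⟩ := key _ hP
  · exact ⟨hk', fun e => by omega, fun e => by omega⟩
  · exact ⟨fun e => by omega, hk', fun e => by omega⟩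
  · exact ⟨fun e => by omega, fun e => by omega, hk'⟩

theorem IsFlag.mem₀ (h : F.IsFlag D M₀ M₁ M₂ a b c) : ∃ x ∈ D.1, Represents M₀ x := by
  obtain ⟨x, hx⟩ := exists_vertex h.pos₀.isLattice
  exact ⟨x, (h.mem_iff x).2 (Or.inl hx), hx⟩

/-- The charge selects one representative of each vertex, and each jump is recovered as the one lost
between consecutive lattices. -/
theorem IsFlag.ext (h : F.IsFlag D M₀ M₁ M₂ a b c) (h' : F.IsFlag D N₀ N₁ N₂ a' b' c')
    (hc : F.charge N₀ = F.charge M₀) :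
    N₀ = M₀ ∧ N₁ = M₁ ∧ N₂ = M₂ ∧ a' = a ∧ b' = b ∧ c' = c := by
  have h1 := h.charge₁
  have h2 := h.charge₂
  have h1' := h'.charge₁
  have h2' := h'.charge₂
  obtain ⟨x, hx, hx'⟩ := h'.mem₀
  obtain ⟨y, hy, hy'⟩ := h'.rotate.mem₀
  obtain ⟨z, hz, hz'⟩ := h'.rotate.rotate.mem₀
  obtain rfl := (h.eq_of_represents hx hx').1 hc
  obtain rfl := (h.eq_of_represents hy hy').2.1 (by omega)
  obtain rfl := (h.eq_of_represents hz hz').2.2 (by omega)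
  refine ⟨rfl, rfl, rfl, ?_⟩
  have key : ∀ {P Q : Submodule O (Fin 3 → K)} {a b c a' b' c' : ℤ}, F.Pos P a b c →
      F.Pos Q b c (a + 3) → F.Pos P a' b' c' → F.Pos Q b' c' (a' + 3) → a' = a := by
    intro P Q a b c a' b' c' h1 h2 h3 h4
    have h5 := h3.mem1
    have h6 : a' ∉ F.jumps Q := by
      have := h3.ab
      have := h3.ac
      rw [h4.mem_iff]; omega
    rw [h1.mem_iff] at h5
    rw [h2.mem_iff] at h6
    omega
  exact ⟨key h.pos₀ h.pos₁ h'.pos₀ h'.pos₁, key h.pos₁ h.pos₂ h'.pos₁ h'.pos₂,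
    key h.pos₂ h.pos₀.u_smul h'.pos₂ h'.pos₀.u_smul⟩

theorem exists_flag (F : Filtration O K) (D : Chamber O K) (i : ℤ) :
    ∃ M₀ M₁ M₂ a b c, F.IsFlag D M₀ M₁ M₂ a b c ∧ F.charge M₀ = i := by
  obtain ⟨x, hx⟩ : D.1.Nonempty := by rw [← Finset.card_pos, D.2.card_eq]; norm_num
  obtain ⟨M, hM⟩ := exists_represents x
  obtain ⟨M₁, M₂, a, b, c, h⟩ := F.exists_flag_of_mem hx hM
  have h' := h.zpow_smul ((i - F.charge M) / 3)
  have hc := charge_zpow_smul (F := F) hM.isLattice ((i - F.charge M) / 3)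
  have h1 := h'.charge₁
  have h2 := h'.charge₂
  have h3 : (i - F.charge M) % 3 = 0 ∨ (i - F.charge M) % 3 = 1 ∨ (i - F.charge M) % 3 = 2 := by
    omega
  rcases h3 with h3 | h3 | h3
  · exact ⟨_, _, _, _, _, _, h', by omega⟩
  · exact ⟨_, _, _, _, _, _, h'.rotate, by omega⟩
  · exact ⟨_, _, _, _, _, _, h'.rotate.rotate, by omega⟩

/-- The lattice of charge `i` that represents a vertex of the chamber `D`. -/
def lat (F : Filtration O K) (D : Chamber O K) (i : ℤ) : Submodule O (Fin 3 → K) :=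
  (F.exists_flag D i).choose

/-- The jump of `lat D i` which is not a jump of `lat D (i + 1)`. -/
def pos (F : Filtration O K) (D : Chamber O K) (i : ℤ) : ℤ :=
  (F.exists_flag D i).choose_spec.choose_spec.choose_spec.choose

theorem exists_flag_lat (F : Filtration O K) (D : Chamber O K) (i : ℤ) :
    ∃ M₁ M₂ b c, F.IsFlag D (F.lat D i) M₁ M₂ (F.pos D i) b c ∧ F.charge (F.lat D i) = i := by
  obtain ⟨b, c, h⟩ := (F.exists_flag D i).choose_spec.choose_spec.choose_spec.choose_spec
  exact ⟨_, _, b, c, h⟩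

theorem charge_lat (F : Filtration O K) (D : Chamber O K) (i : ℤ) : F.charge (F.lat D i) = i := by
  obtain ⟨_, _, _, _, -, h⟩ := F.exists_flag_lat D i
  exact h

theorem IsFlag.eq_lat (h : F.IsFlag D M₀ M₁ M₂ a b c) {i : ℤ} (hi : F.charge M₀ = i) :
    M₀ = F.lat D i ∧ a = F.pos D i := by
  obtain ⟨_, _, _, _, h', hi'⟩ := F.exists_flag_lat D i
  obtain ⟨e1, -, -, e2, -⟩ := h'.ext h (by omega)
  exact ⟨e1, e2⟩

theorem isFlag_lat (F : Filtration O K) (D : Chamber O K) (i : ℤ) :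
    F.IsFlag D (F.lat D i) (F.lat D (i + 1)) (F.lat D (i + 2)) (F.pos D i) (F.pos D (i + 1))
      (F.pos D (i + 2)) := by
  obtain ⟨M₁, M₂, b, c, h, hi⟩ := F.exists_flag_lat D i
  have h1 := h.charge₁
  have h2 := h.charge₂
  obtain ⟨e1, e2⟩ := h.rotate.eq_lat (i := i + 1) (by omega)
  obtain ⟨e3, e4⟩ := h.rotate.rotate.eq_lat (i := i + 2) (by omega)
  rwa [← e1, ← e2, ← e3, ← e4]

theorem lat_add_three (F : Filtration O K) (D : Chamber O K) (i : ℤ) :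
    F.lat D (i + 3) = F.u • F.lat D i ∧ F.pos D (i + 3) = F.pos D i + 3 := by
  have h := F.isFlag_lat D i
  obtain ⟨e1, e2⟩ := h.rotate.rotate.rotate.eq_lat (i := i + 3) (by
    rw [charge_u_smul h.pos₀.isLattice, charge_lat])
  exact ⟨e1.symm, e2.symm⟩

theorem IsFlag.eq_lat_all (h : F.IsFlag D M₀ M₁ M₂ a b c) {i : ℤ} (hi : F.charge M₀ = i) :
    M₀ = F.lat D i ∧ M₁ = F.lat D (i + 1) ∧ M₂ = F.lat D (i + 2) ∧
      a = F.pos D i ∧ b = F.pos D (i + 1) ∧ c = F.pos D (i + 2) :=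
  (F.isFlag_lat D i).ext h (by rw [charge_lat, hi])

theorem exists_mem_represents_lat (F : Filtration O K) (D : Chamber O K) (i : ℤ) :
    ∃ x ∈ D.1, Represents (F.lat D i) x := (F.isFlag_lat D i).mem₀

theorem mem_iff_lat (F : Filtration O K) (D : Chamber O K) {x : Vertex O K} :
    x ∈ D.1 ↔ ∃ i, Represents (F.lat D i) x := by
  constructor
  · intro hx
    rcases ((F.isFlag_lat D 0).mem_iff x).1 hx with h | h | h
    exacts [⟨_, h⟩, ⟨_, h⟩, ⟨_, h⟩]
  · rintro ⟨i, hi⟩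
    exact ((F.isFlag_lat D i).mem_iff x).2 (Or.inl hi)

theorem eq_lat_of_mem (hx : x ∈ D.1) (hM : Represents M x) : M = F.lat D (F.charge M) :=
  ((F.isFlag_lat D (F.charge M)).eq_of_represents hx hM).1 (by rw [charge_lat])

theorem eq_of_lat_eq (i : ℤ) (h0 : F.lat D i = F.lat E i) (h1 : F.lat D (i + 1) = F.lat E (i + 1))
    (h2 : F.lat D (i + 2) = F.lat E (i + 2)) : D = E := by
  refine Subtype.ext (Finset.ext fun x => ?_)
  rw [(F.isFlag_lat D i).mem_iff, (F.isFlag_lat E i).mem_iff, h0, h1, h2]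

theorem lat_congr_mod {i j : ℤ} (h : F.lat D i = F.lat E i) (hij : (j - i) % 3 = 0) :
    F.lat D j = F.lat E j := by
  obtain ⟨x, hx, hxi⟩ := F.exists_mem_represents_lat D i
  have hxE : x ∈ E.1 := (F.mem_iff_lat E).2 ⟨i, h ▸ hxi⟩
  have hr : Represents (F.u ^ ((j - i) / 3) • F.lat D i) x := hxi.smul _
  have hc : F.charge (F.u ^ ((j - i) / 3) • F.lat D i) = j := by
    rw [charge_zpow_smul hxi.isLattice, charge_lat]; omega
  rw [← hc, ← eq_lat_of_mem hx hr, ← eq_lat_of_mem hxE hr]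

end Filtration

end Flags

end A2Building

namespace A2Building

/-! ### The affine Weyl group acting on windows -/

section Words

/-- Windows of affine permutations: `(w 0, w 1, w 2)` where `w (i + 3) = w i + 3`. -/
def IsWindow (u : ℤ × ℤ × ℤ) : Prop :=
  (u.2.1 - u.1) % 3 ≠ 0 ∧ (u.2.2 - u.2.1) % 3 ≠ 0 ∧ (u.2.2 - u.1) % 3 ≠ 0 ∧
    u.1 + u.2.1 + u.2.2 = 3

/-- The number of inversions of the affine permutation with window `u`. -/
def len (u : ℤ × ℤ × ℤ) : ℕ :=
  ((u.2.1 - u.1) / 3).natAbs + ((u.2.2 - u.2.1) / 3).natAbs + ((u.2.2 - u.1) / 3).natAbs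

/-- The action of the simple reflections on windows. -/
def refl : Fin 3 → ℤ × ℤ × ℤ → ℤ × ℤ × ℤ
  | 0, u => (u.2.2 - 3, u.2.1, u.1 + 3)
  | 1, u => (u.2.1, u.1, u.2.2)
  | 2, u => (u.1, u.2.2, u.2.1)

/-- The reflection `i` decreases the length of `u`. -/
def Descent : Fin 3 → ℤ × ℤ × ℤ → Prop
  | 0, u => u.1 + 3 < u.2.2
  | 1, u => u.2.1 < u.1
  | 2, u => u.2.2 < u.2.1

/-- The types of the minimal galleries between the window `u` and the trivial window. -/
def IsReduced : ℤ × ℤ × ℤ → List (Fin 3) → Prop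
  | u, [] => u = (0, 1, 2)
  | u, i :: ω => Descent i u ∧ IsReduced (refl i u) ω

theorem len_eq {x y z k l m e₁ e₂ e₃ : ℤ} (hk : y - x = 3 * k + e₁) (hl : z - y = 3 * l + e₂)
    (hm : z - x = 3 * m + e₃) (h₁ : e₁ = 1 ∨ e₁ = 2) (h₂ : e₂ = 1 ∨ e₂ = 2)
    (h₃ : e₃ = 1 ∨ e₃ = 2) : len (x, y, z) = k.natAbs + l.natAbs + m.natAbs := by
  have h1 : (y - x) / 3 = k := by omega
  have h2 : (z - y) / 3 = l := by omega
  have h3 : (z - x) / 3 = m := by omega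
  simp only [len, h1, h2, h3]

theorem refl_refl (i : Fin 3) (u : ℤ × ℤ × ℤ) : refl i (refl i u) = u := by
  fin_cases i <;> simp [refl]

theorem IsWindow.refl {u : ℤ × ℤ × ℤ} (h : IsWindow u) (i : Fin 3) : IsWindow (refl i u) := by
  obtain ⟨x, y, z⟩ := u
  fin_cases i <;> simp only [IsWindow, A2Building.refl] at * <;> omega

theorem IsWindow.len_refl {u : ℤ × ℤ × ℤ} (h : IsWindow u) {i : Fin 3} (hi : Descent i u) :
    len (A2Building.refl i u) + 1 = len u := by
  obtain ⟨x, y, z⟩ := u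
  -- Three distinct residues modulo 3 force the two consecutive gaps to be congruent, so `k, l, e`
  -- determine the third quotient as well.
  have hm : ∃ k l e : ℤ, (e = 1 ∨ e = 2) ∧ y = x + 3 * k + e ∧ z = y + 3 * l + e := by
    simp only [IsWindow] at h
    exact ⟨(y - x) / 3, (z - y) / 3, (y - x) % 3, by omega, by omega, by omega⟩
  clear h
  obtain ⟨k, l, e, he, hy, hz⟩ := hm
  have h0 : len (x, y, z) = k.natAbs + l.natAbs + (k + l + (e - 1)).natAbs :=
    len_eq (e₁ := e) (e₂ := e) (e₃ := 3 - e) (by omega) (by omega) (by omega) he he (by omega)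
  have h1 : len (y, x, z) = (-k - 1).natAbs + (k + l + (e - 1)).natAbs + l.natAbs :=
    len_eq (e₁ := 3 - e) (e₂ := 3 - e) (e₃ := e) (by omega) (by omega) (by omega) (by omega)
      (by omega) he
  have h2 : len (x, z, y) = (k + l + (e - 1)).natAbs + (-l - 1).natAbs + k.natAbs :=
    len_eq (e₁ := 3 - e) (e₂ := 3 - e) (e₃ := e) (by omega) (by omega) (by omega) (by omega)
      (by omega) he
  have h3 : len (z - 3, y, x + 3) = (-l).natAbs + (-k).natAbs + (2 - e - k - l).natAbs :=
    len_eq (e₁ := 3 - e) (e₂ := 3 - e) (e₃ := e) (by omega) (by omega) (by omega) (by omega)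
      (by omega) he
  fin_cases i
  · have hi' : x + 3 < z := hi
    change len (z - 3, y, x + 3) + 1 = _
    omega
  · have hi' : y < x := hi
    change len (y, x, z) + 1 = _
    omega
  · have hi' : z < y := hi
    change len (x, z, y) + 1 = _
    omega

theorem IsWindow.descent_refl {u : ℤ × ℤ × ℤ} (h : IsWindow u) (i : Fin 3) :
    Descent i (A2Building.refl i u) ↔ ¬ Descent i u := by
  obtain ⟨x, y, z⟩ := u
  fin_cases i <;> simp only [IsWindow, A2Building.refl, Descent] at * <;> omega

theorem IsWindow.len_refl_le {u : ℤ × ℤ × ℤ} (h : IsWindow u) (i : Fin 3) :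
    len u ≤ len (A2Building.refl i u) + 1 := by
  by_cases hi : Descent i u
  · exact (h.len_refl hi).ge
  · have := (h.refl i).len_refl ((h.descent_refl i).2 hi)
    rw [refl_refl] at this
    omega

theorem IsWindow.exists_descent {u : ℤ × ℤ × ℤ} (h : IsWindow u) (hu : u ≠ (0, 1, 2)) :
    ∃ i, Descent i u := by
  obtain ⟨x, y, z⟩ := u
  by_contra! h'
  have h0 := h' 0
  have h1 := h' 1
  have h2 := h' 2
  apply hu
  simp only [IsWindow, Descent] at *
  simp only [Prod.mk.injEq]
  omega

theorem IsWindow.exists_reduced {u : ℤ × ℤ × ℤ} (h : IsWindow u) : ∃ ω, IsReduced u ω := by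
  generalize hn : len u = n
  induction n generalizing u with
  | zero =>
    refine ⟨[], ?_⟩
    by_contra hu
    obtain ⟨i, hi⟩ := h.exists_descent hu
    have := h.len_refl hi
    omega
  | succ n ih =>
    have hu : u ≠ (0, 1, 2) := by
      rintro rfl
      simp [len] at hn
    obtain ⟨i, hi⟩ := h.exists_descent hu
    obtain ⟨ω, hω⟩ := ih (h.refl i) (by have := h.len_refl hi; omega)
    exact ⟨i :: ω, hi, hω⟩

theorem IsReduced.length_eq {u : ℤ × ℤ × ℤ} (h : IsWindow u) {ω : List (Fin 3)}
    (hω : IsReduced u ω) : ω.length = len u := by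
  induction ω generalizing u with
  | nil =>
    obtain rfl : u = (0, 1, 2) := hω
    simp [len]
  | cons i ω ih =>
    rw [List.length_cons, ih (h.refl i) hω.2, h.len_refl hω.1]

/-- The simple reflections as permutations. -/
def reflPerm (i : Fin 3) : Equiv.Perm (ℤ × ℤ × ℤ) :=
  ⟨refl i, refl i, refl_refl i, refl_refl i⟩

theorem isLiftable_reflPerm : coxeterMatrix.IsLiftable reflPerm := by
  intro i j
  ext u : 1
  obtain ⟨x, y, z⟩ := u
  fin_cases i <;> fin_cases j <;>
    simp [coxeterMatrix, reflPerm, refl, pow_succ]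

/-- The action of the affine Weyl group on windows. -/
def windowAction : AffineWeyl →* Equiv.Perm (ℤ × ℤ × ℤ) :=
  coxeterMatrix.toCoxeterSystem.lift ⟨reflPerm, isLiftable_reflPerm⟩

/-- The window is recovered from the group element alone, so chambers with different windows have
different Weyl distances. -/
theorem IsReduced.windowAction_wordProd {u : ℤ × ℤ × ℤ} {ω : List (Fin 3)} (hω : IsReduced u ω) :
    windowAction (coxeterMatrix.toCoxeterSystem.wordProd ω) (0, 1, 2) = u := by
  induction ω generalizing u with
  | nil =>
    obtain rfl : u = (0, 1, 2) := hω
    simp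
  | cons i ω ih =>
    rw [CoxeterSystem.wordProd_cons, map_mul, Equiv.Perm.mul_apply, ih hω.2, windowAction,
      CoxeterSystem.lift_apply_simple]
    exact refl_refl i u

end Words

/-! ### Gallery distance, Weyl distance and the size of Weyl spheres -/

section Distance

variable {O K : Type*} [CommRing O] [IsDomain O] [IsDiscreteValuationRing O]
  [Field K] [Algebra O K] [IsFractionRing O K]

/-- The filtration `F` is made of the representatives of the vertices of `C`, indexed compatibly
with the types. -/
structure IsAdapted (F : Filtration O K) (C : Chamber O K) : Prop where
  hasType_iff : ∀ {M : Submodule O (Fin 3 → K)} {x : Vertex O K}, Represents M x →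
    ∀ i : Fin 3, HasType i x ↔ (F.charge M - ((i : ℕ) : ℤ)) % 3 = 0
  mem_iff : ∀ x, x ∈ C.1 ↔ ∃ i, Represents (F.L i) x

namespace Filtration

variable {F : Filtration O K} {C D E : Chamber O K} {M N A B : Submodule O (Fin 3 → K)}
  {p p' r : ℤ} {x y : Vertex O K}

theorem pos_sup_inf_L (hA : F.Pos A (p + 3) (p' + 3) r) (hB : F.Pos B p p' r)
    (hAB : A ≤ B) (huB : F.u • B ≤ A) (hpp : p < p') :
    F.Pos (A ⊔ (B ⊓ F.L p')) (p + 3) p' r where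
  isLattice := isLattice_of_between (F := F) hB.isLattice (huB.trans le_sup_left)
    (sup_le hAB inf_le_left)
  ab := by have := hB.ab; omega
  bc := hB.bc
  ac := hA.ac
  mem_iff j := by
    rw [jumps_sup_inf hAB, Set.mem_union, hA.mem_iff, Set.mem_inter_iff, hB.mem_iff, Set.mem_Ici]
    have := hB.ab
    have := hB.bc
    have := hB.ac
    omega

/-- This is the exceptional line of the pencil between `A` and `B`; it yields the one chamber on a
panel that is closer to the base chamber. -/
theorem eq_sup_inf_L (hA : F.Pos A (p + 3) (p' + 3) r) (hB : F.Pos B p p' r)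
    (hAB : A ≤ B) (huB : F.u • B ≤ A) (hpp : p < p') (h1 : A ≤ N) (h2 : N ≤ B)
    (hN : F.Pos N (p + 3) p' r) : N = A ⊔ (B ⊓ F.L p') := by
  refine (hN.eq_of_le (pos_sup_inf_L hA hB hAB huB hpp) (sup_le h1 ?_)).symm
  refine inf_L_le hB.isLattice h2 fun j hj hpj => ?_
  rw [hB.mem_iff] at hj
  rw [hN.mem_iff]
  omega

/-- The window of the relative position of `D` and the filtration. -/
def win (F : Filtration O K) (D : Chamber O K) : ℤ × ℤ × ℤ := (F.pos D 0, F.pos D 1, F.pos D 2)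

theorem isWindow_win (F : Filtration O K) (D : Chamber O K) : IsWindow (F.win D) := by
  have h := F.isFlag_lat D 0
  have hc := h.pos₀.charge_eq
  rw [charge_lat] at hc
  exact ⟨h.pos₀.ab, h.pos₀.bc, h.pos₀.ac, hc⟩

/-- The chambers `D` and `E` have the same lattices, except possibly in degrees congruent to `i`
modulo `3`. -/
def Agree (F : Filtration O K) (i : ℤ) (D E : Chamber O K) : Prop :=
  ∀ k : ℤ, (k - i) % 3 ≠ 0 → F.lat D k = F.lat E k

theorem Agree.symm {i : ℤ} (h : F.Agree i D E) : F.Agree i E D := fun k hk => (h k hk).symm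

theorem Agree.eq {i : ℤ} (h : F.Agree i D E) (hi : F.lat D i = F.lat E i) : D = E :=
  eq_of_lat_eq i hi (h _ (by omega)) (h _ (by omega))

/-- In an adapted filtration the type of a vertex is the charge of any representative modulo 3, so
sharing the panel of type `i` means sharing all lattices in the other degrees. -/
theorem _root_.A2Building.IsAdapted.adjType_iff (hF : IsAdapted F C) {i : Fin 3} :
    AdjType i D E ↔ D ≠ E ∧ F.Agree ((i : ℕ) : ℤ) D E := by
  refine and_congr_right fun _ => ⟨fun h k hk => ?_, fun h => ?_⟩
  · obtain ⟨x, hx, hxk⟩ := F.exists_mem_represents_lat D k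
    have := eq_lat_of_mem (F := F) ((h x (by rwa [hF.hasType_iff hxk, charge_lat])).1 hx) hxk
    rwa [charge_lat] at this
  · have key : ∀ {D E : Chamber O K}, F.Agree ((i : ℕ) : ℤ) D E → ∀ x, ¬ HasType i x →
        x ∈ D.1 → x ∈ E.1 := by
      intro D E h x hx hxD
      obtain ⟨k, hk⟩ := (F.mem_iff_lat D).1 hxD
      rw [hF.hasType_iff hk, charge_lat] at hx
      exact (F.mem_iff_lat E).2 ⟨k, h k hx ▸ hk⟩
    exact fun x hx => ⟨key h x hx, key h.symm x hx⟩

/-- The lattices in degrees `j` and `j + 2` are common, so the same two jumps are lost between them;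
only their order can change. -/
theorem Agree.pos_eq {j : ℤ} (h : F.Agree (j + 1) D E) :
    F.pos E (j + 2) = F.pos D (j + 2) ∧
    ((F.pos E j = F.pos D j ∧ F.pos E (j + 1) = F.pos D (j + 1)) ∨
      (F.pos E j = F.pos D (j + 1) ∧ F.pos E (j + 1) = F.pos D j)) := by
  have hD := F.isFlag_lat D j
  have hE := F.isFlag_lat E j
  have e0 := h j (by omega)
  have e2 := h (j + 2) (by omega)
  have h0 := hE.pos₀
  have h2 := hE.pos₂
  rw [← e0] at h0
  rw [← e2] at h2
  have k1 := h0.eq_or hD.pos₀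
  have k2 := h0.swap12.eq_or hD.pos₀
  have k3 := h0.swap23.swap12.eq_or hD.pos₀
  have l1 := h2.eq_or hD.pos₂
  have l2 := h2.swap12.eq_or hD.pos₂
  have l3 := h2.swap23.swap12.eq_or hD.pos₂
  have := h0.ab
  have := h0.bc
  have := h0.ac
  have := hD.pos₀.ab
  have := hD.pos₀.bc
  have := hD.pos₀.ac
  omega

theorem exists_agree (j : ℤ) (h1 : F.lat D (j + 2) < N) (h2 : N < F.lat D j) :
    ∃ E, F.Agree (j + 1) D E ∧ F.lat E (j + 1) = N := by
  have hD := F.isFlag_lat D j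
  obtain ⟨E, a, b, c, hE⟩ := exists_chamber hD.pos₀.isLattice h2 h1 hD.lt₃
  obtain ⟨e0, e1, e2, -⟩ := hE.eq_lat_all (charge_lat F D j)
  refine ⟨E, fun k hk => ?_, e1.symm⟩
  rcases (show (k - j) % 3 = 0 ∨ (k - (j + 2)) % 3 = 0 by omega) with h | h
  · exact lat_congr_mod e0 h
  · exact lat_congr_mod e2 h

/-- Across a descent there is exactly one chamber which is closer. -/
theorem existsUnique_agree_of_lt {j : ℤ} (h : F.pos D (j + 1) < F.pos D j) :
    ∃! E, F.Agree (j + 1) D E ∧ F.pos E j = F.pos D (j + 1) ∧ F.pos E (j + 1) = F.pos D j := by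
  have hD := F.isFlag_lat D j
  have hA := hD.pos₂.swap12.swap23.swap12.swap23.swap12
  have hB := hD.pos₀.swap12
  have hAB := hD.lt₂.le.trans hD.lt₁.le
  have hN := pos_sup_inf_L (hD.pos₂.swap23.swap12.swap23) hB hAB hD.lt₃.le h
  set N := F.lat D (j + 2) ⊔ (F.lat D j ⊓ F.L (F.pos D j)) with hNdef
  have hcN := hN.charge_eq
  have hc0 := hD.pos₀.charge_eq
  have hc2 := hD.pos₂.charge_eq
  have h1 : F.lat D (j + 2) < N := by
    refine lt_of_le_of_ne le_sup_left fun e => ?_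
    rw [e] at hc2
    omega
  have h2 : N < F.lat D j := by
    refine lt_of_le_of_ne (sup_le hAB inf_le_left) fun e => ?_
    rw [← e] at hc0
    omega
  obtain ⟨E, hE, hEN⟩ := exists_agree j h1 h2
  have key : ∀ E', F.Agree (j + 1) D E' → (F.pos E' j = F.pos D (j + 1) ∧
      F.pos E' (j + 1) = F.pos D j ↔ F.lat E' (j + 1) = N) := by
    intro E' hE'
    have hfl := F.isFlag_lat E' j
    have e0 := hE' j (by omega)
    have e2 := hE' (j + 2) (by omega)
    obtain ⟨e3, e4⟩ := hE'.pos_eq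
    constructor
    · rintro ⟨k1, k2⟩
      have hP := hfl.pos₁
      rw [k1, k2, e3] at hP
      refine eq_sup_inf_L (hD.pos₂.swap23.swap12.swap23) hB hAB hD.lt₃.le h ?_ ?_
        hP.swap23.swap12
      · rw [e2]; exact hfl.lt₂.le
      · rw [e0]; exact hfl.lt₁.le
    · intro e
      rcases e4 with e4 | e4
      · exfalso
        have hP := hfl.pos₁
        rw [e, e3, e4.1, e4.2] at hP
        have k1 := hP.eq_or hN
        have k2 := hP.swap12.eq_or hN
        have := hD.pos₀.ab
        have := hD.pos₀.bc
        have := hD.pos₀.ac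
        omega
      · exact e4
  refine ⟨E, ⟨hE, (key E hE).2 hEN⟩, ?_⟩
  rintro E' ⟨hE', hE''⟩
  have e := (key E' hE').1 hE''
  have hEE : F.Agree (j + 1) E' E := fun k hk => (hE' k hk).symm.trans (hE k hk)
  exact hEE.eq (e.trans hEN.symm)

/-- Across an ascent there are exactly `q` chambers which are farther. -/
theorem ncard_agree_of_lt {j : ℤ} (h : F.pos E j < F.pos E (j + 1)) :
    {D | F.Agree (j + 1) D E ∧ F.pos D j = F.pos E (j + 1) ∧ F.pos D (j + 1) = F.pos E j}.ncard =
      Nat.card (IsLocalRing.ResidueField O) := by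
  have hE := F.isFlag_lat E j
  have hA := hE.pos₂.swap12.swap23
  have hAB := hE.lt₂.le.trans hE.lt₁.le
  rw [← ncard_between hA hE.pos₀ hAB hE.lt₃.le h]
  refine Set.ncard_congr (fun D _ => F.lat D (j + 1)) ?_ ?_ ?_
  · rintro D ⟨hD, h1, h2⟩
    have hfl := F.isFlag_lat D j
    have e0 := hD j (by omega)
    have e2 := hD (j + 2) (by omega)
    have e3 := hD.pos_eq.1
    refine ⟨by rw [← e2]; exact hfl.lt₂.le, by rw [← e0]; exact hfl.lt₁.le, ?_⟩
    have hP := hfl.pos₁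
    rw [h1, h2, ← e3] at hP
    exact hP.swap23
  · rintro D D' ⟨hD, -⟩ ⟨hD', -⟩ e
    have : F.Agree (j + 1) D D' := fun k hk => (hD k hk).trans (hD' k hk).symm
    exact this.eq e
  · rintro N ⟨h1, h2, hN⟩
    have hcN := hN.charge_eq
    have hc0 := hE.pos₀.charge_eq
    have hc2 := hE.pos₂.charge_eq
    have h1' : F.lat E (j + 2) < N := by
      refine lt_of_le_of_ne h1 fun e => ?_
      rw [e] at hc2
      omega
    have h2' : N < F.lat E j := by
      refine lt_of_le_of_ne h2 fun e => ?_
      rw [← e] at hc0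
      omega
    obtain ⟨D, hD, hDN⟩ := exists_agree j h1' h2'
    refine ⟨D, ⟨hD.symm, ?_⟩, hDN⟩
    obtain ⟨e3, e4 | e4⟩ := hD.pos_eq
    · exfalso
      have hP := (F.isFlag_lat D j).pos₁
      rw [hDN, e3, e4.1, e4.2] at hP
      have k1 := hP.eq_or hN
      have k2 := hP.swap12.eq_or hN
      have := hE.pos₀.ab
      have := hE.pos₀.bc
      have := hE.pos₀.ac
      omega
    · exact e4

/-- The panel of type 0 exchanges degrees `-1` and `0`, whereas the window records degree 2 in place
of `-1`; this explains the shifts by 3 in `refl 0`. -/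
theorem pos_sub_one (F : Filtration O K) (D : Chamber O K) :
    F.pos D 2 = F.pos D (-1) + 3 := by
  simpa using (F.lat_add_three D (-1)).2

theorem Agree.win_eq_refl_iff {i : Fin 3} (h : F.Agree ((i : ℕ) : ℤ) D E) :
    F.win E = refl i (F.win D) ↔ F.pos E ((i : ℕ) - 1 : ℤ) = F.pos D (i : ℕ) ∧
      F.pos E (i : ℕ) = F.pos D ((i : ℕ) - 1 : ℤ) := by
  have h1 := F.pos_sub_one D
  have h2 := F.pos_sub_one E
  have h5 := (F.lat_add_three D 0).2
  have h6 := (F.lat_add_three E 0).2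
  have h' : F.Agree ((((i : ℕ) : ℤ) - 1) + 1) D E := by simpa using h
  have h3 := h'.pos_eq.1
  fin_cases i <;> norm_num [win, refl] at * <;> omega

theorem Agree.win_eq_or {i : Fin 3} (h : F.Agree ((i : ℕ) : ℤ) D E) :
    F.win E = F.win D ∨ F.win E = refl i (F.win D) := by
  have h1 := F.pos_sub_one D
  have h2 := F.pos_sub_one E
  have h5 := (F.lat_add_three D 0).2
  have h6 := (F.lat_add_three E 0).2
  have h' : F.Agree ((((i : ℕ) : ℤ) - 1) + 1) D E := by simpa using h
  obtain ⟨h3, h4⟩ := h'.pos_eq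
  fin_cases i <;> norm_num [win, refl] at * <;> omega

theorem descent_win_iff {i : Fin 3} :
    Descent i (F.win D) ↔ F.pos D (i : ℕ) < F.pos D ((i : ℕ) - 1 : ℤ) := by
  have h1 := F.pos_sub_one D
  fin_cases i <;> norm_num [win, Descent] at *; omega

theorem existsUnique_of_descent {i : Fin 3} (h : Descent i (F.win D)) :
    ∃! E, F.Agree ((i : ℕ) : ℤ) D E ∧ F.win E = refl i (F.win D) := by
  rw [descent_win_iff] at h
  have := existsUnique_agree_of_lt (F := F) (D := D) (j := ((i : ℕ) : ℤ) - 1) (by simpa using h)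
  simp only [sub_add_cancel] at this
  convert this using 2 with E
  exact and_congr_right fun hE => hE.win_eq_refl_iff

theorem ncard_of_not_descent {i : Fin 3} (h : ¬ Descent i (F.win E)) :
    {D | F.Agree ((i : ℕ) : ℤ) D E ∧ F.win D = refl i (F.win E)}.ncard =
      Nat.card (IsLocalRing.ResidueField O) := by
  have hw := F.isWindow_win E
  have h' : F.pos E ((i : ℕ) - 1 : ℤ) < F.pos E (i : ℕ) := by
    rw [descent_win_iff] at h
    have := (F.isFlag_lat E (((i : ℕ) : ℤ) - 1)).pos₀.ab
    simp only [sub_add_cancel] at this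
    omega
  have := ncard_agree_of_lt (F := F) (E := E) (j := ((i : ℕ) : ℤ) - 1) (by simpa using h')
  simp only [sub_add_cancel] at this
  rw [← this]
  congr 1
  ext D
  exact and_congr_right fun hD => hD.symm.win_eq_refl_iff

end Filtration

namespace IsAdapted

variable {F : Filtration O K} {C D E : Chamber O K} (hF : IsAdapted F C)
include hF

theorem lat_eq (i : ℤ) : F.lat C i = F.L i := by
  obtain ⟨x, hx⟩ := exists_vertex (F.isLattice i)
  have := F.eq_lat_of_mem ((hF.mem_iff x).2 ⟨i, hx⟩) hx
  rw [F.charge_L] at this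
  exact this.symm

theorem pos_eq (i : ℤ) : F.pos C i = i := by
  have h := F.isFlag_lat C i
  have h0 := h.pos₀
  have h1 := h.pos₁
  rw [hF.lat_eq] at h0 h1
  have e1 := h0.eq_or (F.pos_L i)
  have e2 := h1.eq_or (F.pos_L (i + 1))
  have e3 := h1.swap12.eq_or (F.pos_L (i + 1))
  have := (F.pos_L i).eq_or h0
  omega

theorem win_eq : F.win C = (0, 1, 2) := by
  simp [Filtration.win, hF.pos_eq]

theorem eq_of_win_eq (h : F.win D = (0, 1, 2)) : D = C := by
  have hD := F.isFlag_lat D 0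
  simp only [Filtration.win, Prod.mk.injEq] at h
  obtain ⟨h0, h1, h2⟩ := h
  have p0 := hD.pos₀
  have p1 := hD.pos₁
  have p2 := hD.pos₂
  norm_num [h0, h1, h2] at p0 p1 p2
  refine F.eq_of_lat_eq 0 ?_ ?_ ?_ <;> rw [hF.lat_eq]
  · exact Filtration.Pos.eq_L (by simpa using p0)
  · exact Filtration.Pos.eq_L (by simpa using p1)
  · exact Filtration.Pos.eq_L (by simpa using p2)

/-- Each descent in the word is followed by moving to the unique closer chamber across that panel.
-/
theorem isGallery_of_isReduced {ω : List (Fin 3)} (h : IsReduced (F.win D) ω) :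
    IsGallery D C ω := by
  induction ω generalizing D with
  | nil => rw [hF.eq_of_win_eq h]; exact .nil C
  | cons i ω ih =>
    obtain ⟨E, ⟨hE, hE'⟩, -⟩ := Filtration.existsUnique_of_descent h.1
    refine .cons (hF.adjType_iff.2 ⟨?_, hE⟩) (ih (hE' ▸ h.2))
    rintro rfl
    have := (F.isWindow_win D).len_refl h.1
    rw [← hE'] at this
    omega

theorem len_le_of_isGallery {ω : List (Fin 3)} (h : IsGallery D C ω) :
    len (F.win D) ≤ ω.length := by
  -- The endpoint is generalised to `E` so that induction on the gallery is possible.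
  have key : ∀ {D E : Chamber O K} {ω : List (Fin 3)}, IsGallery D E ω → E = C →
      len (F.win D) ≤ ω.length := by
    intro D E ω h hE
    induction h with
    | nil D => rw [hE, hF.win_eq]; simp [len]
    | @cons D D' E i ω hDD' _ ih =>
      have hag := (hF.adjType_iff.1 hDD').2
      have h1 := ih hE
      have h2 := (F.isWindow_win D).len_refl_le i
      rw [List.length_cons]
      rcases hag.win_eq_or with e | e <;> rw [e] at h1 <;> omega
  exact key h rfl

theorem isReduced_of_isGallery {ω : List (Fin 3)} (h : IsGallery D C ω)
    (hl : ω.length = len (F.win D)) : IsReduced (F.win D) ω := by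
  have key : ∀ {D E : Chamber O K} {ω : List (Fin 3)}, IsGallery D E ω → E = C →
      ω.length = len (F.win D) → IsReduced (F.win D) ω := by
    intro D E ω h hE
    induction h with
    | nil D => rw [hE, hF.win_eq]; exact fun _ => rfl
    | @cons D D' E i ω hDD' hg ih =>
      intro hl
      have hag := (hF.adjType_iff.1 hDD').2
      have hle := hF.len_le_of_isGallery (hE ▸ hg)
      have hw := F.isWindow_win D
      have hle' := hw.len_refl_le i
      rw [List.length_cons] at hl
      rcases hag.win_eq_or with e | e
      · rw [e] at hle; omega
      · rw [e] at hle ih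
        have hd : Descent i (F.win D) := by
          by_contra hd
          have := (hw.refl i).len_refl ((hw.descent_refl i).2 hd)
          rw [refl_refl] at this
          omega
        exact ⟨hd, ih hE (by have := hw.len_refl hd; omega)⟩
  exact key h rfl hl

theorem dist_eq (D : Chamber O K) : dist D C = len (F.win D) := by
  obtain ⟨ω, hω⟩ := (F.isWindow_win D).exists_reduced
  refine le_antisymm (Nat.sInf_le ⟨ω, hF.isGallery_of_isReduced hω,
    hω.length_eq (F.isWindow_win D)⟩) ?_
  refine le_csInf ⟨_, ω, hF.isGallery_of_isReduced hω, rfl⟩ ?_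
  rintro r ⟨ω', hω', rfl⟩
  exact hF.len_le_of_isGallery hω'

/-- The minimal galleries from `D` have exactly the reduced words of `F.win D` as types. The chosen
word thus depends on the window only, and no comparison of different reduced words is needed. -/
theorem weylDist_eq (D : Chamber O K) : weylDist D C =
    coxeterMatrix.toCoxeterSystem.wordProd (Classical.epsilon (IsReduced (F.win D))) := by
  have : (fun ω => IsGallery D C ω ∧ ω.length = dist D C) = IsReduced (F.win D) := by
    funext ω
    rw [hF.dist_eq]
    exact propext ⟨fun h => hF.isReduced_of_isGallery h.1 h.2,
      fun h => ⟨hF.isGallery_of_isReduced h, h.length_eq (F.isWindow_win D)⟩⟩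
  rw [weylDist, this]

theorem weylDist_eq_iff : weylDist D C = weylDist E C ↔ F.win D = F.win E := by
  rw [hF.weylDist_eq, hF.weylDist_eq]
  refine ⟨fun h => ?_, fun h => by rw [h]⟩
  have hD := Classical.epsilon_spec (F.isWindow_win D).exists_reduced
  have hE := Classical.epsilon_spec (F.isWindow_win E).exists_reduced
  rw [← hD.windowAction_wordProd, h, hE.windowAction_wordProd]

theorem weylSphere_eq (E : Chamber O K) :
    weylSphere C (weylDist E C) = {D | F.win D = F.win E} := by
  ext D
  exact hF.weylDist_eq_iff

/-- Induction on the length: a descent `i` of `u` fibres the chambers with window `u` over those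
with window `refl i u`. Uniqueness of the closer chamber makes the fibres disjoint, and each has `q`
elements. -/
theorem finite_and_ncard_win_eq [Finite (IsLocalRing.ResidueField O)] {u : ℤ × ℤ × ℤ}
    (hu : IsWindow u) : {D | F.win D = u}.Finite ∧
      {D | F.win D = u}.ncard = Nat.card (IsLocalRing.ResidueField O) ^ len u := by
  have hq : 0 < Nat.card (IsLocalRing.ResidueField O) := Nat.card_pos
  generalize hn : len u = n
  induction n generalizing u with
  | zero =>
    have hu0 : u = (0, 1, 2) := by
      by_contra hu0
      obtain ⟨i, hi⟩ := hu.exists_descent hu0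
      have := hu.len_refl hi
      omega
    have : {D | F.win D = u} = {C} := by
      ext D
      rw [hu0, Set.mem_singleton_iff]
      exact ⟨fun h => hF.eq_of_win_eq h, fun h => h ▸ hF.win_eq⟩
    rw [this]
    simp
  | succ n ih =>
    have hu0 : u ≠ (0, 1, 2) := by
      rintro rfl
      simp [len] at hn
    obtain ⟨i, hi⟩ := hu.exists_descent hu0
    obtain ⟨hfin, hcard⟩ := ih (hu.refl i) (by have := hu.len_refl hi; omega)
    have hfib : ∀ E ∈ {E | F.win E = refl i u},
        {D | F.Agree ((i : ℕ) : ℤ) D E ∧ F.win D = u}.ncard =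
          Nat.card (IsLocalRing.ResidueField O) := by
      intro E hE
      rw [← Filtration.ncard_of_not_descent (F := F) (E := E) (i := i) ?_]
      · rw [show F.win E = refl i u from hE, refl_refl]
      · rw [show F.win E = refl i u from hE, hu.descent_refl]
        simpa using hi
    have hfib' : ∀ E ∈ {E | F.win E = refl i u},
        {D | F.Agree ((i : ℕ) : ℤ) D E ∧ F.win D = u}.Finite := fun E hE =>
      Set.finite_of_ncard_pos (by rw [hfib E hE]; exact hq)
    have hunion : {D | F.win D = u} =
        ⋃ E ∈ {E | F.win E = refl i u}, {D | F.Agree ((i : ℕ) : ℤ) D E ∧ F.win D = u} := by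
      ext D
      simp only [Set.mem_iUnion, Set.mem_ofPred_eq, exists_prop]
      refine ⟨fun h => ?_, fun ⟨_, _, _, h⟩ => h⟩
      obtain ⟨E, ⟨hE, hE'⟩, -⟩ := Filtration.existsUnique_of_descent
        (F := F) (D := D) (i := i) (h ▸ hi)
      exact ⟨E, by rw [hE', h], hE, h⟩
    have hdisj : Set.PairwiseDisjoint {E | F.win E = refl i u}
        fun E => {D | F.Agree ((i : ℕ) : ℤ) D E ∧ F.win D = u} := by
      intro E hE E' hE' hne
      refine Set.disjoint_left.2 ?_
      rintro D ⟨h1, h2⟩ ⟨h1', -⟩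
      exact hne ((Filtration.existsUnique_of_descent (F := F) (D := D) (i := i)
        (h2 ▸ hi)).unique ⟨h1, by rw [h2]; exact hE⟩ ⟨h1', by rw [h2]; exact hE'⟩)
    rw [hunion]
    refine ⟨hfin.biUnion hfib', ?_⟩
    rw [hfin.ncard_biUnion hfib' hdisj, finsum_mem_congr rfl hfib,
      finsum_mem_eq_finite_toFinset_sum _ hfin, Finset.sum_const,
      ← Set.ncard_eq_toFinset_card _ hfin, hcard, smul_eq_mul, pow_succ]

end IsAdapted

end Distance

end A2Building

namespace A2Building

/-! ### Levels of positions and of their neighbours -/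

section Levels

/-- The number of walls that separate a vertex in position `a, b, c` from the base chamber. -/
def lev (a b c : ℤ) : ℕ := (b - a).natAbs / 3 + (c - b).natAbs / 3 + (c - a).natAbs / 3

theorem natAbs_ediv_three {d : ℤ} (hd : d % 3 ≠ 0) :
    (d / 3).natAbs = d.natAbs / 3 + if d < 0 then 1 else 0 := by
  split_ifs <;> omega

/-- A negative difference has its floor one further from 0 than its truncation, so `len` exceeds the
symmetric quantity `lev` by the number of inversions of the triple. The minimum over all orders is
reached exactly at the increasing one. -/
theorem len_eq_lev {a b c : ℤ} (h1 : (b - a) % 3 ≠ 0) (h2 : (c - b) % 3 ≠ 0)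
    (h3 : (c - a) % 3 ≠ 0) : len (a, b, c) = lev a b c + ((if b < a then 1 else 0) +
      (if c < b then 1 else 0) + (if c < a then 1 else 0)) := by
  simp only [len, lev, natAbs_ediv_three h1, natAbs_ediv_three h2, natAbs_ediv_three h3, sub_neg]
  omega

theorem lev_le_len {a b c : ℤ} (h1 : (b - a) % 3 ≠ 0) (h2 : (c - b) % 3 ≠ 0)
    (h3 : (c - a) % 3 ≠ 0) : lev a b c ≤ len (a, b, c) := by
  rw [len_eq_lev h1 h2 h3]
  omega

theorem len_eq_lev_iff {a b c : ℤ} (h1 : (b - a) % 3 ≠ 0) (h2 : (c - b) % 3 ≠ 0)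
    (h3 : (c - a) % 3 ≠ 0) : len (a, b, c) = lev a b c ↔ a < b ∧ b < c := by
  rw [len_eq_lev h1 h2 h3]
  split_ifs <;> omega

theorem len_rotate {a b c : ℤ} (h1 : (b - a) % 3 ≠ 0) (h2 : (c - b) % 3 ≠ 0)
    (h3 : (c - a) % 3 ≠ 0) : len (b, c, a + 3) = len (a, b, c) := by
  simp only [len]
  omega

/-- The shape of sorted triples of a given level. -/
theorem exists_of_lev_eq {a b c : ℤ} (h1 : (b - a) % 3 ≠ 0) (h2 : (c - b) % 3 ≠ 0)
    (h3 : (c - a) % 3 ≠ 0) (hab : a < b) (hbc : b < c) {n : ℕ} (h : lev a b c = n) :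
    ∃ k : ℕ, k ≤ n / 2 ∧ b = a + 1 + (n % 2 : ℕ) + 3 * k ∧
      c = a + 2 + 2 * (n % 2 : ℕ) + 3 * (n / 2 : ℕ) := by
  obtain ⟨k, l, e, he, hb, hc⟩ : ∃ k l e : ℕ, (e = 0 ∨ e = 1) ∧ b = a + 1 + e + 3 * k ∧
      c = b + 1 + e + 3 * l := by
    refine ⟨((b - a) / 3).toNat, ((c - b) / 3).toNat, ((b - a) % 3 - 1).toNat, ?_, ?_, ?_⟩ <;> omega
  have e1 : (b - a).natAbs = 3 * k + (1 + e) := by omega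
  have e2 : (c - b).natAbs = 3 * l + (1 + e) := by omega
  have e3 : (c - a).natAbs = 3 * (k + l) + (2 + 2 * e) := by omega
  rw [lev, e1, e2, e3] at h
  rcases he with rfl | rfl
  · obtain rfl : n = 2 * (k + l) := by omega
    exact ⟨k, by omega, by omega, by omega⟩
  · obtain rfl : n = 2 * (k + l) + 1 := by omega
    exact ⟨k, by omega, by omega, by omega⟩

theorem lev_of_eq {a b c : ℤ} {n k : ℕ} (hk : k ≤ n / 2) (hb : b = a + 1 + (n % 2 : ℕ) + 3 * k)
    (hc : c = a + 2 + 2 * (n % 2 : ℕ) + 3 * (n / 2 : ℕ)) :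
    lev a b c = n ∧ (b - a) % 3 ≠ 0 ∧ (c - b) % 3 ≠ 0 ∧ (c - a) % 3 ≠ 0 ∧ a < b ∧ b < c := by
  have e1 : (b - a).natAbs = 3 * k + (1 + n % 2) := by omega
  have e2 : (c - b).natAbs = 3 * (n / 2 - k) + (1 + n % 2) := by omega
  have e3 : (c - a).natAbs = 3 * (n / 2) + (2 + 2 * (n % 2)) := by omega
  refine ⟨?_, by omega, by omega, by omega, by omega, by omega⟩
  rw [lev, e1, e2, e3]
  have hn : n % 2 = 0 ∨ n % 2 = 1 := by omega
  rcases hn with hn | hn <;> rw [hn] <;> omega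

/-- The levels of the possible positions of the neighbours of a vertex. -/
theorem lev_neighbour {a b c : ℤ} (h1 : (b - a) % 3 ≠ 0) (h2 : (c - b) % 3 ≠ 0)
    (h3 : (c - a) % 3 ≠ 0) (hab : a < b) (hbc : b < c) (hl0 : lev a b c ≠ 0) :
    lev a b c < lev a b (c + 3) ∧ lev a b c < lev a (b + 3) (c + 3) ∧
      lev (a + 3) b c < lev a b c ∧ lev (a + 3) (b + 3) c < lev a b c ∧
      (lev a (b + 3) c = lev a b c ∧ b + 3 < c ∨ lev a b c < lev a (b + 3) c ∧ ¬ b + 3 < c) ∧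
      (lev (a + 3) b (c + 3) = lev a b c ∧ a + 3 < b ∨
        lev a b c < lev (a + 3) b (c + 3) ∧ ¬ a + 3 < b) := by
  obtain ⟨k, l, e, he, hb, hc⟩ : ∃ k l e : ℕ, (e = 0 ∨ e = 1) ∧ b = a + 1 + e + 3 * k ∧
      c = b + 1 + e + 3 * l := by
    refine ⟨((b - a) / 3).toNat, ((c - b) / 3).toNat, ((b - a) % 3 - 1).toNat, ?_, ?_, ?_⟩ <;> omega
  -- The truncated differences `k - 1`, `l - 1` and `k + l + e - 1` are correct also at 0, because
  -- the corresponding absolute values are then below 3.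
  have g1 : (b - a).natAbs / 3 = k := by omega
  have g2 : (b + 3 - a).natAbs / 3 = k + 1 := by omega
  have g3 : (b - (a + 3)).natAbs / 3 = k - 1 := by omega
  have g4 : (c - b).natAbs / 3 = l := by omega
  have g5 : (c + 3 - b).natAbs / 3 = l + 1 := by omega
  have g6 : (c - (b + 3)).natAbs / 3 = l - 1 := by omega
  have g7 : (c - a).natAbs / 3 = k + l + e := by omega
  have g8 : (c + 3 - a).natAbs / 3 = k + l + e + 1 := by omega
  have g9 : (c - (a + 3)).natAbs / 3 = k + l + e - 1 := by omega
  have e1 : ∀ s t : ℤ, s + 3 - (t + 3) = s - t := fun s t => by ring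
  simp only [lev, e1, g1, g2, g3, g4, g5, g6, g7, g8, g9] at hl0 ⊢
  clear g1 g2 g3 g4 g5 g6 g7 g8 g9 h1 h2 h3 e1
  subst hc hb
  refine ⟨?_, ?_, ?_, ?_, ?_, ?_⟩ <;> rcases he with rfl | rfl <;> omega

end Levels

/-! ### The chamber at a vertex nearest to the base chamber -/

section Summits

variable {O K : Type*} [CommRing O] [IsDomain O] [IsDiscreteValuationRing O]
  [Field K] [Algebra O K] [IsFractionRing O K]

namespace Filtration

variable {F : Filtration O K} {C D E : Chamber O K} {M N M₀ M₁ M₂ : Submodule O (Fin 3 → K)}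
  {x y z : Vertex O K} {a b c a' b' c' : ℤ}

theorem Pos.lev_eq (h : F.Pos M a b c) (h' : F.Pos M a' b' c') : lev a b c = lev a' b' c' := by
  have e1 := h.eq_or h'
  have e2 := h.swap12.eq_or h'
  have e3 := h.swap23.swap12.eq_or h'
  have h1 := h.ab
  have h2 := h.bc
  have h3 := h.ac
  have hab : a ≠ b := by rintro rfl; simp at h1
  have hbc : b ≠ c := by rintro rfl; simp at h2
  have hac : a ≠ c := by rintro rfl; simp at h3
  clear h h' h1 h2 h3
  rcases e1 with rfl | rfl | rfl <;> rcases e2 with rfl | rfl | rfl <;>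
    rcases e3 with rfl | rfl | rfl <;>
    first
      | exact absurd rfl hab
      | exact absurd rfl hac
      | exact absurd rfl hbc
      | (unfold lev; omega)

theorem IsFlag.len_win (h : F.IsFlag D M₀ M₁ M₂ a b c) : len (F.win D) = len (a, b, c) := by
  obtain ⟨-, -, -, rfl, rfl, rfl⟩ := h.eq_lat_all rfl
  have step : ∀ i, len (F.pos D (i + 1), F.pos D (i + 1 + 1), F.pos D (i + 1 + 2)) =
      len (F.pos D i, F.pos D (i + 1), F.pos D (i + 2)) := by
    intro i
    have hi := (F.isFlag_lat D i).pos₀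
    rw [← len_rotate hi.ab hi.bc hi.ac, ← (F.lat_add_three D i).2]
    rw [show i + 1 + 1 = i + 2 by ring, show i + 1 + 2 = i + 3 by ring]
  have all : ∀ i, len (F.pos D i, F.pos D (i + 1), F.pos D (i + 2)) = len (F.win D) := by
    intro i
    induction i using Int.induction_on with
    | zero => rfl
    | succ i ih => rw [step, ih]
    | pred i ih => rw [← step, sub_add_cancel, ih]
  exact (all _).symm

theorem IsFlag.of_pos {M₁ M₂ : Submodule O (Fin 3 → K)} (h : F.Pos M a b c) (h1 : F.Pos M₁ b c (a + 3))
    (h2 : F.Pos M₂ c (a + 3) (b + 3)) (hM1 : M₁ ≤ M) (hM2 : M₂ ≤ M₁) (hM3 : F.u • M ≤ M₂) :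
    ∃ D, F.IsFlag D M M₁ M₂ a b c := by
  have c0 := h.charge_eq
  have c1 := h1.charge_eq
  have c2 := h2.charge_eq
  have c3 := h.u_smul.charge_eq
  have lt1 : M₁ < M := lt_of_le_of_ne hM1 (by rintro rfl; omega)
  have lt2 : M₂ < M₁ := lt_of_le_of_ne hM2 (by rintro rfl; omega)
  have lt3 : F.u • M < M₂ := lt_of_le_of_ne hM3 (by rintro rfl; omega)
  obtain ⟨D, _, _, _, hD⟩ := exists_chamber h.isLattice lt1 lt2 lt3
  exact ⟨D, hD.mem_iff, lt1, lt2, lt3, h, h1, h2⟩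

theorem exists_isFlag_cut (h : F.Pos M a b c) (hab : a < b) (hbc : b < c) :
    ∃ D, F.IsFlag D M (F.cut M b) (F.cut M c) a b c :=
  IsFlag.of_pos h (h.cut2 hab hbc) (h.cut3 hab hbc) (cut_le _ _) (cut_antitone _ hbc.le)
    (u_smul_le_cut _ _)

theorem IsFlag.eq_cut (h : F.IsFlag D M M₁ M₂ a b c) (hab : a < b) (hbc : b < c) :
    M₁ = F.cut M b ∧ M₂ = F.cut M c :=
  ⟨h.pos₀.eq_cut2 hab hbc (h.lt₃.trans h.lt₂).le h.lt₁.le h.pos₁,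
    h.pos₀.eq_cut3 hab hbc h.lt₃.le (h.lt₂.trans h.lt₁).le h.pos₂⟩

/-- `D` is the projection of the base chamber to `x`, and `a, b, c` is the position of `x`. -/
def Summit (F : Filtration O K) (D : Chamber O K) (x : Vertex O K) (a b c : ℤ) : Prop :=
  ∃ M₀ M₁ M₂, Represents M₀ x ∧ F.IsFlag D M₀ M₁ M₂ a b c ∧ a < b ∧ b < c

theorem Summit.shift (h : F.Summit D x a b c) (k : ℤ) :
    F.Summit D x (a + 3 * k) (b + 3 * k) (c + 3 * k) := by
  obtain ⟨M₀, M₁, M₂, hx, hD, h1, h2⟩ := h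
  exact ⟨_, _, _, hx.smul _, hD.zpow_smul k, by omega, by omega⟩

theorem Summit.exists_flag (h : F.Summit D x a b c) (hM : Represents M x) :
    ∃ k M₁ M₂, F.IsFlag D M M₁ M₂ (a + 3 * k) (b + 3 * k) (c + 3 * k) := by
  obtain ⟨M₀, M₁, M₂, hx, hD, h1, h2⟩ := h
  obtain ⟨k, rfl⟩ := F.exists_eq_zpow_smul hx hM
  exact ⟨k, _, _, hD.zpow_smul k⟩

theorem Summit.of_pos (hM : Represents M x) (h : F.Pos M a b c) (hab : a < b) (hbc : b < c) :
    ∃ D, F.Summit D x a b c := by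
  obtain ⟨D, hD⟩ := exists_isFlag_cut h hab hbc
  exact ⟨D, _, _, _, hM, hD, hab, hbc⟩

/-- An increasing flag at `M` consists of the cuts of `M`, so there is only one. -/
theorem IsFlag.eq_chamber (h : F.IsFlag D M M₁ M₂ a b c) {N₁ N₂ : Submodule O (Fin 3 → K)}
    (h' : F.IsFlag E M N₁ N₂ a' b' c') (hab : a < b) (hbc : b < c) (hab' : a' < b')
    (hbc' : b' < c') : D = E := by
  obtain ⟨rfl, rfl, rfl⟩ := h.pos₀.eq_of_lt h'.pos₀ hab hbc hab' hbc'
  obtain ⟨rfl, rfl⟩ := h.eq_cut hab hbc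
  obtain ⟨rfl, rfl⟩ := h'.eq_cut hab hbc
  exact Subtype.ext (Finset.ext fun x => by rw [h.mem_iff, h'.mem_iff])

theorem Summit.eq_chamber (h : F.Summit D x a b c) (h' : F.Summit E x a' b' c') : D = E := by
  obtain ⟨M₀, M₁, M₂, hx, hD, h1, h2⟩ := h
  obtain ⟨k, N₁, N₂, hE⟩ := h'.exists_flag hx
  obtain ⟨-, -, -, -, -, h3, h4⟩ := h'
  exact hD.eq_chamber hE h1 h2 (by omega) (by omega)

theorem Summit.eq_shift (h : F.Summit D x a b c) (h' : F.Summit E x a' b' c') :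
    ∃ k : ℤ, a' = a + 3 * k ∧ b' = b + 3 * k ∧ c' = c + 3 * k := by
  obtain ⟨M₀, M₁, M₂, hx, hE, h1, h2⟩ := h'
  obtain ⟨k, N₁, N₂, hD⟩ := h.exists_flag hx
  obtain ⟨-, -, -, -, -, h3, h4⟩ := h
  exact ⟨k, hE.pos₀.eq_of_lt hD.pos₀ h1 h2 (by omega) (by omega)⟩

theorem Summit.mem (h : F.Summit D x a b c) : x ∈ D.1 := by
  obtain ⟨M₀, M₁, M₂, hx, hD, h1, h2⟩ := h
  exact (hD.mem_iff x).2 (Or.inl hx)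

theorem Summit.residues (h : F.Summit D x a b c) :
    (b - a) % 3 ≠ 0 ∧ (c - b) % 3 ≠ 0 ∧ (c - a) % 3 ≠ 0 ∧ a < b ∧ b < c := by
  obtain ⟨M₀, M₁, M₂, hx, hD, h1, h2⟩ := h
  exact ⟨hD.pos₀.ab, hD.pos₀.bc, hD.pos₀.ac, h1, h2⟩

theorem Summit.len_win (h : F.Summit D x a b c) : len (F.win D) = lev a b c := by
  obtain ⟨h1, h2, h3, h4, h5⟩ := h.residues
  obtain ⟨M₀, M₁, M₂, hx, hD, -, -⟩ := h
  rw [hD.len_win, len_eq_lev_iff h1 h2 h3]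
  exact ⟨h4, h5⟩

/-- All chambers at `x` carry the same three jumps modulo 3 in different orders and shifts, so `len`
is smallest exactly when the flag at `x` is increasing. -/
theorem lev_le_len_win (hx : x ∈ D.1) (hM : Represents M x) (h : F.Pos M a b c) :
    lev a b c ≤ len (F.win D) ∧ (len (F.win D) = lev a b c → ∃ a' b' c', F.Summit D x a' b' c') := by
  obtain ⟨M₁, M₂, a', b', c', hD⟩ := F.exists_flag_of_mem hx hM
  rw [hD.len_win, h.lev_eq hD.pos₀]
  have h1 := hD.pos₀.ab
  have h2 := hD.pos₀.bc
  have h3 := hD.pos₀.ac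
  refine ⟨lev_le_len h1 h2 h3, fun e => ?_⟩
  rw [len_eq_lev_iff h1 h2 h3] at e
  exact ⟨a', b', c', _, _, _, hM, hD, e⟩

/-- The neighbours of a vertex whose level is at most that of the vertex. -/
theorem Pos.cases_of_lev_le (h : F.Pos M a b c) (hab : a < b) (hbc : b < c) (h1 : F.u • M < N)
    (h2 : N < M) (hN : F.Pos N a' b' c') (hl : lev a' b' c' ≤ lev a b c) (hl0 : lev a b c ≠ 0) :
    (lev a' b' c' < lev a b c ∧ (N = F.cut M b ∨ N = F.cut M c)) ∨
      (lev a' b' c' = lev a b c ∧ ((b + 3 < c ∧ F.Pos N a (b + 3) c) ∨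
        (a + 3 < b ∧ F.Pos N (a + 3) b (c + 3)))) := by
  obtain ⟨x, y, z, hx, hx1, hx2, hx3⟩ := h.of_between hN.isLattice h1.le h2.le
  rw [hN.lev_eq hx] at hl ⊢
  obtain ⟨l1, l2, l3, l4, l5, l6⟩ := lev_neighbour h.ab h.bc h.ac hab hbc hl0
  rcases hx1 with rfl | rfl <;> rcases hx2 with rfl | rfl <;> rcases hx3 with rfl | rfl
  · exact absurd (h.eq_of_le hx h2.le) h2.ne
  · omega
  · exact Or.inr ⟨by omega, Or.inl ⟨by omega, hx⟩⟩
  · omega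
  · exact Or.inl ⟨l3, Or.inl (h.eq_cut2 hab hbc h1.le h2.le hx.swap12.swap23)⟩
  · exact Or.inr ⟨by omega, Or.inr ⟨by omega, hx⟩⟩
  · exact Or.inl ⟨l4, Or.inr (h.eq_cut3 hab hbc h1.le h2.le hx.swap23.swap12)⟩
  · exact absurd (hx.eq_of_le h.u_smul h1.le) h1.ne

end Filtration

end Summits

end A2Building

namespace A2Building

/-! ### Peaks and summits, and the neighbours of a peak in its own level -/

section Regions

variable {O K : Type*} [CommRing O] [IsDomain O] [IsDiscreteValuationRing O]
  [Field K] [Algebra O K] [IsFractionRing O K]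
  {F : Filtration O K} {C D E : Chamber O K} {M N M₀ M₁ M₂ : Submodule O (Fin 3 → K)}
  {x y y' z : Vertex O K} {a b c a' b' c' : ℤ} {n : ℕ}

open Filtration

namespace IsAdapted

theorem dist_summit (hF : IsAdapted F C) (h : F.Summit D x a b c) : dist D C = lev a b c := by
  rw [hF.dist_eq, h.len_win]

theorem exists_mem_dist_eq (hF : IsAdapted F C) (hM : Represents M x) (h : F.Pos M a b c) :
    ∃ D : Chamber O K, x ∈ D.1 ∧ dist D C = lev a b c := by
  obtain ⟨a', b', c', h', hab, hbc⟩ := exists_pos (F := F) hM.isLattice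
  obtain ⟨D, hD⟩ := Summit.of_pos hM h' hab hbc
  exact ⟨D, hD.mem, by rw [hF.dist_summit hD, h.lev_eq h']⟩

theorem mem_region_iff (hF : IsAdapted F C) (hM : Represents M x) (h : F.Pos M a b c) :
    x ∈ region C n ↔ lev a b c ≤ n := by
  constructor
  · rintro ⟨D, hx, hD⟩
    rw [hF.dist_eq] at hD
    exact (lev_le_len_win hx hM h).1.trans hD
  · intro hl
    obtain ⟨D, hx, hD⟩ := hF.exists_mem_dist_eq hM h
    exact ⟨D, hx, hD ▸ hl⟩

theorem mem_regionLT_iff (hF : IsAdapted F C) (hM : Represents M x) (h : F.Pos M a b c) :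
    x ∈ regionLT C n ↔ lev a b c < n := by
  constructor
  · rintro ⟨D, hx, hD⟩
    rw [hF.dist_eq] at hD
    exact (lev_le_len_win hx hM h).1.trans_lt hD
  · intro hl
    obtain ⟨D, hx, hD⟩ := hF.exists_mem_dist_eq hM h
    exact ⟨D, hx, hD ▸ hl⟩

theorem mem_newVertices_iff (hF : IsAdapted F C) (hM : Represents M x) (h : F.Pos M a b c) :
    x ∈ newVertices C n ↔ lev a b c = n := by
  rw [newVertices, Set.mem_sdiff, hF.mem_region_iff hM h, hF.mem_regionLT_iff hM h]
  omega

theorem mem_base_iff (h : F.IsFlag D M₀ M₁ M₂ a b c) (hx : Represents M₀ x) :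
    y ∈ base D x ↔ Represents M₁ y ∨ Represents M₂ y := by
  have hne : ∀ {P : Submodule O (Fin 3 → K)}, F.charge P = F.charge M₀ + 1 ∨
      F.charge P = F.charge M₀ + 2 → Represents P y → y ≠ x := by
    rintro P hP hy rfl
    obtain ⟨k, rfl⟩ := F.exists_eq_zpow_smul hx hy
    rw [charge_zpow_smul hx.isLattice] at hP
    omega
  change y ∈ D.1 ∧ y ≠ x ↔ _
  rw [h.mem_iff]
  constructor
  · rintro ⟨h0 | h1, hyx⟩
    · exact absurd (h0.eq hx) hyx
    · exact h1
  · rintro (h1 | h1)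
    · exact ⟨Or.inr (Or.inl h1), hne (Or.inl h.charge₁) h1⟩
    · exact ⟨Or.inr (Or.inr h1), hne (Or.inr h.charge₂) h1⟩

/-- Every vertex is a peak at its own level: the nearest chamber is unique, and at positive level
the only neighbours of smaller level are the two cuts, which span the base. -/
theorem isSummitAt_of_summit (hF : IsAdapted F C) (h : F.Summit D x a b c) :
    IsSummitAt C (lev a b c) D x := by
  have hS := h
  have hlen := h.len_win
  obtain ⟨M₀, M₁, M₂, hx, hD, hab, hbc⟩ := h
  have hp := hD.pos₀
  refine ⟨(hF.mem_newVertices_iff hx hp).2 rfl, hS.mem, hF.dist_summit hS, fun E hE hd => ?_,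
    fun hl => ?_⟩
  · rw [hF.dist_eq] at hd
    obtain ⟨_, _, _, hE'⟩ := (lev_le_len_win hE hx hp).2 hd
    exact hE'.eq_chamber hS
  · obtain ⟨l1, l2, l3, l4, l5, l6⟩ := lev_neighbour hp.ab hp.bc hp.ac hab hbc hl.ne'
    ext y
    rw [mem_base_iff hD hx]
    constructor
    · intro hy
      have hmem : y ∈ base D x := (mem_base_iff hD hx).2 hy
      refine ⟨?_, D.2.isClique hS.mem hmem.1 hmem.2.symm⟩
      rcases hy with hy | hy
      · exact (hF.mem_regionLT_iff hy hD.pos₁.swap23.swap12).2 l3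
      · exact (hF.mem_regionLT_iff hy hD.pos₂.swap12.swap23).2 l4
    · rintro ⟨hy, hadj⟩
      obtain ⟨N, hN, hN1, hN2⟩ := (F.adj_iff hx).1 hadj
      obtain ⟨a', b', c', hp', -⟩ := exists_pos (F := F) hN.isLattice
      rw [hF.mem_regionLT_iff hN hp'] at hy
      obtain ⟨rfl, rfl⟩ := hD.eq_cut hab hbc
      rcases hp.cases_of_lev_le hab hbc hN1 hN2 hp' hy.le hl.ne' with ⟨-, rfl | rfl⟩ | ⟨h, -⟩
      · exact Or.inl hN
      · exact Or.inr hN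
      · omega

theorem isSummitAt_iff (hF : IsAdapted F C) :
    IsSummitAt C n D x ↔ ∃ a b c, F.Summit D x a b c ∧ lev a b c = n := by
  constructor
  · intro h
    obtain ⟨M, hM⟩ := exists_represents x
    obtain ⟨a, b, c, hp, -⟩ := exists_pos (F := F) hM.isLattice
    have hl := (hF.mem_newVertices_iff hM hp).1 h.mem_new
    have hd := h.dist_eq
    rw [hF.dist_eq] at hd
    obtain ⟨a', b', c', hS⟩ := (lev_le_len_win h.mem hM hp).2 (by omega)
    exact ⟨a', b', c', hS, by rw [← hS.len_win, hd]⟩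
  · rintro ⟨a, b, c, h, rfl⟩
    exact hF.isSummitAt_of_summit h

/-- The neighbours of `x` that have the same level. -/
theorem summit_of_adj (hF : IsAdapted F C) (h : F.Summit D x a b c) (hl : lev a b c ≠ 0)
    (hadj : (graph O K).Adj x y) (hy : y ∈ newVertices C (lev a b c)) :
    (b + 3 < c ∧ ∃ E, F.Summit E y a (b + 3) c) ∨
      (a + 3 < b ∧ ∃ E, F.Summit E y (a + 3) b (c + 3)) := by
  obtain ⟨M₀, M₁, M₂, hx, hD, hab, hbc⟩ := h
  obtain ⟨N, hN, hN1, hN2⟩ := (F.adj_iff hx).1 hadj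
  obtain ⟨a', b', c', hp', -⟩ := exists_pos (F := F) hN.isLattice
  have hy' := (hF.mem_newVertices_iff hN hp').1 hy
  rcases hD.pos₀.cases_of_lev_le hab hbc hN1 hN2 hp' hy'.le hl with
    ⟨h, -⟩ | ⟨-, ⟨hlt, hP⟩ | ⟨hlt, hP⟩⟩
  · omega
  · exact Or.inl ⟨hlt, Summit.of_pos hN hP (by omega) hlt⟩
  · exact Or.inr ⟨hlt, Summit.of_pos hN hP hlt (by omega)⟩

end IsAdapted

theorem Filtration.charge_sub_of_represents (F : Filtration O K) (hM : Represents M x) (hN : Represents N x) :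
    (F.charge N - F.charge M) % 3 = 0 := by
  obtain ⟨k, rfl⟩ := F.exists_eq_zpow_smul hM hN
  rw [charge_zpow_smul hM.isLattice]
  omega

/-- A neighbour in a given position has a representative in that position
between `u • M` and `M`. -/
theorem Filtration.exists_between_of_adj (hM : Represents M x) (hadj : (graph O K).Adj x y)
    (hN : Represents N y) (h1 : F.charge M < F.charge N) (h2 : F.charge N < F.charge M + 3) :
    F.u • M < N ∧ N < M := by
  obtain ⟨N', hN', l1, l2⟩ := (F.adj_iff hM).1 hadj
  obtain ⟨a, b, c, hp, -⟩ := exists_pos (F := F) hM.isLattice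
  obtain ⟨a', b', c', hp', h⟩ := hp.of_between hN'.isLattice l1.le l2.le
  have e1 := hp.charge_eq
  have e2 := hp'.charge_eq
  have e3 := F.charge_sub_of_represents hN hN'
  have hne1 : F.charge N' ≠ F.charge M := by
    intro e
    have : a' = a ∧ b' = b ∧ c' = c := by omega
    obtain ⟨rfl, rfl, rfl⟩ := this
    exact l2.ne (hp.eq_of_le hp' l2.le)
  have hne2 : F.charge N' ≠ F.charge M + 3 := by
    intro e
    have : a' = a + 3 ∧ b' = b + 3 ∧ c' = c + 3 := by omega
    obtain ⟨rfl, rfl, rfl⟩ := this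
    exact l1.ne (hp'.eq_of_le hp.u_smul l1.le)
  obtain rfl : N = N' := eq_of_charge_eq (F := F) hN hN' (by omega)
  exact ⟨l1, l2⟩

theorem Filtration.Summit.exists_isFlag (h : F.Summit D x a b c) :
    ∃ M, Represents M x ∧ F.IsFlag D M (F.cut M b) (F.cut M c) a b c := by
  obtain ⟨M₀, M₁, M₂, hx, hD, hab, hbc⟩ := h
  obtain ⟨rfl, rfl⟩ := hD.eq_cut hab hbc
  exact ⟨M₀, hx, hD⟩

/-- Representatives of a fixed charge are unique, so vertices can be counted through lattices. -/
theorem Filtration.ncard_vertices_eq (S : Set (Submodule O (Fin 3 → K))) (T : Set (Vertex O K))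
    (h1 : ∀ N ∈ S, ∃ y ∈ T, Represents N y) (h2 : ∀ y ∈ T, ∃ N ∈ S, Represents N y)
    (h3 : ∀ N ∈ S, ∀ N' ∈ S, F.charge N = F.charge N') : T.ncard = S.ncard := by
  choose f hf using h2
  refine Set.ncard_congr f (fun y hy => (hf y hy).1) ?_ ?_
  · intro y y' hy hy' e
    have := (hf y' hy').2
    rw [← e] at this
    exact (hf y hy).2.eq this
  · intro N hN
    obtain ⟨y, hy, hNy⟩ := h1 N hN
    exact ⟨y, hy, eq_of_charge_eq (F := F) (hf y hy).2 hNy (h3 _ (hf y hy).1 _ hN)⟩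

/-- Lattices in position `a, b + 3, c` contain `cut M c`, so they are the lines of the plane `M /
cut M c` other than the exceptional one. -/
theorem Filtration.Summit.ncard_up (h : F.Summit D x a b c) (hbc : b + 3 < c) :
    {y | (∃ E, F.Summit E y a (b + 3) c) ∧ (graph O K).Adj x y}.ncard =
      Nat.card (IsLocalRing.ResidueField O) := by
  obtain ⟨-, -, -, hab, -⟩ := h.residues
  obtain ⟨M, hM, hD⟩ := h.exists_isFlag
  have hp := hD.pos₀
  have hcM := hp.charge_eq
  rw [← ncard_between (hp.cut3 hab (by omega)).swap12.swap23 hp (cut_le _ _)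
    (u_smul_le_cut _ _) hab]
  refine ncard_vertices_eq (F := F) _ _ ?_ ?_ ?_
  · rintro N ⟨h1, h2, h3⟩
    obtain ⟨y, hy⟩ := exists_vertex h3.isLattice
    have hcN := h3.charge_eq
    refine ⟨y, ⟨Summit.of_pos hy h3 (by omega) hbc, (F.adj_iff hM).2 ⟨N, hy, ?_, ?_⟩⟩, hy⟩
    · refine lt_of_le_of_ne ((u_smul_le_cut _ _).trans h1) ?_
      rintro rfl
      rw [charge_u_smul hM.isLattice] at hcN
      omega
    · refine lt_of_le_of_ne h2 ?_
      rintro rfl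
      omega
  · rintro y ⟨⟨E, hE⟩, hadj⟩
    obtain ⟨N, hN, hE'⟩ := hE.exists_isFlag
    have hpN := hE'.pos₀
    have hcN := hpN.charge_eq
    obtain ⟨l1, l2⟩ := exists_between_of_adj hM hadj hN (F := F) (by omega) (by omega)
    refine ⟨N, ⟨cut_le_of_jumps hM.isLattice l1.le l2.le fun j hj hcj => ?_, l2.le, hpN⟩, hN⟩
    rw [hp.mem_iff] at hj
    rw [hpN.mem_iff]
    have := hp.bc
    omega
  · rintro N ⟨-, -, h3⟩ N' ⟨-, -, h3'⟩
    have := h3.charge_eq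
    have := h3'.charge_eq
    omega

/-- Lattices in position `a + 3, b, c + 3` lie inside `cut M b`, so here the plane is `cut M b / (u
M)`, with jumps `b < c`. -/
theorem Filtration.Summit.ncard_down (h : F.Summit D x a b c) (hab' : a + 3 < b) :
    {y | (∃ E, F.Summit E y (a + 3) b (c + 3)) ∧ (graph O K).Adj x y}.ncard =
      Nat.card (IsLocalRing.ResidueField O) := by
  obtain ⟨-, -, -, hab, hbc⟩ := h.residues
  obtain ⟨M, hM, hD⟩ := h.exists_isFlag
  have hp := hD.pos₀
  have hcM := hp.charge_eq
  rw [← ncard_between (A := F.u • M) (B := F.cut M b) (p := b) (p' := c) (r := a + 3)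
    (hp.u_smul.swap12.swap23) (hp.cut2 hab hbc) (u_smul_le_cut _ _)
    (units_smul_le (cut_le _ _)) hbc]
  refine ncard_vertices_eq (F := F) _ _ ?_ ?_ ?_
  · rintro N ⟨h1, h2, h3⟩
    obtain ⟨y, hy⟩ := exists_vertex h3.isLattice
    have hcN := h3.charge_eq
    refine ⟨y, ⟨Summit.of_pos hy h3.swap23.swap12 hab' (by omega),
      (F.adj_iff hM).2 ⟨N, hy, ?_, ?_⟩⟩, hy⟩
    · refine lt_of_le_of_ne h1 ?_
      rintro rfl
      rw [charge_u_smul hM.isLattice] at hcN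
      omega
    · refine lt_of_le_of_ne (h2.trans (cut_le _ _)) ?_
      rintro rfl
      omega
  · rintro y ⟨⟨E, hE⟩, hadj⟩
    obtain ⟨N, hN, hE'⟩ := hE.exists_isFlag
    have hpN := hE'.pos₀
    have hcN := hpN.charge_eq
    obtain ⟨l1, l2⟩ := exists_between_of_adj hM hadj hN (F := F) (by omega) (by omega)
    refine ⟨N, ⟨l1.le, le_cut_of_jumps hM.isLattice l1.le l2.le fun j hj hcj => ?_,
      hpN.swap12.swap23⟩, hN⟩
    rw [hpN.mem_iff] at hj
    rw [hp.mem_iff]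
    have := hp.bc
    omega
  · rintro N ⟨-, -, h3⟩ N' ⟨-, -, h3'⟩
    have := h3.charge_eq
    have := h3'.charge_eq
    omega

/-- Two neighbours of `x` in position `a, b + 3, c` have summits with distinct bases. -/
theorem Filtration.Summit.base_ne_of_up {E' : Chamber O K} (h : F.Summit D x a b c)
    (hE : F.Summit E y a (b + 3) c) (hE' : F.Summit E' y' a (b + 3) c)
    (hy : (graph O K).Adj x y) (hy' : (graph O K).Adj x y') (hne : y ≠ y') :
    base E y ≠ base E' y' := by
  intro hbase
  obtain ⟨M, hM, hD⟩ := h.exists_isFlag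
  obtain ⟨N, hN, hEf⟩ := hE.exists_isFlag
  obtain ⟨N', hN', hEf'⟩ := hE'.exists_isFlag
  have hp := hD.pos₀
  have hpN := hEf.pos₀
  have hpN' := hEf'.pos₀
  have hcM := hp.charge_eq
  have hcN := hpN.charge_eq
  have hcN' := hpN'.charge_eq
  obtain ⟨l1, l2⟩ := exists_between_of_adj hM hy hN (F := F) (by omega) (by omega)
  obtain ⟨l1', l2'⟩ := exists_between_of_adj hM hy' hN' (F := F) (by omega) (by omega)
  obtain ⟨z, hz⟩ := exists_vertex hEf.pos₂.isLattice
  have hz' : z ∈ base E' y' := hbase ▸ (IsAdapted.mem_base_iff hEf hN).2 (Or.inr hz)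
  have c2 := hEf.charge₂
  have c2' := hEf'.charge₂
  have c1' := hEf'.charge₁
  -- Charges modulo 3 tell the two base vertices apart, so equal bases have equal third lattices.
  have hcut : F.cut N c = F.cut N' c := by
    rcases (IsAdapted.mem_base_iff hEf' hN').1 hz' with hz' | hz'
    · have := F.charge_sub_of_represents hz hz'
      omega
    · exact eq_of_charge_eq (F := F) hz hz' (by omega)
  have hlt : N < N ⊔ N' := by
    refine lt_of_le_of_ne le_sup_left fun e => hne ?_
    have : N' ≤ N := by rw [e]; exact le_sup_right
    have e' := hpN.eq_of_le hpN' this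
    exact hN.eq (e' ▸ hN')
  have hle : N ⊔ N' ≤ M := sup_le l2.le l2'.le
  obtain ⟨j, hj, hjN⟩ := exists_jump_of_lt (F := F) (isLattice_of_between (F := F) hM.isLattice
    (l1.le.trans le_sup_left) hle) hlt
  have hjM := jumps_mono hle hj
  have hr := hp.ab
  have hr2 := hp.bc
  obtain rfl : j = b := by
    rw [hp.mem_iff] at hjM
    rw [hpN.mem_iff] at hjN
    omega
  -- The sum gains the jump `b` over `N`. Hence `b + 3` becomes a jump of the common cut, whose
  -- least jump in that class is `b + 6`.
  have hle2 : F.u • (N ⊔ N') ≤ F.cut N c := by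
    rw [← units_smul_le_iff (a := F.u⁻¹), inv_smul_smul]
    refine sup_le ?_ ?_ <;> rw [← units_smul_le_iff (a := F.u), smul_inv_smul]
    · exact u_smul_le_cut _ _
    · rw [hcut]
      exact u_smul_le_cut _ _
  have hj3 : j + 3 ∈ F.jumps (F.cut N c) :=
    jumps_mono hle2 (mem_jumps_u_smul.2 (by simpa using hj))
  rw [hEf.pos₂.mem_iff] at hj3
  omega

/-- Two neighbours of `x` in position `a + 3, b, c + 3` have summits with distinct bases. -/
theorem Filtration.Summit.base_ne_of_down {E' : Chamber O K} (h : F.Summit D x a b c)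
    (hE : F.Summit E y (a + 3) b (c + 3)) (hE' : F.Summit E' y' (a + 3) b (c + 3))
    (hy : (graph O K).Adj x y) (hy' : (graph O K).Adj x y') (hne : y ≠ y') :
    base E y ≠ base E' y' := by
  intro hbase
  obtain ⟨M, hM, hD⟩ := h.exists_isFlag
  obtain ⟨N, hN, hEf⟩ := hE.exists_isFlag
  obtain ⟨N', hN', hEf'⟩ := hE'.exists_isFlag
  have hp := hD.pos₀
  have hpN := hEf.pos₀
  have hpN' := hEf'.pos₀
  have hcM := hp.charge_eq
  have hcN := hpN.charge_eq
  have hcN' := hpN'.charge_eq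
  obtain ⟨l1, l2⟩ := exists_between_of_adj hM hy hN (F := F) (by omega) (by omega)
  obtain ⟨l1', l2'⟩ := exists_between_of_adj hM hy' hN' (F := F) (by omega) (by omega)
  obtain ⟨z, hz⟩ := exists_vertex hEf.pos₁.isLattice
  have hz' : z ∈ base E' y' := hbase ▸ (IsAdapted.mem_base_iff hEf hN).2 (Or.inl hz)
  have c1 := hEf.charge₁
  have c2' := hEf'.charge₂
  have c1' := hEf'.charge₁
  have hcut : F.cut N b = F.cut N' b := by
    rcases (IsAdapted.mem_base_iff hEf' hN').1 hz' with hz' | hz'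
    · exact eq_of_charge_eq (F := F) hz hz' (by omega)
    · have := F.charge_sub_of_represents hz hz'
      omega
  have hlt : N ⊓ N' < N := by
    refine lt_of_le_of_ne inf_le_left fun e => hne ?_
    have : N ≤ N' := by rw [← e]; exact inf_le_right
    have e' := hpN'.eq_of_le hpN this
    exact hN.eq (e' ▸ hN')
  -- Dually to the previous case, the intersection contains the common cut and `u M`. The only jump
  -- of `N` missing from the cut is `a + 3`, which is a jump of `u M`.
  have hcle : F.cut N b ≤ N ⊓ N' := le_inf (cut_le _ _) (hcut ▸ cut_le _ _)
  have hule : F.u • M ≤ N ⊓ N' := le_inf l1.le l1'.le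
  obtain ⟨j, hj, hjN⟩ := exists_jump_of_lt (F := F) hN.isLattice hlt
  have hjM : j ∉ F.jumps (F.u • M) := fun h => hjN (jumps_mono hule h)
  have hjc : j ∉ F.jumps (F.cut N b) := fun h => hjN (jumps_mono hcle h)
  rw [hpN.mem_iff] at hj
  rw [hEf.pos₁.mem_iff] at hjc
  rw [mem_jumps_u_smul, hp.mem_iff] at hjM
  omega

/-- Neighbours of `x` on the two sides have summits with distinct bases. -/
theorem Filtration.Summit.base_ne_of_up_down {E' : Chamber O K}
    (hE : F.Summit E y a (b + 3) c) (hE' : F.Summit E' y' (a + 3) b (c + 3)) :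
    base E y ≠ base E' y' := by
  intro hbase
  obtain ⟨N, hN, hEf⟩ := hE.exists_isFlag
  obtain ⟨N', hN', hEf'⟩ := hE'.exists_isFlag
  have hcN := hEf.pos₀.charge_eq
  have hcN' := hEf'.pos₀.charge_eq
  obtain ⟨z, hz⟩ := exists_vertex hEf'.pos₂.isLattice
  have hz' : z ∈ base E y := hbase ▸ (IsAdapted.mem_base_iff hEf' hN').2 (Or.inr hz)
  have c1 := hEf.charge₁
  have c2 := hEf.charge₂
  have c2' := hEf'.charge₂
  -- The peaks `y` and `y'` have different types, so their opposite edges have different types too.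
  rcases (IsAdapted.mem_base_iff hEf hN).1 hz' with hz' | hz' <;>
  · have := F.charge_sub_of_represents hz hz'
    omega

end Regions

end A2Building

namespace A2Building

/-! ### Graph distance to the vertices of the base chamber -/

section GraphDistance

variable {O K : Type*} [CommRing O] [IsDomain O] [IsDiscreteValuationRing O]
  [Field K] [Algebra O K] [IsFractionRing O K]
  {F : Filtration O K} {C D E : Chamber O K} {M N M₀ M₁ M₂ : Submodule O (Fin 3 → K)}
  {x y z : Vertex O K} {a b c a' b' c' t : ℤ} {n : ℕ}

namespace Filtration

/-- One step of a walk raises each jump by 0 or 3, up to homothety, so a difference of two quotients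
changes by at most 1. At `z` all three jumps lie in one block `t + 3m, t + 3m + 1, t + 3m + 2` and
the differences vanish. -/
theorem Pos.le_length (hz : Represents (F.L t) z) (w : (graph O K).Walk x z) :
    ∀ {M : Submodule O (Fin 3 → K)} {a b c : ℤ}, Represents M x → F.Pos M a b c →
      (c - t) / 3 - (a - t) / 3 ≤ w.length := by
  induction w with
  | nil =>
    intro M a b c hM h
    obtain ⟨k, rfl⟩ := F.exists_eq_zpow_smul hz hM
    rw [zpow_smul_L] at h
    have e1 := (F.pos_L (t + 3 * k)).eq_or h
    have e2 := (F.pos_L (t + 3 * k)).swap12.eq_or h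
    have e3 := (F.pos_L (t + 3 * k)).swap23.swap12.eq_or h
    simp only [SimpleGraph.Walk.length_nil, Nat.cast_zero]
    omega
  | cons hadj w ih =>
    intro M a b c hM h
    obtain ⟨N, hN, h1, h2⟩ := (F.adj_iff hM).1 hadj
    obtain ⟨a', b', c', h', ha, hb, hc⟩ := h.of_between hN.isLattice h1.le h2.le
    have := ih hz hN h'
    rw [SimpleGraph.Walk.length_cons]
    push_cast
    omega

theorem Pos.exists_walk (hz : Represents (F.L t) z) (r : ℕ) : ∀ {M : Submodule O (Fin 3 → K)}
    {x : Vertex O K} {a b c : ℤ}, Represents M x → F.Pos M a b c → a < b → b < c →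
      (c - t) / 3 - (a - t) / 3 = r → ∃ w : (graph O K).Walk x z, w.length = r := by
  induction r with
  | zero =>
    intro M x a b c hM h hab hbc hr
    have h1 := h.ab
    have h2 := h.bc
    have h3 := h.ac
    obtain ⟨k, hk⟩ : ∃ k, a = t + 3 * k := ⟨(a - t) / 3, by omega⟩
    obtain rfl : b = a + 1 := by omega
    obtain rfl : c = a + 2 := by omega
    have hM' : Represents (F.L a) x := h.eq_L ▸ hM
    rw [hk, ← zpow_smul_L, represents_zpow_smul] at hM'
    obtain rfl := hM'.eq hz
    exact ⟨.nil, rfl⟩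
  | succ r ih =>
    intro M x a b c hM h hab hbc hr
    have c0 := h.charge_eq
    have c3 := h.u_smul.charge_eq
    have step : ∀ {N a' b' c'}, F.u • M ≤ N → N ≤ M → F.Pos N a' b' c' → a' < b' → b' < c' →
        F.charge N = F.charge M + 1 ∨ F.charge N = F.charge M + 2 →
        (c' - t) / 3 - (a' - t) / 3 = r → ∃ w : (graph O K).Walk x z, w.length = r + 1 := by
      intro N a' b' c' l1 l2 h' hab' hbc' hch hr'
      obtain ⟨y, hy⟩ := exists_vertex h'.isLattice
      have hadj : (graph O K).Adj x y := (F.adj_iff hM).2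
        ⟨N, hy, lt_of_le_of_ne l1 (by rintro rfl; omega), lt_of_le_of_ne l2 (by rintro rfl; omega)⟩
      obtain ⟨w, hw⟩ := ih hy h' hab' hbc' hr'
      exact ⟨.cons hadj w, by rw [SimpleGraph.Walk.length_cons, hw]⟩
    have h1 := h.ab
    have h2 := h.bc
    have h3 := h.ac
    -- To shorten the spread, every jump in the lowest block is raised: `a` alone if `b` lies in a
    -- higher block, both `a` and `b` otherwise. The case distinctions below only sort the new
    -- triple.
    by_cases hb : t + 3 * ((a - t) / 3) + 3 ≤ b
    · have hp := h.cut2 hab hbc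
      have c1 := hp.charge_eq
      have l1 := u_smul_le_cut (F := F) M b
      have l2 := cut_le (F := F) M b
      rcases lt_or_gt_of_ne (show b ≠ a + 3 by omega) with h4 | h4
      · rcases lt_or_gt_of_ne (show c ≠ a + 3 by omega) with h5 | h5
        · exact step l1 l2 hp hbc h5 (by omega) (by omega)
        · exact step l1 l2 hp.swap23 h4 h5 (by omega) (by omega)
      · exact step l1 l2 hp.swap23.swap12 h4 hbc (by omega) (by omega)
    · have hp := h.cut3 hab hbc
      have c1 := hp.charge_eq
      have l1 := u_smul_le_cut (F := F) M c
      have l2 := cut_le (F := F) M c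
      rcases lt_or_gt_of_ne (show c ≠ a + 3 by omega) with h4 | h4
      · exact step l1 l2 hp h4 (by omega) (by omega) (by omega)
      · rcases lt_or_gt_of_ne (show c ≠ b + 3 by omega) with h5 | h5
        · exact step l1 l2 hp.swap12 h4 h5 (by omega) (by omega)
        · exact step l1 l2 hp.swap12.swap23 (by omega) h5 (by omega) (by omega)

/-- The graph distance to a vertex of the base chamber. -/
theorem Pos.graph_dist_eq (hz : Represents (F.L t) z) (hM : Represents M x) (h : F.Pos M a b c)
    (hab : a < b) (hbc : b < c) : ((graph O K).dist x z : ℤ) = (c - t) / 3 - (a - t) / 3 := by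
  obtain ⟨w, hw⟩ := h.exists_walk hz ((c - t) / 3 - (a - t) / 3).toNat hM hab hbc (by omega)
  have h1 := SimpleGraph.dist_le w
  obtain ⟨w', hw'⟩ := w.reachable.exists_walk_length_eq_dist
  have h2 := h.le_length hz w' hM
  omega

/-- The symmetric form requires no ordering of the jumps, so it applies directly to the rotated
positions of all vertices of a flag. -/
theorem Pos.graph_dist_le_iff (hz : Represents (F.L t) z) (hM : Represents M x)
    (h : F.Pos M a b c) : (graph O K).dist x z ≤ n ↔
      ((b - t) / 3 - (a - t) / 3 ≤ n ∧ (a - t) / 3 - (b - t) / 3 ≤ n) ∧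
      ((c - t) / 3 - (b - t) / 3 ≤ n ∧ (b - t) / 3 - (c - t) / 3 ≤ n) ∧
      ((c - t) / 3 - (a - t) / 3 ≤ n ∧ (a - t) / 3 - (c - t) / 3 ≤ n) := by
  obtain ⟨a', b', c', h', hab, hbc⟩ := exists_pos (F := F) hM.isLattice
  have hd := h'.graph_dist_eq hz hM hab hbc
  have e1 := h.eq_or h'
  have e2 := h.swap12.eq_or h'
  have e3 := h.swap23.swap12.eq_or h'
  have h1 := h.ab
  have h2 := h.bc
  have h3 := h.ac
  zify
  rw [hd]
  clear hd h h' hM hz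
  rcases e1 with rfl | rfl | rfl <;> rcases e2 with e2 | e2 | e2 <;>
    rcases e3 with e3 | e3 | e3 <;> subst_vars <;> omega

end Filtration

end GraphDistance

/-! ### Crowns as rows of sites -/

section Crown

variable {O K : Type*} [CommRing O] [IsDomain O] [IsDiscreteValuationRing O]
  [Field K] [Algebra O K] [IsFractionRing O K]
  {F : Filtration O K} {C D E : Chamber O K} {M N M₀ M₁ M₂ : Submodule O (Fin 3 → K)}
  {x y z : Vertex O K} {a b c a' b' c' t : ℤ} {n k : ℕ} {v : Fin 3 → Vertex O K} {τ : Fin 3 → ℤ}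
  {i : Fin 3}

open Filtration

/-- `D` is the summit with peak `x`, where `x` is the `k`-th vertex of level `n` in the sector
given by `r`. -/
def Filtration.Site (F : Filtration O K) (r : ℤ) (n k : ℕ) (D : Chamber O K) (x : Vertex O K) :
    Prop :=
  k ≤ n / 2 ∧ F.Summit D x r (r + 1 + (n % 2 : ℕ) + 3 * k)
    (r + 2 + 2 * (n % 2 : ℕ) + 3 * (n / 2 : ℕ))

/-- `L (τ 0), L (τ 1), L (τ 2)` represent the vertices `v 0, v 1, v 2` of the base chamber. -/
structure Filtration.IsLabel (F : Filtration O K) (v : Fin 3 → Vertex O K) (τ : Fin 3 → ℤ) :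
    Prop where
  represents : ∀ k, Represents (F.L (τ k)) (v k)
  residue : ∀ i j, i ≠ j → (τ j - τ i) % 3 ≠ 0

/-- For even `n` the spread `c - a = 2 + 3n/2` stays within distance `n / 2` of `v i` only if `a`
starts a block. For odd `n`, being close to `v k` excludes just the residue `τ k + 2`; excluding it
for both `k ≠ i` leaves `a ≡ τ i + 2`. -/
theorem Filtration.Summit.mem_X_iff (hv : F.IsLabel v τ) (h : F.Summit D x a b c) (hn : 1 ≤ n)
    (hl : lev a b c = n) :
    (∀ y ∈ D.1, y ∈ X v i n) ↔ (a - (τ i + 2 * (n % 2 : ℕ))) % 3 = 0 := by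
  obtain ⟨h1, h2, h3, hab, hbc⟩ := h.residues
  obtain ⟨k, hk, hb, hc⟩ := exists_of_lev_eq h1 h2 h3 hab hbc hl
  obtain ⟨M₀, M₁, M₂, hx, hD, -, -⟩ := h
  have hD1 := hD.rotate
  have hD2 := hD1.rotate
  obtain ⟨x1, hx1D, hx1⟩ := hD1.mem₀
  obtain ⟨x2, hx2D, hx2⟩ := hD2.mem₀
  have hxD : x ∈ D.1 := (hD.mem_iff x).2 (Or.inl hx)
  have hall : (∀ y ∈ D.1, y ∈ X v i n) ↔ x ∈ X v i n ∧ x1 ∈ X v i n ∧ x2 ∈ X v i n := by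
    refine ⟨fun h => ⟨h _ hxD, h _ hx1D, h _ hx2D⟩, ?_⟩
    rintro ⟨g, g1, g2⟩ y hy
    rcases (hD.mem_iff y).1 hy with h | h | h
    exacts [h.eq hx ▸ g, h.eq hx1 ▸ g1, h.eq hx2 ▸ g2]
  rw [hall]
  clear hall hl
  rcases Nat.even_or_odd n with he | ho
  · have hn2 : n % 2 = 0 := Nat.even_iff.1 he
    simp only [X, he, if_true, Set.mem_ofPred_eq, hD.pos₀.graph_dist_le_iff (hv.represents i) hx,
      hD.pos₁.graph_dist_le_iff (hv.represents i) hx1,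
      hD.pos₂.graph_dist_le_iff (hv.represents i) hx2]
    rw [hn2] at hb hc ⊢
    clear h1 h2 h3
    omega
  · have hn2 : n % 2 = 1 := Nat.odd_iff.1 ho
    have key : ∀ k, ((graph O K).dist x (v k) ≤ (n + 1) / 2 ∧
        (graph O K).dist x1 (v k) ≤ (n + 1) / 2 ∧ (graph O K).dist x2 (v k) ≤ (n + 1) / 2) ↔
        (a - τ k) % 3 ≠ 2 := by
      intro k
      rw [hD.pos₀.graph_dist_le_iff (hv.represents k) hx,
        hD.pos₁.graph_dist_le_iff (hv.represents k) hx1,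
        hD.pos₂.graph_dist_le_iff (hv.represents k) hx2]
      rw [hn2] at hb hc
      clear h1 h2 h3
      omega
    simp only [X, Nat.not_even_iff_odd.2 ho, if_false, Set.mem_ofPred_eq]
    rw [hn2]
    constructor
    · rintro ⟨g, g1, g2⟩
      obtain ⟨j, l, hj, hl, hjl⟩ : ∃ j l, j ≠ i ∧ l ≠ i ∧ j ≠ l :=
        (show ∀ i : Fin 3, ∃ j l, j ≠ i ∧ l ≠ i ∧ j ≠ l by decide) i
      have e1 := (key j).1 ⟨g j hj, g1 j hj, g2 j hj⟩
      have e2 := (key l).1 ⟨g l hl, g1 l hl, g2 l hl⟩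
      have e3 := hv.residue i j hj.symm
      have e4 := hv.residue i l hl.symm
      have e5 := hv.residue j l hjl
      omega
    · intro h
      have e : ∀ k, k ≠ i → (a - τ k) % 3 ≠ 2 := fun k hk => by
        have := hv.residue i k hk.symm
        omega
      exact ⟨fun k hk => ((key k).2 (e k hk)).1, fun k hk => ((key k).2 (e k hk)).2.1,
        fun k hk => ((key k).2 (e k hk)).2.2⟩

theorem Filtration.Site.lev_eq {r : ℤ} (h : F.Site r n k D x) :
    lev r (r + 1 + (n % 2 : ℕ) + 3 * k) (r + 2 + 2 * (n % 2 : ℕ) + 3 * (n / 2 : ℕ)) = n :=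
  (lev_of_eq h.1 rfl rfl).1

theorem Filtration.Site.isSummitAt {r : ℤ} (hF : IsAdapted F C) (h : F.Site r n k D x) :
    IsSummitAt C n D x := hF.isSummitAt_iff.2 ⟨_, _, _, h.2, h.lev_eq⟩

theorem exists_site (hF : IsAdapted F C) (h : IsSummitAt C n D x) {r : ℤ}
    (hr : ∀ a b c, F.Summit D x a b c → (a - r) % 3 = 0) : ∃ k, F.Site r n k D x := by
  obtain ⟨a, b, c, hS, hl⟩ := hF.isSummitAt_iff.1 h
  obtain ⟨h1, h2, h3, hab, hbc⟩ := hS.residues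
  obtain ⟨k, hk, rfl, rfl⟩ := exists_of_lev_eq h1 h2 h3 hab hbc hl
  have har := hr _ _ _ hS
  have hS' := hS.shift ((r - a) / 3)
  refine ⟨k, hk, ?_⟩
  convert hS' using 1 <;> omega

theorem mem_crown_iff (hF : IsAdapted F C) (hv : F.IsLabel v τ) (hn : 1 ≤ n) :
    D ∈ crown C v i n ↔ ∃ k x, F.Site (τ i + 2 * (n % 2 : ℕ)) n k D x := by
  rw [crown, if_neg (by omega)]
  constructor
  · rintro ⟨⟨x, hx⟩, hX⟩
    obtain ⟨a, b, c, hS, hl⟩ := hF.isSummitAt_iff.1 hx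
    obtain ⟨k, hk⟩ := exists_site hF hx (r := τ i + 2 * (n % 2 : ℕ)) fun a b c h => by
      obtain ⟨k, rfl, -, -⟩ := hS.eq_shift h
      have := (hS.mem_X_iff hv hn hl).1 hX
      omega
    exact ⟨k, x, hk⟩
  · rintro ⟨k, x, h⟩
    exact ⟨⟨x, h.isSummitAt hF⟩, (h.2.mem_X_iff hv hn h.lev_eq).2 (by simp)⟩

end Crown

end A2Building

namespace A2Building

/-! ### Lattices diagonal in a basis -/

section Diagonal

variable {O K : Type*} [CommRing O] [IsDomain O] [IsDiscreteValuationRing O]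
  [Field K] [Algebra O K] [IsFractionRing O K]

variable (K) in
/-- A uniformizer as a unit of the field of fractions. -/
def unif {ϖ : O} (hϖ : Irreducible ϖ) : Kˣ :=
  Units.mk0 (algebraMap O K ϖ) (by simpa using hϖ.ne_zero)

variable {ϖ : O} (hϖ : Irreducible ϖ) {e : Module.Basis (Fin 3) K (Fin 3 → K)}
  {x : Fin 3 → K} {z w : K} {d d' : Fin 3 → ℤ} {k l : ℤ}

/-- The fractional ideal generated by the `k`-th power of the uniformizer. -/
def frac (k : ℤ) : Submodule O K := Submodule.span O {((unif K hϖ ^ k : Kˣ) : K)}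

theorem mem_frac : z ∈ frac hϖ k ↔ ∃ r : O, z = algebraMap O K r * (unif K hϖ ^ k : Kˣ) := by
  simp only [frac, Submodule.mem_span_singleton, Algebra.smul_def, eq_comm]

theorem exists_zpow (a : Kˣ) :
    ∃ (k : ℤ) (w : Oˣ), (a : K) = algebraMap O K w * (unif K hϖ ^ k : Kˣ) := by
  obtain ⟨k, w, h⟩ := IsDiscreteValuationRing.exists_units_eq_smul_zpow_of_irreducible hϖ a.ne_zero
  exact ⟨k, w, by rw [h, Units.smul_def, Algebra.smul_def]; simp [unif]⟩

theorem unit_mul_zpow_mem_frac_iff (w : Oˣ) :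
    algebraMap O K w * (unif K hϖ ^ l : Kˣ) ∈ frac hϖ k ↔ k ≤ l := by
  rw [mem_frac]
  constructor
  · rintro ⟨r, hr⟩
    by_contra! hlt
    obtain ⟨m, hm, rfl⟩ : ∃ m : ℕ, 0 < m ∧ k = l + m := ⟨(k - l).toNat, by omega, by omega⟩
    have h1 : algebraMap O K w = algebraMap O K (r * ϖ ^ m) := by
      have h0 : ((unif K hϖ ^ l : Kˣ) : K) ≠ 0 := Units.ne_zero _
      refine mul_right_cancel₀ h0 ?_
      rw [hr, zpow_add, zpow_natCast, map_mul, map_pow]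
      simp only [Units.val_mul, Units.val_pow_eq_pow_val, unif, Units.val_mk0]
      ring
    have h2 := IsFractionRing.injective O K h1
    have h3 : IsUnit (ϖ ^ m) := isUnit_of_mul_isUnit_right (h2 ▸ w.isUnit)
    exact hϖ.not_isUnit ((isUnit_pow_iff hm.ne').1 h3)
  · intro hle
    obtain ⟨m, rfl⟩ : ∃ m : ℕ, l = k + m := ⟨(l - k).toNat, by omega⟩
    refine ⟨w * ϖ ^ m, ?_⟩
    rw [zpow_add, zpow_natCast, map_mul, map_pow]
    simp only [Units.val_mul, Units.val_pow_eq_pow_val, unif, Units.val_mk0]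
    ring

theorem zpow_mem_frac_iff : ((unif K hϖ ^ l : Kˣ) : K) ∈ frac hϖ k ↔ k ≤ l := by
  simpa using unit_mul_zpow_mem_frac_iff (K := K) hϖ (k := k) (l := l) 1

theorem exists_frac_of_ne_zero (hz : z ≠ 0) : ∃ l, ∀ k, z ∈ frac hϖ k ↔ k ≤ l := by
  obtain ⟨l, w, h⟩ := exists_zpow hϖ (Units.mk0 z hz)
  refine ⟨l, fun k => ?_⟩
  rw [Units.val_mk0] at h
  rw [h, unit_mul_zpow_mem_frac_iff]

theorem exists_mem_frac (z : K) : ∃ l, ∀ k ≤ l, z ∈ frac hϖ k := by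
  by_cases hz : z = 0
  · exact ⟨0, fun k _ => hz ▸ Submodule.zero_mem _⟩
  · obtain ⟨l, hl⟩ := exists_frac_of_ne_zero hϖ hz
    exact ⟨l, fun k => (hl k).2⟩

theorem smul_mem_frac_iff : algebraMap O K ϖ * z ∈ frac hϖ (k + 1) ↔ z ∈ frac hϖ k := by
  have h0 : algebraMap O K ϖ ≠ 0 := by simpa using hϖ.ne_zero
  simp only [mem_frac, zpow_add_one, Units.val_mul]
  refine exists_congr fun r => ⟨fun h => mul_left_cancel₀ h0 (h.trans ?_), fun h => ?_⟩
  · simp only [unif, Units.val_mk0]; ring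
  · rw [h]; simp only [unif, Units.val_mk0]; ring

theorem exists_eq_mul_of_frac (hz : z ∈ frac hϖ k) (hw : w ∈ frac hϖ k) (hw' : w ∉ frac hϖ (k + 1)) :
    ∃ r : O, z = algebraMap O K r * w := by
  have hw0 : w ≠ 0 := by rintro rfl; exact hw' (Submodule.zero_mem _)
  obtain ⟨l, c, h⟩ := exists_zpow hϖ (Units.mk0 w hw0)
  rw [Units.val_mk0] at h
  rw [h, unit_mul_zpow_mem_frac_iff] at hw hw'
  obtain rfl : l = k := by omega
  obtain ⟨r, rfl⟩ := (mem_frac hϖ).1 hz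
  refine ⟨r * (c⁻¹ : Oˣ), ?_⟩
  rw [h, map_mul, mul_assoc, ← mul_assoc (algebraMap O K (c⁻¹ : Oˣ)), ← map_mul, Units.inv_mul,
    map_one, one_mul]

/-- The lattice spanned by multiples of the basis vectors by powers of the uniformizer. -/
def diag (e : Module.Basis (Fin 3) K (Fin 3 → K)) (d : Fin 3 → ℤ) : Submodule O (Fin 3 → K) :=
  Submodule.span O (Set.range fun i => unif K hϖ ^ d i • e i)

theorem mem_diag : x ∈ diag hϖ e d ↔ ∀ i, e.repr x i ∈ frac hϖ (d i) := by
  rw [diag, Submodule.mem_span_range_iff_exists_fun]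
  simp only [mem_frac]
  have key : ∀ (c : Fin 3 → O) i, e.repr (∑ j, c j • unif K hϖ ^ d j • e j) i =
      algebraMap O K (c i) * (unif K hϖ ^ d i : Kˣ) := by
    intro c i
    have h : ∀ j, c j • unif K hϖ ^ d j • e j =
        (algebraMap O K (c j) * (unif K hϖ ^ d j : Kˣ)) • e j := by
      intro j
      rw [mul_smul, algebraMap_smul, Units.smul_def]
    simp only [h]
    rw [Module.Basis.repr_sum_self]
  constructor
  · rintro ⟨c, rfl⟩ i
    exact ⟨c i, key c i⟩
  · intro h
    choose c hc using h
    refine ⟨c, e.repr.injective (Finsupp.ext fun i => ?_)⟩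
    rw [key, hc]

theorem smul_basis_mem_diag {i : Fin 3} : unif K hϖ ^ k • e i ∈ diag hϖ e d ↔ d i ≤ k := by
  rw [mem_diag]
  have h : ∀ j, e.repr (unif K hϖ ^ k • e i) j = if i = j then ((unif K hϖ ^ k : Kˣ) : K) else 0 := by
    intro j
    rw [Units.smul_def, map_smul, Finsupp.smul_apply, Module.Basis.repr_self, Finsupp.single_apply]
    simp
  simp only [h]
  constructor
  · intro h
    have := h i
    rwa [if_pos rfl, zpow_mem_frac_iff] at this
  · intro h j
    split_ifs with hij
    · rw [zpow_mem_frac_iff]; exact hij ▸ h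
    · exact Submodule.zero_mem _

theorem frac_antitone (h : k ≤ l) : frac (K := K) hϖ l ≤ frac hϖ k := by
  rw [frac, Submodule.span_singleton_le_iff_mem, zpow_mem_frac_iff]
  exact h

theorem diag_le_iff : diag hϖ e d ≤ diag hϖ e d' ↔ ∀ i, d' i ≤ d i := by
  constructor
  · intro h i
    exact (smul_basis_mem_diag hϖ).1 (h ((smul_basis_mem_diag hϖ).2 le_rfl))
  · intro h x hx
    rw [mem_diag] at hx ⊢
    exact fun i => frac_antitone hϖ (h i) (hx i)

theorem isLattice_diag : (diag hϖ e d).IsLattice K where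
  fg := Submodule.fg_span (Set.finite_range _)
  span_eq_top := by
    rw [eq_top_iff, ← e.span_eq, Submodule.span_le]
    rintro _ ⟨i, rfl⟩
    have h1 : unif K hϖ ^ d i • e i ∈ Submodule.span K (diag hϖ e d : Set (Fin 3 → K)) :=
      Submodule.subset_span ((smul_basis_mem_diag hϖ).2 le_rfl)
    have h2 := Submodule.smul_mem _ (((unif K hϖ ^ d i)⁻¹ : Kˣ) : K) h1
    rwa [← Units.smul_def, inv_smul_smul] at h2

theorem zpow_smul_diag (k : ℤ) : unif K hϖ ^ k • diag hϖ e d = diag hϖ e fun i => d i + k := by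
  have key : ∀ (a : Kˣ) (f : Fin 3 → Fin 3 → K), a • Submodule.span O (Set.range f) =
      Submodule.span O (Set.range fun i => a • f i) := by
    intro a f
    have := Submodule.map_span (DistribSMul.toLinearMap O (Fin 3 → K) a) (Set.range f)
    rw [← Set.range_comp] at this
    exact this
  rw [diag, key, diag]
  congr 2
  ext1 i
  rw [smul_smul, ← zpow_add, add_comm]

theorem exists_span_eq_diag (a : Fin 3 → Kˣ) :
    ∃ d, Submodule.span O (Set.range fun i => a i • e i) = diag hϖ e d := by
  choose d w h using fun i => exists_zpow hϖ (a i)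
  refine ⟨d, ?_⟩
  have h' : ∀ i, a i • e i = w i • unif K hϖ ^ d i • e i := fun i => by
    rw [Units.smul_def, h, mul_smul, algebraMap_smul, Units.smul_def (w i), Units.smul_def]
  apply le_antisymm <;> rw [diag, Submodule.span_le] <;> rintro _ ⟨i, rfl⟩
  · simp only [h', Units.smul_def (w i)]
    exact Submodule.smul_mem _ _ (Submodule.subset_span ⟨i, rfl⟩)
  · have : unif K hϖ ^ d i • e i = ((w i)⁻¹ : Oˣ) • a i • e i := by rw [h', inv_smul_smul]
    simp only [this, Units.smul_def (w i)⁻¹]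
    exact Submodule.smul_mem _ _ (Submodule.subset_span ⟨i, rfl⟩)

theorem mem_apartment_iff {x : Vertex O K} :
    x ∈ apartment e ↔ ∃ d, Represents (diag hϖ e d) x := by
  constructor
  · rintro ⟨a, ha⟩
    obtain ⟨d, hd⟩ := exists_span_eq_diag hϖ (e := e) a
    exact ⟨d, hd ▸ ha⟩
  · rintro ⟨d, hd⟩
    exact ⟨fun i => unif K hϖ ^ d i, hd⟩

end Diagonal

end A2Building

namespace A2Building

/-! ### The chain attached to a basis, and its apartment -/

section DiagonalFiltration

variable {O K : Type*} [CommRing O] [IsDomain O] [IsDiscreteValuationRing O]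
  [Field K] [Algebra O K] [IsFractionRing O K]
  {ϖ : O} (hϖ : Irreducible ϖ) (e : Module.Basis (Fin 3) K (Fin 3 → K)) (s : ℤ)
  {x : Fin 3 → K} {d d' : Fin 3 → ℤ} {j l : ℤ}

/-- The exponents of the lattices in the filtration attached to a basis. -/
def expo (s i : ℤ) (k : Fin 3) : ℤ := (i - s - ((k : ℕ) : ℤ) + 2) / 3

theorem exists_index (s i : ℤ) : ∃ k : Fin 3, (i - s - ((k : ℕ) : ℤ)) % 3 = 0 := by
  refine ⟨⟨((i - s) % 3).toNat, by omega⟩, ?_⟩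
  simp only
  omega

theorem expo_add_one {s i : ℤ} {k : Fin 3} (hk : (i - s - ((k : ℕ) : ℤ)) % 3 = 0) (l : Fin 3) :
    expo s (i + 1) l = expo s i l + if l = k then 1 else 0 := by
  have h1 := l.isLt
  have h2 := k.isLt
  simp only [expo, Fin.ext_iff]
  split_ifs <;> omega

/-- The filtration attached to a basis. -/
def diagFiltration : Filtration O K where
  ϖ := ϖ
  irr := hϖ
  L i := diag hϖ e (expo s i)
  succ_le i := by
    rw [diag_le_iff]
    intro k
    simp only [expo]
    omega
  smul_mem_iff i x := by
    simp only [mem_diag]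
    refine forall_congr' fun k => ?_
    have h1 : expo s (i + 3) k = expo s i k + 1 := by simp only [expo]; omega
    rw [h1, ← algebraMap_smul K ϖ x, map_smul, Finsupp.smul_apply, smul_eq_mul, smul_mem_frac_iff]
  exists_jump x hx := by
    obtain ⟨k, hk⟩ : ∃ k, e.repr x k ≠ 0 := by
      by_contra! h
      exact hx (e.repr.map_eq_zero_iff.1 (Finsupp.ext h))
    obtain ⟨l, hl⟩ := exists_frac_of_ne_zero hϖ hk
    choose m hm using fun i => exists_mem_frac hϖ (e.repr x i)
    -- A nonzero coordinate bounds the indices `i` with `x ∈ L i` from above, and the least of the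
    -- three coordinate valuations provides one such index.
    obtain ⟨i, hi, himax⟩ := Int.exists_greatest_of_bdd (P := fun i => x ∈ diag hϖ e (expo s i))
      ⟨3 * l + 3 + s, fun i hi => by
        have h1 := (hl _).1 ((mem_diag hϖ).1 hi k)
        have h2 := k.isLt
        simp only [expo] at h1
        omega⟩
      ⟨s + 3 * (min (m 0) (min (m 1) (m 2))) - 2, (mem_diag hϖ).2 fun k => hm k _ (by
        simp only [expo]
        fin_cases k <;> simp <;> omega)⟩
    exact ⟨i, hi, fun h => by have := himax _ h; omega⟩
  exists_sub_mem i x y hx hy hy' := by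
    obtain ⟨k, hk⟩ := exists_index s i
    rw [mem_diag] at hx hy hy'
    have hyk : e.repr y k ∉ frac hϖ (expo s i k + 1) := by
      intro h
      refine hy' fun l => ?_
      rw [expo_add_one hk]
      split_ifs with hl
      · exact hl ▸ h
      · rw [add_zero]; exact hy l
    obtain ⟨r, hr⟩ := exists_eq_mul_of_frac hϖ (hx k) (hy k) hyk
    refine ⟨r, (mem_diag hϖ).2 fun l => ?_⟩
    rw [expo_add_one hk, ← algebraMap_smul K r y, map_sub, map_smul, Finsupp.sub_apply,
      Finsupp.smul_apply, smul_eq_mul]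
    split_ifs with hl
    · rw [hl, hr, sub_self]; exact Submodule.zero_mem _
    · rw [add_zero, ← Algebra.smul_def]
      exact Submodule.sub_mem _ (hx l) (Submodule.smul_mem _ _ (hy l))
  exists_mem i := by
    obtain ⟨k, hk⟩ := exists_index s i
    refine ⟨unif K hϖ ^ expo s i k • e k, (smul_basis_mem_diag hϖ).2 le_rfl, fun h => ?_⟩
    have := (smul_basis_mem_diag hϖ).1 h
    rw [expo_add_one hk, if_pos rfl] at this
    omega
  isLattice i := isLattice_diag hϖ

theorem mem_jumps_diag : j ∈ (diagFiltration hϖ e s).jumps (diag hϖ e d) ↔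
    ∃ k : Fin 3, (j - s - ((k : ℕ) : ℤ)) % 3 = 0 ∧ s + (k : ℕ) + 3 * d k ≤ j := by
  constructor
  · rintro ⟨x, hx, hxj, hxj'⟩
    obtain ⟨k, hk⟩ := exists_index s j
    refine ⟨k, hk, ?_⟩
    change x ∈ diag hϖ e (expo s j) at hxj
    change x ∉ diag hϖ e (expo s (j + 1)) at hxj'
    rw [mem_diag] at hx hxj hxj'
    by_contra! hlt
    refine hxj' fun l => ?_
    rw [expo_add_one hk]
    split_ifs with hl
    · subst hl
      refine frac_antitone hϖ ?_ (hx l)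
      simp only [expo]
      omega
    · rw [add_zero]; exact hxj l
  · rintro ⟨k, hk, hle⟩
    refine ⟨unif K hϖ ^ expo s j k • e k, (smul_basis_mem_diag hϖ).2 ?_,
      (smul_basis_mem_diag hϖ).2 le_rfl, fun h => ?_⟩
    · simp only [expo]; omega
    · have := (smul_basis_mem_diag hϖ).1 h
      rw [expo_add_one hk, if_pos rfl] at this
      omega

/-- The basis vector `e k` jumps at `s + k`, and scaling it by the `d k`-th power of the uniformizer
shifts this jump by `3 * d k`. In particular every position is realised by a diagonal lattice. -/
theorem pos_diag : (diagFiltration hϖ e s).Pos (diag hϖ e d) (s + 3 * d 0) (s + 1 + 3 * d 1)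
    (s + 2 + 3 * d 2) where
  isLattice := isLattice_diag hϖ
  ab := by omega
  bc := by omega
  ac := by omega
  mem_iff j := by
    rw [mem_jumps_diag, Fin.exists_fin_succ, Fin.exists_fin_two]
    simp only [Fin.val_zero, Fin.succ_zero_eq_one, Fin.succ_one_eq_two, Fin.val_one, Fin.val_two]
    omega

theorem diag_le_of_jumps (h : (diagFiltration hϖ e s).jumps (diag hϖ e d) ⊆
    (diagFiltration hϖ e s).jumps (diag hϖ e d')) : diag hϖ e d ≤ diag hϖ e d' := by
  rw [diag_le_iff]
  intro k
  have h1 := h ((mem_jumps_diag hϖ e s).2 ⟨k, by omega, le_refl (s + (k : ℕ) + 3 * d k)⟩)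
  obtain ⟨l, h2, h3⟩ := (mem_jumps_diag hϖ e s).1 h1
  have h4 := k.isLt
  have h5 := l.isLt
  obtain rfl : l = k := by ext; omega
  omega

/-- A family of lattices, closed under scaling, that behaves like the lattices spanned by
multiples of a basis with respect to the filtration; it represents the vertices in `A`. -/
structure Filtration.IsFrame (F : Filtration O K) (A : Set (Vertex O K))
    (𝓓 : Set (Submodule O (Fin 3 → K))) : Prop where
  zpow_smul_mem : ∀ N ∈ 𝓓, ∀ k : ℤ, F.u ^ k • N ∈ 𝓓
  exists_pos : ∀ a b c : ℤ, (b - a) % 3 ≠ 0 → (c - b) % 3 ≠ 0 → (c - a) % 3 ≠ 0 →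
    ∃ N ∈ 𝓓, F.Pos N a b c
  le_of_jumps : ∀ M ∈ 𝓓, ∀ N ∈ 𝓓, F.jumps N ⊆ F.jumps M → N ≤ M
  mem_iff : ∀ x, x ∈ A ↔ ∃ N ∈ 𝓓, Represents N x

theorem isFrame_diag : (diagFiltration hϖ e s).IsFrame (apartment e)
    (Set.range (diag hϖ e)) where
  zpow_smul_mem := by
    rintro _ ⟨d, rfl⟩ k
    exact ⟨_, (zpow_smul_diag hϖ k).symm⟩
  exists_pos a b c hab hbc hac := by
    have key : ∀ a b c : ℤ, (a - s) % 3 = 0 → (b - s) % 3 = 1 → (c - s) % 3 = 2 →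
        ∃ N ∈ Set.range (diag hϖ e), (diagFiltration hϖ e s).Pos N a b c := by
      intro a b c ha hb hc
      refine ⟨diag hϖ e ![(a - s) / 3, (b - s) / 3, (c - s) / 3], ⟨_, rfl⟩, ?_⟩
      convert pos_diag hϖ e s (d := ![(a - s) / 3, (b - s) / 3, (c - s) / 3]) using 1 <;>
        simp <;> omega
    rcases (by omega : (a - s) % 3 = 0 ∨ (a - s) % 3 = 1 ∨ (a - s) % 3 = 2) with ha | ha | ha <;>
      rcases (by omega : (b - s) % 3 = 0 ∨ (b - s) % 3 = 1 ∨ (b - s) % 3 = 2) with hb | hb | hb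
    · omega
    · obtain ⟨N, hN, h⟩ := key a b c ha hb (by omega)
      exact ⟨N, hN, h⟩
    · obtain ⟨N, hN, h⟩ := key a c b ha (by omega) hb
      exact ⟨N, hN, h.swap23⟩
    · obtain ⟨N, hN, h⟩ := key b a c hb ha (by omega)
      exact ⟨N, hN, h.swap12⟩
    · omega
    · obtain ⟨N, hN, h⟩ := key c a b (by omega) ha hb
      exact ⟨N, hN, h.swap12.swap23⟩
    · obtain ⟨N, hN, h⟩ := key b c a hb (by omega) ha
      exact ⟨N, hN, h.swap23.swap12⟩
    · obtain ⟨N, hN, h⟩ := key c b a (by omega) hb ha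
      exact ⟨N, hN, h.swap12.swap23.swap12⟩
    · omega
  le_of_jumps := by
    rintro _ ⟨d, rfl⟩ _ ⟨d', rfl⟩ h
    exact diag_le_of_jumps hϖ e s h
  mem_iff x := by
    rw [mem_apartment_iff hϖ]
    simp

end DiagonalFiltration

/-! ### Bringing a chamber of an apartment into standard form -/

section Chamber

variable {O K : Type*} [CommRing O] [IsDomain O] [IsDiscreteValuationRing O]
  [Field K] [Algebra O K] [IsFractionRing O K]
  {ϖ : O} (hϖ : Irreducible ϖ)

theorem diag_lt {e : Module.Basis (Fin 3) K (Fin 3 → K)} {d d' : Fin 3 → ℤ}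
    (h : diag hϖ e d < diag hϖ e d') : (∀ i, d' i ≤ d i) ∧ ∃ i, d' i < d i := by
  rw [lt_iff_le_not_ge, diag_le_iff, diag_le_iff] at h
  exact ⟨h.1, by simpa using h.2⟩

theorem apartment_congr {b e : Module.Basis (Fin 3) K (Fin 3 → K)} (a : Fin 3 → Kˣ)
    (t : Equiv.Perm (Fin 3)) (h : ∀ k, e k = a k • b (t k)) :
    apartment (O := O) e = apartment b := by
  ext x
  constructor
  · rintro ⟨c, hc⟩
    refine ⟨fun i => c (t.symm i) * a (t.symm i), ?_⟩
    convert hc using 2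
    rw [← t.surjective.range_comp]
    congr 1
    ext1 i
    simp [h, mul_smul]
  · rintro ⟨c, hc⟩
    refine ⟨fun k => c (t k) * (a k)⁻¹, ?_⟩
    convert hc using 2
    rw [← t.surjective.range_comp (fun i => c i • b i)]
    congr 1
    ext1 i
    simp [h, mul_smul]

/-- A chamber in an apartment is the chamber attached to a basis for this apartment. -/
theorem exists_basis_of_chamber {C : Chamber O K} {b : Module.Basis (Fin 3) K (Fin 3 → K)}
    (hb : ∀ x ∈ C.1, x ∈ apartment (O := O) b) :
    ∃ e : Module.Basis (Fin 3) K (Fin 3 → K), apartment (O := O) e = apartment b ∧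
      ∀ x, x ∈ C.1 ↔ Represents (diag hϖ e ![0, 0, 0]) x ∨ Represents (diag hϖ e ![1, 0, 0]) x ∨
        Represents (diag hϖ e ![1, 1, 0]) x := by
  set F := diagFiltration hϖ b 0
  have hFr := isFrame_diag hϖ b 0
  have key : ∀ {M N₁ N₂ a c c'}, F.IsFlag C M N₁ N₂ a c c' → ∃ d, M = diag hϖ b d := by
    intro M N₁ N₂ a c c' h
    obtain ⟨x, hx, hM⟩ := h.mem₀
    obtain ⟨d, hd⟩ := (mem_apartment_iff hϖ).1 (hb x hx)
    obtain ⟨k, rfl⟩ := F.exists_eq_zpow_smul hd hM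
    exact ⟨_, zpow_smul_diag hϖ k⟩
  obtain ⟨M, N₁, N₂, a, c, c', h, -⟩ := F.exists_flag C 0
  obtain ⟨d, rfl⟩ := key h
  obtain ⟨d1, rfl⟩ := key h.rotate
  obtain ⟨d2, rfl⟩ := key h.rotate.rotate
  have l3 := h.lt₃
  rw [show F.u • diag hϖ b d = diag hϖ b fun i => d i + 1 by
    have := zpow_smul_diag (e := b) (d := d) hϖ 1
    rwa [zpow_one] at this] at l3
  obtain ⟨h1, t0, ht0⟩ := diag_lt hϖ h.lt₁
  obtain ⟨h2, t1, ht1⟩ := diag_lt hϖ h.lt₂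
  obtain ⟨h3, t2, ht2⟩ := diag_lt hϖ l3
  -- From `d` to `d + 1` each exponent can grow by 1 only, so the coordinates moved by the three
  -- strict inclusions are distinct. Their order gives the permutation `t` of the basis.
  have h01 : t0 ≠ t1 := by rintro rfl; have := h3 t0; omega
  have h02 : t0 ≠ t2 := by rintro rfl; have := h2 t0; omega
  have h12 : t1 ≠ t2 := by rintro rfl; have := h1 t1; omega
  have hinj : Function.Injective ![t0, t1, t2] := by
    intro i j hij
    fin_cases i <;> fin_cases j <;> simp_all
  set t : Equiv.Perm (Fin 3) := Equiv.ofBijective _ (Finite.injective_iff_bijective.1 hinj)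
  have ht : ∀ k, t k = ![t0, t1, t2] k := fun _ => rfl
  set e : Module.Basis (Fin 3) K (Fin 3 → K) :=
    (b.unitsSMul fun i => unif K hϖ ^ d i).reindex t.symm
  have he : ∀ k, e k = unif K hϖ ^ d (t k) • b (t k) := fun k => by
    simp [e, Module.Basis.unitsSMul_apply]
  have hdiag : ∀ f g : Fin 3 → ℤ, (∀ k, g (t k) = d (t k) + f k) → diag hϖ b g = diag hϖ e f := by
    intro f g hfg
    rw [diag, diag, ← t.surjective.range_comp]
    congr 2
    ext1 k
    rw [Function.comp_apply, he, hfg, smul_smul, ← zpow_add, add_comm]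
  refine ⟨e, apartment_congr _ t he, fun x => ?_⟩
  rw [h.mem_iff, hdiag ![0, 0, 0] d, hdiag ![1, 0, 0] d1, hdiag ![1, 1, 0] d2]
  · intro k
    have e1 := h1 (t k); have e2 := h2 (t k); have e3 := h3 (t k)
    rw [ht] at *
    fin_cases k <;> simp at * <;> omega
  · intro k
    have e1 := h1 (t k); have e2 := h2 (t k); have e3 := h3 (t k)
    have e4 := h2 t2
    rw [ht] at *
    fin_cases k <;> simp at * <;> omega
  · intro k
    fin_cases k <;> simp

end Chamber

end A2Building

namespace A2Building

/-! ### Types of vertices as valuations of determinants -/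

section Types

variable {O K : Type*} [CommRing O] [IsDomain O] [IsDiscreteValuationRing O]
  [Field K] [Algebra O K] [IsFractionRing O K]

theorem exists_matrix_of_le {f g : Fin 3 → Fin 3 → K}
    (h : Submodule.span O (Set.range f) ≤ Submodule.span O (Set.range g)) :
    ∃ A : Matrix (Fin 3) (Fin 3) O,
      (Matrix.of f).det = algebraMap O K A.det * (Matrix.of g).det := by
  have h' : ∀ i, ∃ c : Fin 3 → O, ∑ j, c j • g j = f i := fun i =>
    (Submodule.mem_span_range_iff_exists_fun O).1 (h (Submodule.subset_span ⟨i, rfl⟩))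
  choose A hA using h'
  refine ⟨Matrix.of A, ?_⟩
  rw [RingHom.map_det, ← Matrix.det_mul]
  congr 1
  ext i j
  rw [Matrix.of_apply, ← hA i, Matrix.mul_apply, Finset.sum_apply]
  exact Finset.sum_congr rfl fun k _ => by
    rw [Pi.smul_apply, Algebra.smul_def]; rfl

/-- The determinant of a lattice is well-defined up to units. -/
theorem exists_det_eq {f g : Fin 3 → Fin 3 → K}
    (h : Submodule.span O (Set.range f) = Submodule.span O (Set.range g)) :
    ∃ w : Oˣ, (Matrix.of f).det = algebraMap O K w * (Matrix.of g).det := by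
  obtain ⟨A, hA⟩ := exists_matrix_of_le h.le
  obtain ⟨B, hB⟩ := exists_matrix_of_le h.ge
  by_cases h0 : (Matrix.of f).det = 0
  · exact ⟨1, by rw [h0, hB, h0]; simp⟩
  · refine ⟨Units.mkOfMulEqOne A.det B.det (IsFractionRing.injective O K ?_), hA⟩
    refine mul_right_cancel₀ h0 ?_
    rw [map_mul, map_one, one_mul, mul_assoc, ← hB, ← hA]

theorem det_units_smul (a : Fin 3 → Kˣ) (f : Fin 3 → Fin 3 → K) :
    (Matrix.of fun i => a i • f i).det = ((∏ i, a i : Kˣ) : K) * (Matrix.of f).det := by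
  have := Matrix.det_mul_column (fun i => (a i : K)) (Matrix.of f)
  rw [← Units.coe_prod] at this
  rw [← this]
  rfl

theorem span_units_smul (w : Fin 3 → Oˣ) (f : Fin 3 → Fin 3 → K) :
    Submodule.span O (Set.range fun i => (w i : O) • f i) = Submodule.span O (Set.range f) := by
  apply le_antisymm <;> rw [Submodule.span_le] <;> rintro _ ⟨i, rfl⟩
  · exact Submodule.smul_mem _ _ (Submodule.subset_span ⟨i, rfl⟩)
  · have : f i = ((w i)⁻¹ : Oˣ).1 • (w i : O) • f i := by
      rw [smul_smul, Units.inv_mul, one_smul]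
    rw [this]
    exact Submodule.smul_mem _ _ (Submodule.subset_span ⟨i, rfl⟩)

namespace Filtration

variable {F : Filtration O K} {M : Submodule O (Fin 3 → K)} {x : Vertex O K} {a b c s : ℤ}

/-- Vectors realising the three least jumps span a submodule with all jumps of `M`, hence `M`
itself. -/
theorem Pos.exists_span (h : F.Pos M a b c) : ∃ m : Fin 3 → Fin 3 → K,
    Submodule.span O (Set.range m) = M ∧ ∀ i, m i ∈ F.L (![a, b, c] i) ∧
      m i ∉ F.L (![a, b, c] i + 1) := by
  obtain ⟨x, hx, hx1⟩ := h.mem1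
  obtain ⟨y, hy, hy1⟩ := h.mem2
  obtain ⟨z, hz, hz1⟩ := h.mem3
  refine ⟨![x, y, z], ?_, fun i => by fin_cases i; exacts [hx1, hy1, hz1]⟩
  set N := Submodule.span O (Set.range ![x, y, z])
  have hN : N ≤ M := by
    rw [Submodule.span_le]
    rintro _ ⟨i, rfl⟩
    fin_cases i
    exacts [hx, hy, hz]
  have mx : a ∈ F.jumps N := ⟨x, Submodule.subset_span ⟨0, rfl⟩, hx1⟩
  have my : b ∈ F.jumps N := ⟨y, Submodule.subset_span ⟨1, rfl⟩, hy1⟩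
  have mz : c ∈ F.jumps N := ⟨z, Submodule.subset_span ⟨2, rfl⟩, hz1⟩
  have hup : ∀ j ∈ F.jumps N, ∀ n : ℕ, j + 3 * n ∈ F.jumps N := by
    intro j hj n
    induction n with
    | zero => simpa using hj
    | succ n ih =>
      have := add_three_mem_jumps ih
      rwa [show j + 3 * (n : ℤ) + 3 = j + 3 * ((n + 1 : ℕ) : ℤ) by push_cast; ring] at this
  refine eq_of_jumps_subset (F := F) h.isLattice hN fun j hj => ?_
  rw [h.mem_iff] at hj
  have hj' : ∃ i ∈ F.jumps N, i ≤ j ∧ (j - i) % 3 = 0 := by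
    rcases hj with hj | hj | hj
    exacts [⟨_, mx, by omega⟩, ⟨_, my, by omega⟩, ⟨_, mz, by omega⟩]
  obtain ⟨i, hi, h1, h2⟩ := hj'
  have := hup i hi ((j - i) / 3).toNat
  rwa [show i + 3 * (((j - i) / 3).toNat : ℤ) = j by omega] at this

theorem zpow_smul_mem_L_iff {x : Fin 3 → K} {k i : ℤ} : F.u ^ k • x ∈ F.L i ↔ x ∈ F.L (i - 3 * k) := by
  rw [show i = i - 3 * k + 3 * k by ring, ← zpow_smul_L, mem_units_smul, inv_smul_smul,
    add_sub_cancel_right]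

theorem span_eq_L {m : Fin 3 → Fin 3 → K} {s : ℤ} (t : Fin 3 → ℤ) (ht : ∀ i, s ≤ t i ∧ t i ≤ s + 2)
    (hinj : Function.Injective t) (hm : ∀ i, m i ∈ F.L (t i) ∧ m i ∉ F.L (t i + 1)) :
    Submodule.span O (Set.range m) = F.L s := by
  have h := F.pos_L s
  have hle : Submodule.span O (Set.range m) ≤ F.L s := by
    rw [Submodule.span_le]
    rintro _ ⟨i, rfl⟩
    exact F.L_antitone (ht i).1 (hm i).1
  have hup : ∀ i, ∀ n : ℕ, t i + 3 * n ∈ F.jumps (Submodule.span O (Set.range m)) := by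
    intro i n
    induction n with
    | zero => simpa using ⟨m i, Submodule.subset_span ⟨i, rfl⟩, hm i⟩
    | succ n ih =>
      have := add_three_mem_jumps ih
      rwa [show t i + 3 * (n : ℤ) + 3 = t i + 3 * ((n + 1 : ℕ) : ℤ) by push_cast; ring] at this
  refine eq_of_jumps_subset (F := F) h.isLattice hle fun j hj => ?_
  rw [jumps_L, Set.mem_Ici] at hj
  obtain ⟨i, hi⟩ : ∃ i, (j - t i) % 3 = 0 := by
    have h0 := ht 0
    have h1 := ht 1
    have h2 := ht 2
    have h01 : t 0 ≠ t 1 := fun e => by simpa using hinj e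
    have h02 : t 0 ≠ t 2 := fun e => by simpa using hinj e
    have h12 : t 1 ≠ t 2 := fun e => by simpa using hinj e
    by_contra! hne
    have n0 := hne 0
    have n1 := hne 1
    have n2 := hne 2
    omega
  have := hup i ((j - t i) / 3).toNat
  have hti := ht i
  rwa [show t i + 3 * (((j - t i) / 3).toNat : ℤ) = j by omega] at this

/-- A filtration is normalized if the determinants of its lattices have the expected valuation. -/
def Normalized (F : Filtration O K) : Prop :=
  ∃ (s : ℤ) (f : Fin 3 → Fin 3 → K) (w : Oˣ), Submodule.span O (Set.range f) = F.L s ∧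
    (Matrix.of f).det = algebraMap O K w * (F.u ^ s : Kˣ)

/-- Scaling the vectors of a spanning triple with the jumps of `M` by powers of `u` turns it into a
basis of `L s`. Comparing determinants gives valuation `charge M`, and the remaining unit is
absorbed into the first vector. -/
theorem Normalized.exists_det (hF : F.Normalized) (hM : M.IsLattice K) :
    ∃ m : Fin 3 → Fin 3 → K, Submodule.span O (Set.range m) = M ∧
      (Matrix.of m).det = (F.u ^ F.charge M : Kˣ) := by
  obtain ⟨s, f, w, hf, hdet⟩ := hF
  obtain ⟨a, b, c, h, -⟩ := exists_pos (F := F) hM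
  obtain ⟨m, hm, hmem⟩ := h.exists_span
  have h1 := h.ab
  have h2 := h.bc
  have h3 := h.ac
  have hc := h.charge_eq
  set k : Fin 3 → ℤ := ![(a - s) / 3, (b - s) / 3, (c - s) / 3] with hk
  have hspan := span_eq_L (F := F) (m := fun i => F.u ^ (-k i) • m i) (s := s)
    (fun i => ![a, b, c] i - 3 * k i)
    (fun i => by fin_cases i <;> simp [k] <;> omega)
    (fun i j hij => by fin_cases i <;> fin_cases j <;> simp [k] at hij ⊢ <;> omega)
    (fun i => by
      simp only [zpow_smul_mem_L_iff]
      rw [show ![a, b, c] i - 3 * k i - 3 * -k i = ![a, b, c] i by ring,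
        show ![a, b, c] i - 3 * k i + 1 - 3 * -k i = ![a, b, c] i + 1 by ring]
      exact hmem i)
  obtain ⟨w', hw'⟩ := exists_det_eq (hspan.trans hf.symm)
  rw [det_units_smul, hdet] at hw'
  have hprod : (∏ i, F.u ^ (-k i) : Kˣ) = F.u ^ (s - F.charge M) := by
    rw [Fin.prod_univ_three, ← zpow_add, ← zpow_add]
    congr 1
    simp only [k, Matrix.cons_val_zero, Matrix.cons_val_one, Matrix.cons_val]
    have r1 : (a - s) % 3 ≠ (b - s) % 3 := by omega
    have r2 : (b - s) % 3 ≠ (c - s) % 3 := by omega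
    have r3 : (a - s) % 3 ≠ (c - s) % 3 := by omega
    clear h1 h2 h3
    -- The residues are 0, 1, 2 in some order; hence the quotients add up to `charge M - s`.
    have r4 : (a - s) % 3 + (b - s) % 3 + (c - s) % 3 = 3 := by omega
    clear r1 r2 r3
    omega
  rw [hprod] at hw'
  have hdm : (Matrix.of m).det = algebraMap O K (w' * w : Oˣ) * (F.u ^ F.charge M : Kˣ) := by
    refine mul_left_cancel₀ (Units.ne_zero (F.u ^ (s - F.charge M))) ?_
    have hs : ((F.u ^ s : Kˣ) : K) = (F.u ^ (s - F.charge M) : Kˣ) * (F.u ^ F.charge M : Kˣ) := by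
      rw [← Units.val_mul, ← zpow_add, sub_add_cancel]
    rw [hw', Units.val_mul, map_mul, hs]
    ring
  refine ⟨fun i => (((![(w' * w)⁻¹, 1, 1] : Fin 3 → Oˣ) i : Oˣ) : O) • m i,
    by rw [span_units_smul, hm], ?_⟩
  have := Matrix.det_mul_column
    (fun i => algebraMap O K ((![(w' * w)⁻¹, 1, 1] : Fin 3 → Oˣ) i : Oˣ)) (Matrix.of m)
  rw [hdm, Fin.prod_univ_three] at this
  simp only [Matrix.cons_val_zero, Matrix.cons_val_one, Matrix.cons_val, Units.val_one, map_one,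
    mul_one] at this
  rw [← mul_assoc, ← map_mul, Units.inv_mul, map_one, one_mul] at this
  rw [← this]
  congr 1
  ext i j
  rw [Matrix.of_apply, Matrix.of_apply, Pi.smul_apply, Algebra.smul_def]
  rfl

theorem Normalized.hasType_iff (hF : F.Normalized) (hM : Represents M x) (i : Fin 3) :
    HasType i x ↔ (F.charge M - ((i : ℕ) : ℤ)) % 3 = 0 := by
  constructor
  · rintro ⟨ϖ', b, hϖ', hdet, hb⟩
    obtain ⟨k, hk⟩ := F.exists_eq_zpow_smul hM hb
    obtain ⟨m, hm, hmdet⟩ := hF.exists_det hb.isLattice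
    obtain ⟨w, hw⟩ := exists_det_eq hm
    obtain ⟨w', hw'⟩ := IsDiscreteValuationRing.associated_of_irreducible O F.irr hϖ'
    rw [hk, charge_zpow_smul hM.isLattice] at hmdet
    have hu : (F.u : K) = algebraMap O K F.ϖ := rfl
    have hb' : (Matrix.of b.row).det = algebraMap O K ((w' ^ (i : ℕ) : Oˣ) : O) *
        (F.u ^ ((i : ℕ) : ℤ) : Kˣ) := by
      rw [show (Matrix.of b.row) = b from rfl, hdet, ← hw', zpow_natCast, Units.val_pow_eq_pow_val,
        Units.val_pow_eq_pow_val, hu, map_mul, map_pow, mul_pow, mul_comm]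
    rw [hmdet, hb', ← mul_assoc, ← map_mul, ← Units.val_mul] at hw
    have e1 := unit_mul_zpow_mem_frac_iff (K := K) F.irr (k := F.charge M + 3 * k)
      (l := ((i : ℕ) : ℤ)) (w * w' ^ (i : ℕ))
    have e2 := zpow_mem_frac_iff (K := K) F.irr (k := ((i : ℕ) : ℤ)) (l := F.charge M + 3 * k)
    have e3 := unit_mul_zpow_mem_frac_iff (K := K) F.irr (k := ((i : ℕ) : ℤ))
      (l := ((i : ℕ) : ℤ)) (w * w' ^ (i : ℕ))
    have e4 := zpow_mem_frac_iff (K := K) F.irr (k := F.charge M + 3 * k) (l := F.charge M + 3 * k)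
    change _ = algebraMap O K _ * ((unif K F.irr ^ ((i : ℕ) : ℤ) : Kˣ) : K) at hw
    rw [← hw] at e1 e3
    have f1 := e1.1 (e4.2 le_rfl)
    have f2 := e2.1 (e3.2 le_rfl)
    omega
  · intro h
    have hM' := hM.smul (F.u ^ (-((F.charge M - ((i : ℕ) : ℤ)) / 3)))
    obtain ⟨m, hm, hdet⟩ := hF.exists_det hM'.isLattice
    rw [charge_zpow_smul hM.isLattice, show F.charge M +
      3 * -((F.charge M - ((i : ℕ) : ℤ)) / 3) = ((i : ℕ) : ℤ) by omega] at hdet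
    refine ⟨F.ϖ, Matrix.of m, F.irr, ?_, ?_⟩
    · rw [hdet, zpow_natCast, Units.val_pow_eq_pow_val]
      rfl
    · rw [← hm] at hM'
      exact hM'

end Filtration

/-- A chamber and an apartment that contains it come from a filtration. -/
theorem exists_isAdapted {C : Chamber O K} {b : Module.Basis (Fin 3) K (Fin 3 → K)}
    (hb : ∀ x ∈ C.1, x ∈ apartment (O := O) b) :
    ∃ (F : Filtration O K) (𝓓 : Set (Submodule O (Fin 3 → K))), IsAdapted F C ∧
      F.IsFrame (apartment b) 𝓓 := by
  obtain ⟨ϖ, hϖ⟩ := IsDiscreteValuationRing.exists_irreducible O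
  obtain ⟨e, he, hC⟩ := exists_basis_of_chamber hϖ hb
  have hdet : (Matrix.of e).det ≠ 0 := by
    have := (Pi.basisFun K (Fin 3)).isUnit_det e
    rw [Module.Basis.det_apply] at this
    rw [← Matrix.det_transpose]
    convert this.ne_zero using 2
    ext i j
    simp [Module.Basis.toMatrix_apply]
  -- The index shift `s` is the valuation of the determinant of the basis; with it, charge modulo 3
  -- agrees with the type.
  obtain ⟨s, w, hs⟩ := exists_zpow hϖ (Units.mk0 _ hdet)
  have h0 : expo s s = ![0, 0, 0] := by ext k; fin_cases k <;> simp [expo]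
  have h1 : expo s (s + 1) = ![1, 0, 0] := by ext k; fin_cases k <;> simp [expo]
  have h2 : expo s (s + 2) = ![1, 1, 0] := by ext k; fin_cases k <;> simp [expo]
  set F := diagFiltration hϖ e s
  have hF : F.Normalized := by
    refine ⟨s, e, w, ?_, hs⟩
    change _ = diag hϖ e (expo s s)
    rw [h0, diag]
    congr 2
    ext1 i
    fin_cases i <;> simp
  refine ⟨F, _, ⟨hF.hasType_iff, fun x => ?_⟩, he ▸ isFrame_diag hϖ e s⟩
  rw [hC, ← h0, ← h1, ← h2]
  change Represents (F.L s) x ∨ Represents (F.L (s + 1)) x ∨ Represents (F.L (s + 2)) x ↔ _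
  constructor
  · rintro (h | h | h)
    exacts [⟨_, h⟩, ⟨_, h⟩, ⟨_, h⟩]
  · rintro ⟨i, hi⟩
    have key : ∀ j, (i - j) % 3 = 0 → Represents (F.L j) x := by
      intro j hj
      have := hi.smul (F.u ^ ((j - i) / 3))
      rwa [Filtration.zpow_smul_L, show i + 3 * ((j - i) / 3) = j by omega] at this
    rcases (by omega : (i - s) % 3 = 0 ∨ (i - (s + 1)) % 3 = 0 ∨ (i - (s + 2)) % 3 = 0) with
      h | h | h
    exacts [Or.inl (key _ h), Or.inr (Or.inl (key _ h)), Or.inr (Or.inr (key _ h))]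

end Types

end A2Building

namespace A2Building

/-! ### Sites: existence in the apartment, adjacency and bases -/

section Sites

variable {O K : Type*} [CommRing O] [IsDomain O] [IsDiscreteValuationRing O]
  [Field K] [Algebra O K] [IsFractionRing O K]
  {F : Filtration O K} {A : Set (Vertex O K)} {𝓓 : Set (Submodule O (Fin 3 → K))}
  {C D E : Chamber O K} {M N : Submodule O (Fin 3 → K)}
  {x y : Vertex O K} {a b c a' b' c' r r' : ℤ} {n k k' : ℕ} {v : Fin 3 → Vertex O K}
  {τ : Fin 3 → ℤ} {i : Fin 3}

namespace Filtration

namespace IsFrame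

theorem exists_mem (h : F.IsFrame A 𝓓) (hx : x ∈ A) (hM : Represents M x) : M ∈ 𝓓 := by
  obtain ⟨N, hN, hNx⟩ := (h.mem_iff x).1 hx
  obtain ⟨k, rfl⟩ := F.exists_eq_zpow_smul hNx hM
  exact h.zpow_smul_mem N hN k

theorem le_of_pos (h : F.IsFrame A 𝓓) (hM : M ∈ 𝓓) (hN : N ∈ 𝓓) (hpM : F.Pos M a b c)
    (hpN : F.Pos N a' b' c') (ha : a ≤ a' ∧ (a' - a) % 3 = 0) (hb : b ≤ b' ∧ (b' - b) % 3 = 0)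
    (hc : c ≤ c' ∧ (c' - c) % 3 = 0) : N ≤ M :=
  h.le_of_jumps M hM N hN fun j hj => by
    rw [hpN.mem_iff] at hj
    rw [hpM.mem_iff]
    omega

/-- Every position occurs in the apartment. -/
theorem exists_summit (h : F.IsFrame A 𝓓) (h1 : (b - a) % 3 ≠ 0) (h2 : (c - b) % 3 ≠ 0)
    (h3 : (c - a) % 3 ≠ 0) (hab : a < b) (hbc : b < c) :
    ∃ D x, F.Summit D x a b c ∧ ∀ y ∈ D.1, y ∈ A := by
  obtain ⟨N, hN, hp⟩ := h.exists_pos a b c h1 h2 h3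
  obtain ⟨N₁, hN₁, hp₁⟩ := h.exists_pos b c (a + 3) (by omega) (by omega) (by omega)
  obtain ⟨N₂, hN₂, hp₂⟩ := h.exists_pos c (a + 3) (b + 3) (by omega) (by omega) (by omega)
  have huN : F.u • N ∈ 𝓓 := by simpa using h.zpow_smul_mem N hN 1
  obtain ⟨D, hD⟩ := IsFlag.of_pos hp hp₁ hp₂
    (h.le_of_pos hN hN₁ hp hp₁.swap23.swap12 (by omega) (by omega) (by omega))
    (h.le_of_pos hN₁ hN₂ hp₁.swap12 hp₂.swap23 (by omega) (by omega) (by omega))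
    (h.le_of_pos hN₂ huN hp₂ hp.u_smul.swap23.swap12 (by omega) (by omega) (by omega))
  obtain ⟨x, hx⟩ := exists_vertex hp.isLattice
  refine ⟨D, x, ⟨N, N₁, N₂, hx, hD, hab, hbc⟩, fun y hy => (h.mem_iff y).2 ?_⟩
  rcases (hD.mem_iff y).1 hy with hy | hy | hy
  exacts [⟨_, hN, hy⟩, ⟨_, hN₁, hy⟩, ⟨_, hN₂, hy⟩]

/-- A vertex of the apartment is determined by its position. -/
theorem eq_of_summit (h : F.IsFrame A 𝓓) (hx : x ∈ A) (hy : y ∈ A) (hD : F.Summit D x a b c)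
    (hE : F.Summit E y a b c) : x = y := by
  obtain ⟨M, _, _, hM, hDf, -, -⟩ := hD
  obtain ⟨N, _, _, hN, hEf, -, -⟩ := hE
  have e := h.le_of_pos (h.exists_mem hx hM) (h.exists_mem hy hN) hDf.pos₀ hEf.pos₀ (by omega)
    (by omega) (by omega)
  have := hDf.pos₀.eq_of_le hEf.pos₀ e
  exact hM.eq (this ▸ hN)

theorem adj (h : F.IsFrame A 𝓓) (hx : x ∈ A) (hy : y ∈ A) (hD : F.Summit D x a b c)
    (hE : F.Summit E y a (b + 3) c) : (graph O K).Adj x y := by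
  obtain ⟨M, _, _, hM, hDf, -, -⟩ := hD
  obtain ⟨N, _, _, hN, hEf, -, -⟩ := hE
  have hM' := h.exists_mem hx hM
  have hN' := h.exists_mem hy hN
  have huM : F.u • M ∈ 𝓓 := by simpa using h.zpow_smul_mem M hM' 1
  have l1 := h.le_of_pos hM' hN' hDf.pos₀ hEf.pos₀ (by omega) (by omega) (by omega)
  have l2 := h.le_of_pos hN' huM hEf.pos₀ hDf.pos₀.u_smul (by omega) (by omega) (by omega)
  have c0 := hDf.pos₀.charge_eq
  have c1 := hEf.pos₀.charge_eq
  have c2 := hDf.pos₀.u_smul.charge_eq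
  exact (F.adj_iff hM).2 ⟨N, hN, lt_of_le_of_ne l2 (by rintro rfl; omega),
    lt_of_le_of_ne l1 (by rintro rfl; omega)⟩

end IsFrame

/-- Except for the base chamber, a summit has only one peak. -/
theorem Summit.peak_unique (h : F.Summit D x a b c) (h' : F.Summit D y a' b' c') (hac : a + 2 < c) :
    x = y := by
  obtain ⟨M₀, M₁, M₂, hx, hD, hab, hbc⟩ := h
  have hy := (hD.mem_iff y).1 h'.mem
  rcases hy with hy | hy | hy
  · exact hx.eq hy
  · obtain ⟨k, _, _, hE⟩ := h'.exists_flag hy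
    obtain ⟨-, -, -, h1, h2⟩ := h'.residues
    -- A second peak at `M₁` would require `b < c < a + 3`, which contradicts `a + 2 < c`; the case
    -- of `M₂` is similar.
    obtain ⟨-, -, -, e1, e2, e3⟩ := hD.rotate.ext hE rfl
    have := hD.pos₀.ac
    omega
  · obtain ⟨k, _, _, hE⟩ := h'.exists_flag hy
    obtain ⟨-, -, -, h1, h2⟩ := h'.residues
    obtain ⟨-, -, -, e1, e2, e3⟩ := hD.rotate.rotate.ext hE rfl
    have := hD.pos₀.ac
    omega

theorem Summit.win_eq_iff (h : F.Summit D x a b c) :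
    F.win E = F.win D ↔ ∃ y, F.Summit E y a b c := by
  have key : ∀ i, F.win E = F.win D ↔ F.pos E i = F.pos D i ∧ F.pos E (i + 1) = F.pos D (i + 1) ∧
      F.pos E (i + 2) = F.pos D (i + 2) := by
    -- By periodicity, equality of windows may be tested on any three consecutive degrees, in
    -- particular from the charge of the peak on.
    have step : ∀ i, (F.pos E i = F.pos D i ∧ F.pos E (i + 1) = F.pos D (i + 1) ∧
      F.pos E (i + 2) = F.pos D (i + 2)) ↔ (F.pos E (i + 1) = F.pos D (i + 1) ∧
      F.pos E (i + 1 + 1) = F.pos D (i + 1 + 1) ∧ F.pos E (i + 1 + 2) = F.pos D (i + 1 + 2)) := by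
      intro i
      have e1 := (F.lat_add_three D i).2
      have e2 := (F.lat_add_three E i).2
      rw [show i + 1 + 1 = i + 2 by ring, show i + 1 + 2 = i + 3 by ring, e1, e2]
      constructor
      · rintro ⟨h1, h2, h3⟩; exact ⟨h2, h3, by rw [h1]⟩
      · rintro ⟨h1, h2, h3⟩; exact ⟨by omega, h1, h2⟩
    intro i
    induction i using Int.induction_on with
    | zero => simp [win, Prod.ext_iff]
    | succ i ih => rw [ih, step]
    | pred i ih => rw [ih, step (-i - 1), sub_add_cancel]
  obtain ⟨M₀, M₁, M₂, hx, hD, hab, hbc⟩ := h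
  obtain ⟨i, hi⟩ : ∃ i, F.charge M₀ = i := ⟨_, rfl⟩
  obtain ⟨-, -, -, rfl, rfl, rfl⟩ := hD.eq_lat_all hi
  rw [key i]
  constructor
  · rintro ⟨e1, e2, e3⟩
    obtain ⟨y, hy, hyE⟩ := F.exists_mem_represents_lat E i
    have := F.isFlag_lat E i
    rw [e1, e2, e3] at this
    exact ⟨y, _, _, _, hyE, this, hab, hbc⟩
  · rintro ⟨y, N₀, N₁, N₂, hy, hE, -, -⟩
    have c1 := hE.pos₀.charge_eq
    have c2 := hD.pos₀.charge_eq
    obtain ⟨-, -, -, e1, e2, e3⟩ := hE.eq_lat_all (i := i) (by omega)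
    exact ⟨e1.symm, e2.symm, e3.symm⟩

namespace Site

theorem of_mod (h : F.Site r n k D x) (hr : (r' - r) % 3 = 0) : F.Site r' n k D x := by
  refine ⟨h.1, ?_⟩
  convert h.2.shift ((r' - r) / 3) using 1 <;> omega

theorem eq_chamber (h : F.Site r n k D x) (h' : F.Site r' n k' E x) : D = E :=
  h.2.eq_chamber h'.2

theorem index_eq (h : F.Site r n k D x) (h' : F.Site r' n k' E x) : k = k' ∧ (r' - r) % 3 = 0 := by
  obtain ⟨l, h1, h2, h3⟩ := h.2.eq_shift h'.2
  omega

theorem peak_unique (h : F.Site r n k D x) (h' : F.Site r' n k' D y) (hn : 1 ≤ n) : x = y :=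
  h.2.peak_unique h'.2 (by omega)

theorem dist_eq (h : F.Site r n k D x) (hF : IsAdapted F C) : dist D C = n :=
  (h.isSummitAt hF).dist_eq

theorem eq_of_isSummitAt (h : F.Site r n k D x) (hF : IsAdapted F C) (hn : 1 ≤ n)
    (h' : IsSummitAt C n D y) : y = x := by
  obtain ⟨a, b, c, hS, -⟩ := hF.isSummitAt_iff.1 h'
  exact (h.2.peak_unique hS (by omega)).symm

theorem of_isSummitAt (h : F.Site r n k D x) (hF : IsAdapted F C) (h' : IsSummitAt C n E x) :
    F.Site r n k E x := by
  obtain ⟨a, b, c, hS, -⟩ := hF.isSummitAt_iff.1 h'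
  rwa [← h.2.eq_chamber hS]

theorem weylSphere_eq (h : F.Site r n k D x) (hF : IsAdapted F C) :
    weylSphere C (weylDist D C) = {E | ∃ y, F.Site r n k E y} := by
  rw [hF.weylSphere_eq]
  ext E
  rw [Set.mem_ofPred_eq, h.2.win_eq_iff, Set.mem_ofPred_eq]
  simp only [Site, h.1, true_and]

end Site

theorem IsFrame.exists_site (h : F.IsFrame A 𝓓) (r : ℤ) (hk : k ≤ n / 2) :
    ∃ D x, F.Site r n k D x ∧ ∀ y ∈ D.1, y ∈ A := by
  obtain ⟨-, h1, h2, h3, h4, h5⟩ := lev_of_eq (a := r) hk rfl rfl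
  obtain ⟨D, x, hS, hA⟩ := h.exists_summit h1 h2 h3 h4 h5
  exact ⟨D, x, ⟨hk, hS⟩, hA⟩

theorem IsFrame.adj_site (h : F.IsFrame A 𝓓) (hD : F.Site r n k D x) (hE : F.Site r n (k + 1) E y)
    (hx : x ∈ A) (hy : y ∈ A) : (graph O K).Adj x y := by
  refine h.adj hx hy hD.2 (E := E) ?_
  convert hE.2 using 1
  push_cast
  ring

theorem Site.of_adj (hF : IsAdapted F C) (h : F.Site r n k D x) (hn : 1 ≤ n)
    (hadj : (graph O K).Adj x y) (hy : y ∈ newVertices C n) :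
    (k + 1 ≤ n / 2 ∧ ∃ E, F.Site r n (k + 1) E y) ∨ (1 ≤ k ∧ ∃ E, F.Site r n (k - 1) E y) := by
  have hk := h.1
  have hl := h.lev_eq
  rcases hF.summit_of_adj h.2 (by omega) hadj (by rwa [hl]) with ⟨h1, E, hE⟩ | ⟨h1, E, hE⟩
  · refine Or.inl ⟨by omega, E, by omega, ?_⟩
    convert hE using 1
    push_cast
    ring
  · refine Or.inr ⟨by omega, E, by omega, ?_⟩
    convert hE.shift (-1) using 1 <;> omega

theorem Site.ncard_succ (h : F.Site r n k D x) (hk : k + 1 ≤ n / 2) :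
    {y | (∃ E, F.Site r n (k + 1) E y) ∧ (graph O K).Adj x y}.ncard =
      Nat.card (IsLocalRing.ResidueField O) := by
  rw [← h.2.ncard_up (by omega)]
  congr 1
  ext y
  refine and_congr_left' (exists_congr fun E => ?_)
  rw [Site, show r + 1 + ((n % 2 : ℕ) : ℤ) + 3 * ((k + 1 : ℕ) : ℤ) =
    r + 1 + ((n % 2 : ℕ) : ℤ) + 3 * (k : ℤ) + 3 by push_cast; ring]
  exact and_iff_right hk

theorem Site.ncard_pred (h : F.Site r n k D x) (hk : 1 ≤ k) :
    {y | (∃ E, F.Site r n (k - 1) E y) ∧ (graph O K).Adj x y}.ncard =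
      Nat.card (IsLocalRing.ResidueField O) := by
  rw [← h.2.ncard_down (by omega)]
  congr 1
  ext y
  have hk' := h.1
  refine and_congr_left' (exists_congr fun E => ⟨fun h => ?_, fun h => ⟨by omega, ?_⟩⟩)
  · convert h.2.shift 1 using 1 <;> omega
  · convert h.shift (-1) using 1 <;> omega

theorem Site.base_ne {E' : Chamber O K} {y' : Vertex O K} {l l' : ℕ} (h : F.Site r n k D x)
    (hl : l = k + 1 ∨ 1 ≤ k ∧ l = k - 1) (hl' : l' = k + 1 ∨ 1 ≤ k ∧ l' = k - 1)
    (hE : F.Site r n l E y) (hE' : F.Site r n l' E' y') (hy : (graph O K).Adj x y)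
    (hy' : (graph O K).Adj x y') (hne : y ≠ y') : base E y ≠ base E' y' := by
  have up : ∀ {l E y}, l = k + 1 → F.Site r n l E y → F.Summit E y r
      (r + 1 + (n % 2 : ℕ) + 3 * k + 3) (r + 2 + 2 * (n % 2 : ℕ) + 3 * (n / 2 : ℕ)) := by
    rintro l E y rfl h
    convert h.2 using 1
    push_cast
    ring
  have down : ∀ {l E y}, 1 ≤ k ∧ l = k - 1 → F.Site r n l E y → F.Summit E y (r + 3)
      (r + 1 + (n % 2 : ℕ) + 3 * k) (r + 2 + 2 * (n % 2 : ℕ) + 3 * (n / 2 : ℕ) + 3) := by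
    rintro l E y ⟨hk, rfl⟩ h
    convert h.2.shift 1 using 1 <;> omega
  rcases hl with hl | hl <;> rcases hl' with hl' | hl'
  · exact h.2.base_ne_of_up (up hl hE) (up hl' hE') hy hy' hne
  · exact Summit.base_ne_of_up_down (up hl hE) (down hl' hE')
  · exact (Summit.base_ne_of_up_down (up hl' hE') (down hl hE)).symm
  · exact h.2.base_ne_of_down (down hl hE) (down hl' hE') hy hy' hne

/-- The base of an inner summit. -/
theorem Site.base_inner (h : F.Site r n k D x) (h1 : 1 ≤ k) (h2 : k < n / 2) :
    ∃ E y E' y', F.Site r (n - 2) (k - 1) E y ∧ F.Site r (n - 2) k E' y' ∧ base D x = {y, y'} := by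
  obtain ⟨hk, M₀, M₁, M₂, hx, hD, hab, hbc⟩ := h
  obtain ⟨y, hy⟩ := exists_vertex hD.pos₁.isLattice
  obtain ⟨y', hy'⟩ := exists_vertex hD.pos₂.isLattice
  -- The base vertices have increasing positions `a + 3, b, c` and `a + 3, b + 3, c`. Shifting back
  -- by 3 gives level `n - 2` with indices `k - 1` and `k`.
  obtain ⟨E, hE⟩ := Summit.of_pos hy hD.pos₁.swap23.swap12 (by omega) (by omega)
  obtain ⟨E', hE'⟩ := Summit.of_pos hy' hD.pos₂.swap12.swap23 (by omega) (by omega)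
  refine ⟨E, y, E', y', ⟨by omega, ?_⟩, ⟨by omega, ?_⟩, ?_⟩
  · convert hE.shift (-1) using 1 <;> omega
  · convert hE'.shift (-1) using 1 <;> omega
  · ext z
    rw [IsAdapted.mem_base_iff hD hx]
    refine or_congr ⟨fun h => h.eq hy, ?_⟩ ⟨fun h => h.eq hy', ?_⟩
    · rintro rfl; exact hy
    · rintro h; exact h ▸ hy'

/-- The base of the first summit is an edge of a summit of the level below. -/
theorem Site.base_first (h : F.Site r n 0 D x) (hn : 1 ≤ n) :
    ∃ E, ∃ y ∈ base D x, F.Site (r + 1 + (n % 2 : ℕ)) (n - 1) 0 E y ∧ base D x ⊆ {z | z ∈ E.1} := by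
  obtain ⟨hk, M₀, M₁, M₂, hx, hD, hab, hbc⟩ := h
  obtain ⟨y, hy⟩ := exists_vertex hD.pos₁.isLattice
  have hp := hD.pos₁.swap23
  obtain ⟨E, hE⟩ := exists_isFlag_cut hp (by omega) (by omega)
  -- For `k = 0` the sorted position of `M₁` is `b, a + 3, c`, and removing its smallest jump `b`
  -- gives `M₂`. So `M₂` belongs to the nearest chamber at `M₁`.
  have hM₂ : M₂ = F.cut M₁ _ := hp.eq_cut2 (by omega) (by omega)
    (units_smul_le hD.lt₁.le |>.trans hD.lt₃.le) hD.lt₂.le hD.pos₂.swap12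
  have hS : F.Summit E y _ _ _ := ⟨_, _, _, hy, hE, by omega, by omega⟩
  refine ⟨E, y, (IsAdapted.mem_base_iff hD hx).2 (Or.inl hy), ⟨by omega, ?_⟩, fun z hz => ?_⟩
  · convert hS using 1 <;> omega
  · rcases (IsAdapted.mem_base_iff hD hx).1 hz with h | h
    · exact (hE.mem_iff z).2 (Or.inl h)
    · exact (hE.mem_iff z).2 (Or.inr (Or.inl (hM₂ ▸ h)))

/-- The base of the last summit is an edge of a summit of the level below. -/
theorem Site.base_last (h : F.Site r n (n / 2) D x) (hn : 1 ≤ n) :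
    ∃ E, ∃ y ∈ base D x, F.Site r (n - 1) ((n - 1) / 2) E y ∧ base D x ⊆ {z | z ∈ E.1} := by
  obtain ⟨hk, M₀, M₁, M₂, hx, hD, hab, hbc⟩ := h
  obtain ⟨y, hy⟩ := exists_vertex hD.pos₂.isLattice
  have hp := hD.pos₂.swap12
  obtain ⟨E, hE⟩ := exists_isFlag_cut hp (by omega) (by omega)
  -- For `k = n / 2` the sorted position of `M₂` is `a + 3, c, b + 3`, and `u M₁` is its third
  -- lattice.
  have hM₁ : F.u • M₁ = F.cut M₂ _ := hp.eq_cut3 (by omega) (by omega)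
    (units_smul_le hD.lt₂.le) (units_smul_le hD.lt₁.le |>.trans hD.lt₃.le) hD.pos₁.u_smul.swap23
  have hS : F.Summit E y _ _ _ := ⟨_, _, _, hy, hE, by omega, by omega⟩
  refine ⟨E, y, (IsAdapted.mem_base_iff hD hx).2 (Or.inr hy), ⟨by omega, ?_⟩, fun z hz => ?_⟩
  · convert hS.shift (-1) using 1 <;> omega
  · rcases (IsAdapted.mem_base_iff hD hx).1 hz with h | h
    · exact (hE.mem_iff z).2 (Or.inr (Or.inr (hM₁ ▸ h.smul _)))
    · exact (hE.mem_iff z).2 (Or.inl h)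

end Filtration

end Sites

end A2Building

namespace A2Building

/-! ### Existence and uniqueness of the labelling -/

section Labelling

variable {O K : Type*} [CommRing O] [IsDomain O] [IsDiscreteValuationRing O]
  [Field K] [Algebra O K] [IsFractionRing O K]
  {F : Filtration O K} {A : Set (Vertex O K)} {𝓓 : Set (Submodule O (Fin 3 → K))}
  {C : Chamber O K} {E E' : Chamber O K} {x y : Vertex O K} {r r' : ℤ} {n k k' j : ℕ}
  {v : Fin 3 → Vertex O K} {τ : Fin 3 → ℤ} {i i' : Fin 3} {D : Fin 3 → ℕ → ℕ → Chamber O K}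

open Filtration

theorem exists_isLabel (hF : IsAdapted F C) (hv : Set.range v = {x | x ∈ C.1}) :
    ∃ τ, F.IsLabel v τ := by
  have h : ∀ k, ∃ i, Represents (F.L i) (v k) := fun k =>
    (hF.mem_iff (v k)).1 (hv.le ⟨k, rfl⟩)
  choose τ hτ using h
  refine ⟨τ, hτ, fun i j hij hmod => ?_⟩
  have hinj : Function.Injective v := by
    classical
    have hC : Finset.univ.image v = C.1 := by
      ext x
      have : x ∈ Set.range v ↔ x ∈ C.1 := by rw [hv]; rfl
      simpa using this
    have := C.2.card_eq
    rw [← hC] at this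
    have h' := Finset.card_image_iff.1 (this.trans (Finset.card_fin 3).symm)
    rwa [Finset.coe_univ, Set.injOn_univ] at h'
  refine hij (hinj ?_)
  have h1 := (hτ i).smul (F.u ^ ((τ j - τ i) / 3))
  rw [zpow_smul_L, show τ i + 3 * ((τ j - τ i) / 3) = τ j by omega] at h1
  exact h1.eq (hτ j)

/-- The position of the sector to which the crown of `X v i n` belongs. -/
def apex (τ : Fin 3 → ℤ) (i : Fin 3) (n : ℕ) : ℤ := τ i + 2 * (n % 2 : ℕ)

/-- With this the crown at `n = 0`, defined separately as `{C}`, fits the description by sites. -/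
theorem site_zero_iff (hF : IsAdapted F C) : (∃ k x, F.Site r 0 k E x) ↔ E = C := by
  have key : ∀ {k x E}, F.Site r 0 k E x → E = C := by
    rintro k x E ⟨hk, M₀, M₁, M₂, hx, hE, -, -⟩
    obtain rfl : k = 0 := by omega
    simp only [Nat.zero_mod, Nat.zero_div, Nat.cast_zero, mul_zero, add_zero] at hE
    have h0 := hE.pos₀.eq_L
    have h1 : M₁ = F.L (r + 1) := Pos.eq_L (by convert hE.pos₁ using 1 <;> ring)
    have h2 : M₂ = F.L (r + 2) := Pos.eq_L (by convert hE.pos₂ using 1 <;> ring)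
    refine Subtype.ext (Finset.eq_of_subset_of_card_le (fun z hz => ?_) ?_)
    · rw [hF.mem_iff]
      rcases (hE.mem_iff z).1 hz with h | h | h
      exacts [⟨_, h0 ▸ h⟩, ⟨_, h1 ▸ h⟩, ⟨_, h2 ▸ h⟩]
    · rw [C.2.card_eq, E.2.card_eq]
  constructor
  · rintro ⟨k, x, h⟩
    exact key h
  · rintro rfl
    obtain ⟨x, hx⟩ := exists_vertex (F.isLattice r)
    obtain ⟨E', hE'⟩ := Summit.of_pos hx (F.pos_L r) (by omega) (by omega)
    have hs : F.Site r 0 0 E' x := ⟨le_rfl, by simpa using hE'⟩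
    exact ⟨0, x, key hs ▸ hs⟩

theorem mem_crown_iff_site (hF : IsAdapted F C) (hv : F.IsLabel v τ) :
    E ∈ crown C v i n ↔ ∃ k x, F.Site (apex τ i n) n k E x := by
  rcases Nat.eq_zero_or_pos n with rfl | hn
  · rw [site_zero_iff hF]
    simp [crown]
  · exact mem_crown_iff hF hv hn

/-- The labelling of the crown of `X v i n` starts at the end where `k = 0`. -/
def Forward (τ : Fin 3 → ℤ) (i : Fin 3) (n : ℕ) : Prop :=
  (τ (firstFace i) - τ i - (2 * (n % 2 : ℕ) - 1)) % 3 = 0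

open Classical in
/-- The index of the `j`-th chamber in the labelling of the crown of `X v i n`. -/
def rank (τ : Fin 3 → ℤ) (i : Fin 3) (n j : ℕ) : ℕ :=
  if Forward τ i n then j - 1 else n / 2 + 1 - j

theorem rank_of_forward (h : Forward τ i n) (j : ℕ) : rank τ i n j = j - 1 := if_pos h

theorem rank_of_not_forward (h : ¬ Forward τ i n) (j : ℕ) : rank τ i n j = n / 2 + 1 - j := if_neg h

theorem rank_cases (τ : Fin 3 → ℤ) (i : Fin 3) (n : ℕ) : (∀ j, rank τ i n j = j - 1) ∨
    (∀ j, rank τ i n j = n / 2 + 1 - j) := by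
  by_cases h : Forward τ i n
  exacts [Or.inl (rank_of_forward h), Or.inr (rank_of_not_forward h)]

theorem firstFace_ne (i : Fin 3) : firstFace i ≠ i ∧ lastFace i ≠ i ∧ firstFace i ≠ lastFace i := by
  decide +revert

/-- The row supporting the end `k = 0` has first jump `apex τ i n + 1 + n % 2`; the congruence on `τ
i'` says that this row is the crown with index `i'`. -/
theorem apex_pred_of_first (hn : 1 ≤ n) (hi : (τ i' - τ i - (2 * (n % 2 : ℕ) - 1)) % 3 = 0) :
    (apex τ i' (n - 1) - (apex τ i n + 1 + (n % 2 : ℕ))) % 3 = 0 := by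
  rcases (by omega : n % 2 = 0 ∧ (n - 1) % 2 = 1 ∨ n % 2 = 1 ∧ (n - 1) % 2 = 0) with
    ⟨h1, h2⟩ | ⟨h1, h2⟩ <;> simp only [apex, h1, h2] at hi ⊢ <;> omega

theorem apex_pred_of_last (hn : 1 ≤ n) (hi : (τ i' - τ i + (2 * (n % 2 : ℕ) - 1)) % 3 = 0) :
    (apex τ i' (n - 1) - apex τ i n) % 3 = 0 := by
  rcases (by omega : n % 2 = 0 ∧ (n - 1) % 2 = 1 ∨ n % 2 = 1 ∧ (n - 1) % 2 = 0) with
    ⟨h1, h2⟩ | ⟨h1, h2⟩ <;> simp only [apex, h1, h2] at hi ⊢ <;> omega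

/-- The three values of `τ` exhaust the residues modulo 3, so once one face is at the end `k = 0`,
the other one is at `k = n / 2`. -/
theorem faces_of_forward (hv : F.IsLabel v τ) (h : Forward τ i n) :
    (τ (lastFace i) - τ i + (2 * (n % 2 : ℕ) - 1)) % 3 = 0 := by
  obtain ⟨-, f2, f3⟩ := firstFace_ne i
  have g2 := hv.residue _ _ f2
  have g3 := hv.residue _ _ f3
  clear f2 f3
  rcases Nat.mod_two_eq_zero_or_one n with e | e <;> simp only [Forward, e] at h ⊢ <;> omega

theorem faces_of_not_forward (hv : F.IsLabel v τ) (h : ¬ Forward τ i n) :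
    (τ (firstFace i) - τ i + (2 * (n % 2 : ℕ) - 1)) % 3 = 0 ∧
      (τ (lastFace i) - τ i - (2 * (n % 2 : ℕ) - 1)) % 3 = 0 := by
  obtain ⟨f1, f2, f3⟩ := firstFace_ne i
  have g1 := hv.residue _ _ f1
  have g2 := hv.residue _ _ f2
  have g3 := hv.residue _ _ f3
  clear f1 f2 f3
  have h' : (τ (firstFace i) - τ i + (2 * (n % 2 : ℕ) - 1)) % 3 = 0 := by
    rcases Nat.mod_two_eq_zero_or_one n with e | e <;> simp only [Forward, e] at h ⊢ <;> omega
  refine ⟨h', ?_⟩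
  clear h
  rcases Nat.mod_two_eq_zero_or_one n with e | e <;> simp only [e] at h' ⊢ <;> omega

theorem exists_based_at_first (hF : IsAdapted F C)
    (h : F.Site (apex τ i n) n 0 E x) (hn : 1 ≤ n)
    (hi : (τ i' - τ i - (2 * (n % 2 : ℕ) - 1)) % 3 = 0) :
    ∃ E', ∃ y ∈ base E x, F.Site (apex τ i' (n - 1)) (n - 1) 0 E' y ∧ IsBasedAt C n E E' := by
  obtain ⟨E', y, hy, hE', hb⟩ := h.base_first hn
  exact ⟨E', y, hy, hE'.of_mod (apex_pred_of_first hn hi), x, h.isSummitAt hF, hb⟩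

theorem exists_based_at_last (hF : IsAdapted F C)
    (h : F.Site (apex τ i n) n (n / 2) E x) (hn : 1 ≤ n)
    (hi : (τ i' - τ i + (2 * (n % 2 : ℕ) - 1)) % 3 = 0) :
    ∃ E', ∃ y ∈ base E x, F.Site (apex τ i' (n - 1)) (n - 1) ((n - 1) / 2) E' y ∧
      IsBasedAt C n E E' := by
  obtain ⟨E', y, hy, hE', hb⟩ := h.base_last hn
  exact ⟨E', y, hy, hE'.of_mod (apex_pred_of_last hn hi), x, h.isSummitAt hF, hb⟩

/-- The apartment contains exactly one summit at each site; reading the row in the direction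
prescribed by `Forward` gives the labelling. -/
theorem IsFrame.exists_isCrownLabelling (hF : IsAdapted F C) (hA : F.IsFrame A 𝓓)
    (hv : F.IsLabel v τ) : ∃ D, IsCrownLabelling C v A D := by
  have h : ∀ i n k, ∃ D x, k ≤ n / 2 → F.Site (apex τ i n) n k D x ∧ ∀ y ∈ D.1, y ∈ A := by
    intro i n k
    by_cases hk : k ≤ n / 2
    · obtain ⟨D, x, h⟩ := hA.exists_site (apex τ i n) hk
      exact ⟨D, x, fun _ => h⟩
    · exact ⟨C, v 0, fun h => absurd h hk⟩
  choose D x hD using h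
  have hmem : ∀ {i n j}, j ∈ Set.Icc 1 (n / 2 + 1) → rank τ i n j ≤ n / 2 := by
    intro i n j hj
    rw [Set.mem_Icc] at hj
    rcases rank_cases τ i n with h | h <;> rw [h] <;> omega
  have hsite : ∀ {i n j}, j ∈ Set.Icc 1 (n / 2 + 1) →
      F.Site (apex τ i n) n (rank τ i n j) (D i n (rank τ i n j)) (x i n (rank τ i n j)) ∧
      ∀ y ∈ (D i n (rank τ i n j)).1, y ∈ A := fun hj => hD _ _ _ (hmem hj)
  have hends : ∀ {i n i'}, 0 < n → ∀ j ∈ Set.Icc 1 (n / 2 + 1),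
      (rank τ i n j = 0 ∧ (τ i' - τ i - (2 * (n % 2 : ℕ) - 1)) % 3 = 0 ∨
      rank τ i n j = n / 2 ∧ (τ i' - τ i + (2 * (n % 2 : ℕ) - 1)) % 3 = 0) →
      ∃ E ∈ crown C v i' (n - 1), IsBasedAt C n (D i n (rank τ i n j)) E := by
    intro i n i' hn j hj h
    have hs := (hsite (i := i) hj).1
    rcases h with ⟨h, hi⟩ | ⟨h, hi⟩ <;> rw [h] at hs ⊢
    · obtain ⟨E, y, -, hE, hb⟩ := exists_based_at_first hF hs hn hi
      exact ⟨E, (mem_crown_iff_site hF hv).2 ⟨_, _, hE⟩, hb⟩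
    · obtain ⟨E, y, -, hE, hb⟩ := exists_based_at_last hF hs hn hi
      exact ⟨E, (mem_crown_iff_site hF hv).2 ⟨_, _, hE⟩, hb⟩
  refine ⟨fun i n j => D i n (rank τ i n j), ⟨fun i n => ⟨?_, ?_, ?_⟩, ?_, ?_, ?_⟩⟩
  · intro j hj
    exact ⟨(mem_crown_iff_site hF hv).2 ⟨_, _, (hsite hj).1⟩, (hsite hj).2⟩
  · intro j hj j' hj' e
    have h1 := (hsite (i := i) hj).1
    have h2 := (hsite (i := i) hj').1
    simp only at e
    rw [← e] at h2
    -- At `n = 0` peaks are not unique, but then 0 is the only index.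
    have h3 : rank τ i n j = rank τ i n j' := by
      rcases Nat.eq_zero_or_pos n with rfl | hn
      · have := h1.1
        have := h2.1
        omega
      · exact (h1.index_eq (h1.peak_unique h2 hn ▸ h2)).1
    rw [Set.mem_Icc] at hj hj'
    rcases rank_cases τ i n with h | h <;> rw [h, h] at h3 <;> omega
  · rintro E ⟨hE, hEA⟩
    obtain ⟨k, y, hk⟩ := (mem_crown_iff_site hF hv).1 hE
    obtain ⟨j, hj, rfl⟩ : ∃ j ∈ Set.Icc 1 (n / 2 + 1), rank τ i n j = k := by
      have := hk.1
      rcases rank_cases τ i n with h | h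
      · exact ⟨k + 1, by rw [Set.mem_Icc]; omega, by rw [h]; omega⟩
      · exact ⟨n / 2 + 1 - k, by rw [Set.mem_Icc]; omega, by rw [h]; omega⟩
    obtain ⟨h1, h2⟩ := hsite (i := i) hj
    refine ⟨j, hj, h1.eq_chamber (r' := apex τ i n) (k' := rank τ i n j) ?_⟩
    rwa [hA.eq_of_summit (h2 _ h1.2.mem) (hEA _ hk.2.mem) h1.2 hk.2]
  · intro i n j hj
    have hj1 : j ∈ Set.Icc 1 (n / 2 + 1) := ⟨hj.1, by have := hj.2; omega⟩
    have hj2 : j + 1 ∈ Set.Icc 1 (n / 2 + 1) := ⟨by omega, by have := hj.2; omega⟩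
    obtain ⟨h1, h1A⟩ := hsite (i := i) hj1
    obtain ⟨h2, h2A⟩ := hsite (i := i) hj2
    refine ⟨_, _, h1.isSummitAt hF, h2.isSummitAt hF, ?_⟩
    rw [Set.mem_Icc] at hj
    have hx1 := h1A _ h1.2.mem
    have hx2 := h2A _ h2.2.mem
    rcases rank_cases τ i n with h | h
    · refine hA.adj_site h1 (k := rank τ i n j) (E := D i n (rank τ i n (j + 1))) ?_ hx1 hx2
      convert h2 using 1
      rw [h, h]; omega
    · refine (hA.adj_site h2 (E := D i n (rank τ i n j)) ?_ hx2 hx1).symm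
      convert h1 using 1
      rw [h, h]; omega
  · intro i n hn
    refine hends hn 1 ⟨le_rfl, by omega⟩ ?_
    by_cases h : Forward τ i n
    · exact Or.inl ⟨by rw [rank_of_forward h], h⟩
    · exact Or.inr ⟨by rw [rank_of_not_forward h]; omega, (faces_of_not_forward hv h).1⟩
  · intro i n hn
    refine hends hn (n / 2 + 1) ⟨by omega, le_rfl⟩ ?_
    by_cases h : Forward τ i n
    · exact Or.inr ⟨by rw [rank_of_forward h]; omega, faces_of_forward hv h⟩
    · exact Or.inl ⟨by rw [rank_of_not_forward h]; omega, (faces_of_not_forward hv h).2⟩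

/-- Steps of size 1 cannot turn back without violating injectivity, so `f` is monotone; its range
has only `m + 1` values, which fixes the starting point. -/
theorem eq_or_eq_of_steps {m : ℕ} {f : ℕ → ℕ} (hf : ∀ j ∈ Set.Icc 1 (m + 1), f j ≤ m)
    (hinj : Set.InjOn f (Set.Icc 1 (m + 1)))
    (hstep : ∀ j ∈ Set.Icc 1 m, f (j + 1) = f j + 1 ∨ f j = f (j + 1) + 1) :
    (∀ j ∈ Set.Icc 1 (m + 1), f j = j - 1) ∨ (∀ j ∈ Set.Icc 1 (m + 1), f j = m + 1 - j) := by
  simp only [Set.mem_Icc] at *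
  rcases Nat.eq_zero_or_pos m with rfl | hm
  · left
    intro j hj
    have := hf j hj
    omega
  have hdir : ∀ j, 1 ≤ j → j + 1 ≤ m → (f (j + 1) = f j + 1 ↔ f (j + 1 + 1) = f (j + 1) + 1) := by
    intro j h1 h2
    have s1 := hstep j (by omega)
    have s2 := hstep (j + 1) (by omega)
    have : f (j + 1 + 1) ≠ f j := fun e => by
      have := hinj (Set.mem_Icc.2 ⟨by omega, by omega⟩) (Set.mem_Icc.2 ⟨by omega, by omega⟩) e
      omega
    omega
  rcases hstep 1 (by omega) with h | h
  · have hall : ∀ j, 1 ≤ j → j ≤ m → f (j + 1) = f j + 1 := by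
      intro j hj
      induction j, hj using Nat.le_induction with
      | base => exact fun _ => h
      | succ j hj ih => exact fun hj' => (hdir j hj (by omega)).1 (ih (by omega))
    have hval : ∀ j, 1 ≤ j → j ≤ m + 1 → f j = f 1 + (j - 1) := by
      intro j hj
      induction j, hj using Nat.le_induction with
      | base => simp
      | succ j hj ih =>
        intro hj'
        rw [hall j hj (by omega), ih (by omega)]
        omega
    left
    intro j hj
    have e1 := hval (m + 1) (by omega) le_rfl
    have e2 := hf (m + 1) (by omega)
    have e3 := hval j hj.1 hj.2
    omega
  · have hall : ∀ j, 1 ≤ j → j ≤ m → f j = f (j + 1) + 1 := by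
      intro j hj
      induction j, hj using Nat.le_induction with
      | base => exact fun _ => h
      | succ j hj ih =>
        intro hj'
        have := ih (by omega)
        have := hdir j hj (by omega)
        have := hstep (j + 1) (by omega)
        omega
    have hval : ∀ j, 1 ≤ j → j ≤ m + 1 → f 1 = f j + (j - 1) := by
      intro j hj
      induction j, hj using Nat.le_induction with
      | base => simp
      | succ j hj ih =>
        intro hj'
        have := hall j hj (by omega)
        have := ih (by omega)
        omega
    right
    intro j hj
    have e1 := hval (m + 1) (by omega) le_rfl
    have e2 := hf 1 (by omega)
    have e3 := hval j hj.1 hj.2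
    omega

/-- If the base of a summit is an edge of a summit of the level below, then this summit
is determined by its level. -/
theorem eq_of_isBasedAt (hF : IsAdapted F C) (h : F.Site r n k E x) (hn : 1 ≤ n)
    (h' : F.Site r' (n - 1) k' E' y) (hy : y ∈ base E x) {E'' : Chamber O K}
    (hb : IsBasedAt C n E E'') (hd : dist E'' C = n - 1) : E'' = E' := by
  obtain ⟨z, hz, hz'⟩ := hb
  obtain rfl := h.eq_of_isSummitAt hF hn hz
  exact (h'.isSummitAt hF).unique _ (hz' hy) hd

/-- The chambers in a labelling are determined up to their Weyl distance to the base chamber. -/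
theorem IsCrownLabelling.exists_site (hD : IsCrownLabelling C v A D) (hF : IsAdapted F C)
    (hA : F.IsFrame A 𝓓) (hv : F.IsLabel v τ) (i : Fin 3) (n : ℕ) :
    ∀ j ∈ Set.Icc 1 (n / 2 + 1), ∃ x, F.Site (apex τ i n) n (rank τ i n j) (D i n j) x := by
  have h : ∀ j, ∃ k x, j ∈ Set.Icc 1 (n / 2 + 1) → F.Site (apex τ i n) n k (D i n j) x := by
    intro j
    by_cases hj : j ∈ Set.Icc 1 (n / 2 + 1)
    · obtain ⟨k, x, h⟩ := (mem_crown_iff_site hF hv).1 ((hD.bijOn i n).mapsTo hj).1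
      exact ⟨k, x, fun _ => h⟩
    · exact ⟨0, v 0, fun h => absurd h hj⟩
  choose f x hf using h
  suffices hfr : ∀ j ∈ Set.Icc 1 (n / 2 + 1), f j = rank τ i n j from
    fun j hj => ⟨x j, hfr j hj ▸ hf j hj⟩
  have hle : ∀ j ∈ Set.Icc 1 (n / 2 + 1), f j ≤ n / 2 := fun j hj => (hf j hj).1
  rcases Nat.eq_zero_or_pos (n / 2) with h0 | hm
  · intro j hj
    have := hle j hj
    rw [Set.mem_Icc] at hj
    rcases rank_cases τ i n with h | h <;> rw [h] <;> omega
  have hn : 1 ≤ n := by omega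
  have hinj : Set.InjOn f (Set.Icc 1 (n / 2 + 1)) := by
    intro j hj j' hj' e
    refine (hD.bijOn i n).injOn hj hj' ?_
    have h1 := hf j hj
    have h2 := hf j' hj'
    rw [← e] at h2
    have e' := hA.eq_of_summit (((hD.bijOn i n).mapsTo hj).2 _ h1.2.mem)
      (((hD.bijOn i n).mapsTo hj').2 _ h2.2.mem) h1.2 h2.2
    exact h1.eq_chamber (e' ▸ h2)
  have hstep : ∀ j ∈ Set.Icc 1 (n / 2), f (j + 1) = f j + 1 ∨ f j = f (j + 1) + 1 := by
    intro j hj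
    obtain ⟨y, z, hy, hz, hadj⟩ := hD.joined i n j hj
    rw [Set.mem_Icc] at hj
    have h1 := hf j (Set.mem_Icc.2 ⟨by omega, by omega⟩)
    have h2 := hf (j + 1) (Set.mem_Icc.2 ⟨by omega, by omega⟩)
    obtain rfl := h1.eq_of_isSummitAt hF hn hy
    obtain rfl := h2.eq_of_isSummitAt hF hn hz
    rcases h1.of_adj hF hn hadj hz.mem_new with ⟨-, E, hE⟩ | ⟨h3, E, hE⟩
    · exact Or.inl (h2.index_eq hE).1
    · have := (h2.index_eq hE).1
      omega
  have hj1 : 1 ∈ Set.Icc 1 (n / 2 + 1) := Set.mem_Icc.2 ⟨le_rfl, by omega⟩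
  have h1 := hf 1 hj1
  -- If the first chamber lay at the end facing `lastFace i`, its supporting summit would belong to
  -- two crowns of level `n - 1`, whose rows have different residues. Here `n ≥ 2`, so peaks at
  -- level `n - 1` are unique.
  have contra : ∀ E' y k', y ∈ base (D i n 1) (x 1) →
      F.Site (apex τ (lastFace i) (n - 1)) (n - 1) k' E' y → False := by
    intro E' y k' hy hE'
    obtain ⟨E, hE, hb⟩ := hD.first i n hn
    obtain ⟨k, z, hEs⟩ := (mem_crown_iff_site hF hv).1 hE
    obtain rfl := eq_of_isBasedAt hF h1 hn hE' hy hb (hEs.dist_eq hF)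
    obtain rfl := hE'.peak_unique hEs (by omega)
    have h2 := (hE'.index_eq hEs).2
    have h3 := hv.residue _ _ (firstFace_ne i).2.2.symm
    simp only [apex] at h2
    omega
  rcases eq_or_eq_of_steps hle hinj hstep with h | h
  · have hfw : Forward τ i n := by
      by_contra hfw
      have hf1 : f 1 = 0 := by rw [h 1 hj1]
      rw [hf1] at h1
      obtain ⟨E', y, hy, hE', -⟩ := exists_based_at_first hF h1 hn (faces_of_not_forward hv hfw).2
      exact contra E' y _ hy hE'
    intro j hj
    rw [h j hj, rank_of_forward hfw]
  · have hfw : ¬ Forward τ i n := by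
      intro hfw
      have hf1 : f 1 = n / 2 := by rw [h 1 hj1]; omega
      rw [hf1] at h1
      obtain ⟨E', y, hy, hE', -⟩ := exists_based_at_last hF h1 hn (faces_of_forward hv hfw)
      exact contra E' y _ hy hE'
    intro j hj
    rw [h j hj, rank_of_not_forward hfw]

end Labelling

end A2Building

namespace A2Building

/-! ### Weyl spheres as sites, and the arithmetic of labels -/

section Spheres

variable {O K : Type*} [CommRing O] [IsDomain O] [IsDiscreteValuationRing O]
  [Field K] [Algebra O K] [IsFractionRing O K]
  {F : Filtration O K} {C : Chamber O K} {D E : Chamber O K} {x y : Vertex O K} {r : ℤ}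
  {n k j : ℕ} {τ : Fin 3 → ℤ} {i : Fin 3}

open Filtration

theorem peaks_eq (hF : IsAdapted F C) (hn : 1 ≤ n) {S : Set (Chamber O K)}
    (hS : S = {E | ∃ x, F.Site r n k E x}) : peaks C n S = {x | ∃ E, F.Site r n k E x} := by
  subst hS
  ext x
  constructor
  · rintro ⟨E, ⟨y, hy⟩, hx⟩
    exact ⟨E, hy.eq_of_isSummitAt hF hn hx ▸ hy⟩
  · rintro ⟨E, hE⟩
    exact ⟨E, ⟨x, hE⟩, hE.isSummitAt hF⟩

/-- A site is a window class of length `n`, so it has `q ^ n` chambers; for `n ≥ 1` summit and peak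
determine each other. -/
theorem Filtration.Site.ncard_eq [Finite (IsLocalRing.ResidueField O)]
    (h : F.Site r n k D x) (hF : IsAdapted F C) (hn : 1 ≤ n) :
    {E | ∃ y, F.Site r n k E y}.ncard = Nat.card (IsLocalRing.ResidueField O) ^ n ∧
    {y | ∃ E, F.Site r n k E y}.ncard = Nat.card (IsLocalRing.ResidueField O) ^ n := by
  have h1 : {E | ∃ y, F.Site r n k E y} = {E | F.win E = F.win D} := by
    ext E
    rw [Set.mem_ofPred_eq, Set.mem_ofPred_eq, h.2.win_eq_iff]
    simp only [Site, h.1, true_and]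
  have h2 : {E | ∃ y, F.Site r n k E y}.ncard = Nat.card (IsLocalRing.ResidueField O) ^ n := by
    rw [h1, (hF.finite_and_ncard_win_eq (F.isWindow_win D)).2, h.2.len_win, h.lev_eq]
  refine ⟨h2, h2 ▸ Eq.symm ?_⟩
  choose f hf using fun (E : Chamber O K) (hE : ∃ y, F.Site r n k E y) => hE
  refine Set.ncard_congr f (fun E hE => ⟨E, hf E hE⟩) ?_ ?_
  · intro E E' hE hE' e
    have h4 := hf E' hE'
    rw [← e] at h4
    exact (hf E hE).eq_chamber h4
  · rintro y ⟨E, hE⟩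
    exact ⟨E, ⟨y, hE⟩, (hf E ⟨y, hE⟩).peak_unique hE hn⟩

theorem rank_injOn : Set.InjOn (rank τ i n) (Set.Icc 1 (n / 2 + 1)) := by
  intro j hj j' hj' e
  rw [Set.mem_Icc] at hj hj'
  rcases rank_cases τ i n with h | h <;> rw [h, h] at e <;> omega

theorem exists_rank_eq (hk : k ≤ n / 2) : ∃ j ∈ Set.Icc 1 (n / 2 + 1), rank τ i n j = k := by
  rcases rank_cases τ i n with h | h
  · exact ⟨k + 1, by rw [Set.mem_Icc]; omega, by rw [h]; omega⟩
  · exact ⟨n / 2 + 1 - k, by rw [Set.mem_Icc]; omega, by rw [h]; omega⟩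

/-- Consecutive labels correspond to consecutive indices. -/
theorem exists_rank_adj (hj : j ∈ Set.Icc 1 (n / 2 + 1)) :
    (rank τ i n j + 1 ≤ n / 2 → 1 < j ∧ rank τ i n j + 1 = rank τ i n (j - 1) ∨
      j < n / 2 + 1 ∧ rank τ i n j + 1 = rank τ i n (j + 1)) ∧
    (1 ≤ rank τ i n j → 1 < j ∧ rank τ i n j - 1 = rank τ i n (j - 1) ∨
      j < n / 2 + 1 ∧ rank τ i n j - 1 = rank τ i n (j + 1)) := by
  rw [Set.mem_Icc] at hj
  rcases rank_cases τ i n with h | h <;> rw [h, h, h] <;> omega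

theorem rank_adj (hj : j ∈ Set.Icc 1 (n / 2 + 1)) {l : ℕ} (hl : l ∈ Set.Icc 1 (n / 2 + 1))
    (hjl : l = j + 1 ∨ j = l + 1) : rank τ i n j + 1 ≤ n / 2 ∧ rank τ i n l = rank τ i n j + 1 ∨
      1 ≤ rank τ i n j ∧ rank τ i n l = rank τ i n j - 1 := by
  rw [Set.mem_Icc] at hj hl
  rcases rank_cases τ i n with h | h <;> simp only [h] <;> omega

theorem forward_sub_two (hn : 2 ≤ n) : Forward τ i (n - 2) ↔ Forward τ i n := by
  rw [Forward, Forward, show (n - 2) % 2 = n % 2 by omega]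

theorem apex_sub_two (hn : 2 ≤ n) : apex τ i (n - 2) = apex τ i n := by
  rw [apex, apex, show (n - 2) % 2 = n % 2 by omega]

/-- Exchanging `i` with `i'` and passing from `n` to `n - 1` changes the sign of the expression in
`Forward`. -/
theorem forward_pred (hn : 1 ≤ n) {i' : Fin 3} (hi' : firstFace i' = i) :
    Forward τ i' (n - 1) ↔ (τ i' - τ i - (2 * (n % 2 : ℕ) - 1)) % 3 = 0 := by
  rw [Forward, hi']
  rcases (by omega : n % 2 = 0 ∧ (n - 1) % 2 = 1 ∨ n % 2 = 1 ∧ (n - 1) % 2 = 0) with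
    ⟨h1, h2⟩ | ⟨h1, h2⟩ <;> simp only [h1, h2] <;> omega

/-- The end facing crown `i` carries label 1 in the crown with index `i'` because `firstFace i' =
i`; whether that end has index 0 or `(n - 1) / 2` matches the end of the upper row. -/
theorem exists_based_below (hF : IsAdapted F C) (hn : 1 ≤ n) {i' : Fin 3} (hi' : firstFace i' = i)
    (h : F.Site (apex τ i n) n k E x)
    (hk : k = 0 ∧ (τ i' - τ i - (2 * (n % 2 : ℕ) - 1)) % 3 = 0 ∨
      k = n / 2 ∧ ¬ (τ i' - τ i - (2 * (n % 2 : ℕ) - 1)) % 3 = 0 ∧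
        (τ i' - τ i + (2 * (n % 2 : ℕ) - 1)) % 3 = 0) :
    ∃ E' y, F.Site (apex τ i' (n - 1)) (n - 1) (rank τ i' (n - 1) 1) E' y ∧ IsBasedAt C n E E' := by
  rcases hk with ⟨rfl, hi⟩ | ⟨rfl, hi0, hi⟩
  · obtain ⟨E', y, -, hE, hb⟩ := exists_based_at_first hF h hn hi
    exact ⟨E', y, by rwa [rank_of_forward ((forward_pred hn hi').2 hi)], hb⟩
  · obtain ⟨E', y, -, hE, hb⟩ := exists_based_at_last hF h hn hi
    exact ⟨E', y, by rwa [rank_of_not_forward (mt (forward_pred hn hi').1 hi0),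
      Nat.add_sub_cancel], hb⟩

end Spheres

end A2Building

end

/-! ### The theorem, read off from sites and ranks -/

theorem mainTheorem4
    (O K : Type*) [CommRing O] [IsDomain O] [IsDiscreteValuationRing O]
    [Finite (IsLocalRing.ResidueField O)] [Field K] [Algebra O K] [IsFractionRing O K]
    (q : ℕ) (hq : q = Nat.card (IsLocalRing.ResidueField O))
    -- the chamber `C` with its vertices `v₀, v₁, v₂`
    (C : A2Building.Chamber O K) (v : Fin 3 → A2Building.Vertex O K)
    (hv : Set.range v = {x | x ∈ C.1})
    -- an apartment containing `C`
    (b : Module.Basis (Fin 3) K (Fin 3 → K))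
    (hb : ∀ x ∈ C.1, x ∈ A2Building.apartment (O := O) b) :
    (∃ D, A2Building.IsCrownLabelling C v (A2Building.apartment (O := O) b) D) ∧
    ∀ D, A2Building.IsCrownLabelling C v (A2Building.apartment (O := O) b) D →
    ∀ S : Fin 3 → ℕ → ℕ → Set (A2Building.Chamber O K),
    (∀ i n j, S i n j = A2Building.weylSphere C (A2Building.weylDist (D i n j) C)) →
    ∀ P : ℕ → ℕ → Set (A2Building.Vertex O K),
    (∀ n j, P n j = A2Building.peaks C n (S 0 n j)) →
    ∀ n m : ℕ, 1 ≤ n → m = n / 2 →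
      (A2Building.crown C v 0 n = ⋃ j ∈ Set.Icc 1 (m + 1), S 0 n j) ∧
      (Set.Icc 1 (m + 1)).PairwiseDisjoint (S 0 n) ∧
      ∀ j ∈ Set.Icc 1 (m + 1),
        -- neighbours in `P(n)` of a peak in `P_j`
        (∀ x ∈ P n j, ∀ y ∈ A2Building.newVertices C n, (A2Building.graph O K).Adj x y →
          (1 < j ∧ y ∈ P n (j - 1)) ∨ (j < m + 1 ∧ y ∈ P n (j + 1))) ∧
        -- distinct neighbours have summits with distinct bases
        (∀ x ∈ P n j, ∀ y ∈ A2Building.newVertices C n, ∀ y' ∈ A2Building.newVertices C n,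
          (A2Building.graph O K).Adj x y → (A2Building.graph O K).Adj x y' → y ≠ y' →
          ∀ E E', A2Building.IsSummitAt C n E y → A2Building.IsSummitAt C n E' y' →
            A2Building.base E y ≠ A2Building.base E' y') ∧
        -- bases of the inner summits
        (1 < j → j < m + 1 → ∀ E ∈ S 0 n j, ∃ x, A2Building.IsSummitAt C n E x ∧
          ∃ u ∈ P (n - 2) (j - 1), ∃ w ∈ P (n - 2) j, A2Building.base E x = {u, w}) ∧
        -- bases of the outer summits
        (j = 1 → ∀ E ∈ S 0 n j, ∃ F ∈ S 1 (n - 1) 1,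
          F ∈ A2Building.summits C (n - 1) ∧ A2Building.IsBasedAt C n E F) ∧
        (j = m + 1 → ∀ E ∈ S 0 n j, ∃ F ∈ S 2 (n - 1) 1,
          F ∈ A2Building.summits C (n - 1) ∧ A2Building.IsBasedAt C n E F) ∧
        -- numbers of neighbours
        (j < m + 1 → ∀ x ∈ P n j,
          {y | y ∈ P n (j + 1) ∧ (A2Building.graph O K).Adj x y}.ncard = q) ∧
        (1 < j → ∀ x ∈ P n j,
          {y | y ∈ P n (j - 1) ∧ (A2Building.graph O K).Adj x y}.ncard = q) ∧
        -- cardinalities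
        (S 0 n j).ncard = q ^ n ∧ (P n j).ncard = q ^ n := by
  obtain ⟨F, 𝓓, hF, hA⟩ := A2Building.exists_isAdapted hb
  obtain ⟨τ, hτ⟩ := A2Building.exists_isLabel hF hv
  refine ⟨A2Building.IsFrame.exists_isCrownLabelling hF hA hτ, ?_⟩
  intro D hD S hS P hP n m hn hm
  subst hq hm
  have hsite := fun i n => hD.exists_site hF hA hτ i n
  have hSeq : ∀ i n, ∀ j ∈ Set.Icc 1 (n / 2 + 1),
      S i n j = {E | ∃ x, F.Site (A2Building.apex τ i n) n (A2Building.rank τ i n j) E x} := by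
    intro i n j hj
    obtain ⟨x, hx⟩ := hsite i n j hj
    rw [hS, hx.weylSphere_eq hF]
  have hPeq : ∀ n, 1 ≤ n → ∀ j ∈ Set.Icc 1 (n / 2 + 1),
      P n j = {x | ∃ E, F.Site (A2Building.apex τ 0 n) n (A2Building.rank τ 0 n j) E x} := by
    intro n hn j hj
    rw [hP, A2Building.peaks_eq hF hn (hSeq 0 n j hj)]
  have hsub : ∀ {j}, j ∈ Set.Icc 1 (n / 2 + 1) → 1 < j → j - 1 ∈ Set.Icc 1 (n / 2 + 1) := by
    intro j hj h
    rw [Set.mem_Icc] at hj ⊢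
    omega
  have hadd : ∀ {j}, j ∈ Set.Icc 1 (n / 2 + 1) → j < n / 2 + 1 →
      j + 1 ∈ Set.Icc 1 (n / 2 + 1) := by
    intro j hj h
    rw [Set.mem_Icc] at hj ⊢
    omega
  -- Of the crowns 1 and 2 one faces the end `k = 0` and the other the end `k = n / 2`; which one is
  -- which depends on the parity of `n` and the cyclic order of the vertices.
  have hfaces : A2Building.Forward τ 0 n ∧
      (τ 1 - τ 0 - (2 * (n % 2 : ℕ) - 1)) % 3 = 0 ∧
      ¬ (τ 2 - τ 0 - (2 * (n % 2 : ℕ) - 1)) % 3 = 0 ∧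
      (τ 2 - τ 0 + (2 * (n % 2 : ℕ) - 1)) % 3 = 0 ∨
      ¬ A2Building.Forward τ 0 n ∧
      ¬ (τ 1 - τ 0 - (2 * (n % 2 : ℕ) - 1)) % 3 = 0 ∧
      (τ 1 - τ 0 + (2 * (n % 2 : ℕ) - 1)) % 3 = 0 ∧
      (τ 2 - τ 0 - (2 * (n % 2 : ℕ) - 1)) % 3 = 0 := by
    have h12 := hτ.residue 1 2 (by decide)
    by_cases h : A2Building.Forward τ 0 n
    · have h1 : (τ 1 - τ 0 - (2 * (n % 2 : ℕ) - 1)) % 3 = 0 := h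
      exact Or.inl ⟨h, h1, by omega, A2Building.faces_of_forward hτ h⟩
    · exact Or.inr ⟨h, h, A2Building.faces_of_not_forward hτ h⟩
  refine ⟨?_, ?_, fun j hj => ⟨?_, ?_, ?_, ?_, ?_, ?_, ?_, ?_⟩⟩
  · ext E
    simp only [A2Building.mem_crown_iff_site hF hτ, Set.mem_iUnion, exists_prop]
    constructor
    · rintro ⟨k, x, h⟩
      obtain ⟨j, hj, rfl⟩ := A2Building.exists_rank_eq (τ := τ) (i := 0) h.1
      exact ⟨j, hj, by rw [hSeq 0 n j hj]; exact ⟨x, h⟩⟩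
    · rintro ⟨j, hj, h⟩
      rw [hSeq 0 n j hj] at h
      exact ⟨_, h⟩
  · intro j hj j' hj' hne
    rw [Function.onFun, hSeq 0 n j hj, hSeq 0 n j' hj', Set.disjoint_left]
    rintro E ⟨x, hx⟩ ⟨y, hy⟩
    obtain rfl := hx.peak_unique hy hn
    exact hne (A2Building.rank_injOn hj hj' (hx.index_eq hy).1)
  · intro x hx y hy hadj
    rw [hPeq n hn j hj] at hx
    obtain ⟨E, hE⟩ := hx
    have key : ∀ l, (∃ E', F.Site (A2Building.apex τ 0 n) n l E' y) →
        (1 < j ∧ l = A2Building.rank τ 0 n (j - 1) ∨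
          j < n / 2 + 1 ∧ l = A2Building.rank τ 0 n (j + 1)) →
        (1 < j ∧ y ∈ P n (j - 1)) ∨ (j < n / 2 + 1 ∧ y ∈ P n (j + 1)) := by
      rintro l hl (⟨h1, rfl⟩ | ⟨h1, rfl⟩)
      · exact Or.inl ⟨h1, by rw [hPeq n hn _ (hsub hj h1)]; exact hl⟩
      · exact Or.inr ⟨h1, by rw [hPeq n hn _ (hadd hj h1)]; exact hl⟩
    rcases hE.of_adj hF hn hadj hy with ⟨h1, h2⟩ | ⟨h1, h2⟩
    · exact key _ h2 ((A2Building.exists_rank_adj hj).1 h1)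
    · exact key _ h2 ((A2Building.exists_rank_adj hj).2 h1)
  · intro x hx y hy y' hy' hadj hadj' hne E E' hE hE'
    rw [hPeq n hn j hj] at hx
    obtain ⟨D', hD'⟩ := hx
    have key : ∀ {y E}, y ∈ A2Building.newVertices C n → (A2Building.graph O K).Adj x y →
        A2Building.IsSummitAt C n E y → ∃ l, (l = A2Building.rank τ 0 n j + 1 ∨
          1 ≤ A2Building.rank τ 0 n j ∧ l = A2Building.rank τ 0 n j - 1) ∧
          F.Site (A2Building.apex τ 0 n) n l E y := by
      intro y E hy hadj hE
      rcases hD'.of_adj hF hn hadj hy with ⟨-, E', h⟩ | ⟨h1, E', h⟩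
      · exact ⟨_, Or.inl rfl, h.of_isSummitAt hF hE⟩
      · exact ⟨_, Or.inr ⟨h1, rfl⟩, h.of_isSummitAt hF hE⟩
    obtain ⟨l, hl, h⟩ := key hy hadj hE
    obtain ⟨l', hl', h'⟩ := key hy' hadj' hE'
    exact hD'.base_ne hl hl' h h' hadj hadj' hne
  · intro h1 h2 E hE
    rw [hSeq 0 n j hj] at hE
    obtain ⟨x, hx⟩ := hE
    refine ⟨x, hx.isSummitAt hF, ?_⟩
    have hn2 : (n - 2) / 2 = n / 2 - 1 := by omega
    have hj1 : j - 1 ∈ Set.Icc 1 ((n - 2) / 2 + 1) := by rw [Set.mem_Icc]; omega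
    have hj2 : j ∈ Set.Icc 1 ((n - 2) / 2 + 1) := by rw [Set.mem_Icc]; omega
    rw [hPeq (n - 2) (by omega) _ hj1, hPeq (n - 2) (by omega) _ hj2,
      A2Building.apex_sub_two (by omega)]
    -- The direction of labelling is the same at levels `n` and `n - 2`; in the reversed case label
    -- `j - 1` has index `k` and label `j` has index `k - 1`, so the two base vertices trade places.
    by_cases hf : A2Building.Forward τ 0 n
    · have hf' := (A2Building.forward_sub_two (by omega)).2 hf
      rw [A2Building.rank_of_forward hf] at hx
      rw [A2Building.rank_of_forward hf', A2Building.rank_of_forward hf']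
      obtain ⟨E, y, E', y', h3, h4, h5⟩ := hx.base_inner (by omega) (by omega)
      exact ⟨y, ⟨E, h3⟩, y', ⟨E', h4⟩, h5⟩
    · have hf' := mt (A2Building.forward_sub_two (by omega)).1 hf
      rw [A2Building.rank_of_not_forward hf] at hx
      rw [A2Building.rank_of_not_forward hf', A2Building.rank_of_not_forward hf']
      obtain ⟨E, y, E', y', h3, h4, h5⟩ := hx.base_inner (by omega) (by omega)
      refine ⟨y', ⟨E', ?_⟩, y, ⟨E, ?_⟩, h5.trans (Set.pair_comm y y')⟩
      · rwa [show (n - 2) / 2 + 1 - (j - 1) = n / 2 + 1 - j by omega]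
      · rwa [show (n - 2) / 2 + 1 - j = n / 2 + 1 - j - 1 by omega]
  · rintro rfl E hE
    rw [hSeq 0 n 1 hj] at hE
    obtain ⟨x, hx⟩ := hE
    obtain ⟨E', y, hE', hb'⟩ := A2Building.exists_based_below (i' := 1) hF hn rfl hx (by
      rcases hfaces with ⟨hf, h1, -, -⟩ | ⟨hf, h1, h2, -⟩
      · exact Or.inl ⟨A2Building.rank_of_forward hf 1, h1⟩
      · exact Or.inr ⟨by rw [A2Building.rank_of_not_forward hf, Nat.add_sub_cancel], h1, h2⟩)
    rw [hSeq 1 (n - 1) 1 (Set.mem_Icc.2 ⟨le_rfl, by omega⟩)]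
    exact ⟨E', ⟨y, hE'⟩, ⟨y, hE'.isSummitAt hF⟩, hb'⟩
  · rintro rfl E hE
    rw [hSeq 0 n _ hj] at hE
    obtain ⟨x, hx⟩ := hE
    obtain ⟨E', y, hE', hb'⟩ := A2Building.exists_based_below (i' := 2) hF hn rfl hx (by
      rcases hfaces with ⟨hf, -, h1, h2⟩ | ⟨hf, -, -, h1⟩
      · exact Or.inr ⟨by rw [A2Building.rank_of_forward hf, Nat.add_sub_cancel], h1, h2⟩
      · exact Or.inl ⟨by rw [A2Building.rank_of_not_forward hf, Nat.sub_self], h1⟩)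
    rw [hSeq 2 (n - 1) 1 (Set.mem_Icc.2 ⟨le_rfl, by omega⟩)]
    exact ⟨E', ⟨y, hE'⟩, ⟨y, hE'.isSummitAt hF⟩, hb'⟩
  · intro h x hx
    rw [hPeq n hn j hj] at hx
    obtain ⟨E, hE⟩ := hx
    rw [hPeq n hn _ (hadd hj h)]
    rcases A2Building.rank_adj (τ := τ) (i := 0) hj (hadd hj h) (Or.inl rfl) with ⟨h1, h2⟩ | ⟨h1, h2⟩
    · rw [h2]; exact hE.ncard_succ h1
    · rw [h2]; exact hE.ncard_pred h1
  · intro h x hx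
    rw [hPeq n hn j hj] at hx
    obtain ⟨E, hE⟩ := hx
    rw [hPeq n hn _ (hsub hj h)]
    rcases A2Building.rank_adj (τ := τ) (i := 0) hj (hsub hj h) (Or.inr (by omega)) with
      ⟨h1, h2⟩ | ⟨h1, h2⟩
    · rw [h2]; exact hE.ncard_succ h1
    · rw [h2]; exact hE.ncard_pred h1
  · obtain ⟨x, hx⟩ := hsite 0 n j hj
    rw [hPeq n hn j hj, hSeq 0 n j hj]
    exact hx.ncard_eq hF hn
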